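/- **Setting.** Let $d\ge 1$ be an integer, let $m>d/2$ be real, and let $f:\mathbb R^d\to\mathbb R$ be $1$-periodic in every coordinate and $N$ times continuously differentiable, where $N=\lceil m+d/2+2\rceil$ (so $N=m+d/2+2$ when this is an integer). Put $\mathcal X=[0,1]^d$ and $c_*=\inf_{x\in\mathcal X}f(x)$. Assume that the set of minimizers $\{x\in\mathcal X: f(x)=c_*\}$ is finite and that the Hessian of $f$ is positive definite at each of them. For $k\in\mathbb Z^d$ let $|k|=\sum_j|k_j|$, $e_k(x)=e^{-2\pi i k^\top x}$ and $\hat u_k=\int_{\mathcal X}e_k(x)u(x)\,dx$; let $\|u\|_F=\sum_{k\in\mathbb Z^d}|\hat u_k|$. For an integer $t\ge1$ let $n=\#\{k\in\mathbb Z^d:|k|\le t\}$, let $\phi_t(x)=(e_k(x))_{|k|\le t}\in\mathbb C^n$, and for a Hermitian positive semidefinite (PSD) $A\in\mathbb C^{n\times n}$ let $g_A(x)=\phi_t(x)^*A\,\phi_t(x)$. Let $M^{(k)}=\widehat{(\phi_t\phi_t^*)}_k\in\mathbb C^{n\times n}$ (entrywise), let $\langle A,B\rangle=\operatorname{tr}(A^*B)$,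 and let $\|\cdot\|_{\rm Frob}$ be the Frobenius norm. Let $$w_k=\|M^{(k)}\|_{\rm Frob}+\Big(1+\sum_{j=1}^d|2\pi k_j|^{d+1}\Big)^{-1},\qquad \pi_k=\frac{w_k}{\sum_{l\in\mathbb Z^d}w_l},$$ $$L_0(A)=\frac{\hat f_0-\langle A,M^{(0)}\rangle}{\pi_0},\qquad L_k(A)=-\frac{|\hat f_k-\langle A,M^{(k)}\rangle|}{\pi_k}\quad(k\ne0),$$ $$\|f\|_{C^{d+1}}=\max_{1\le j\le d}\ \max_{0\le q\le d+1}\Big\|\frac{\partial^q f}{\partial x_j^q}\Big\|_{L^\infty(\mathcal X)}.$$ For $\delta\in(0,1)$, frequencies $k_1,\dots,k_K\in\mathbb Z^d$ and PSD $A$, let $\hat c_{1-\delta}(A)=\frac1K\sum_{i=1}^K L_{k_i}(A)-\mathrm{Err}_{1-\delta}(A)$, where $$\mathrm{Err}_{1-\delta}(A)=\big(\sqrt{d+1}\,\|f\|_{C^{d+1}}+\|A\|_{\rm Frob}\big)\sqrt{\frac{2\log(2/\delta)}{K}}\Big(1+\sum_{k\in\mathbb Z^d}\|M^{(k)}\|_{\rm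 Frob}\Big).$$ For a cutoff $K\ge 0$ let $$\hat c_1(A)=\sum_{|k|\le K}\pi_kL_k(A)-\sum_{|k|>K}\big(|\hat f_k|+\|A\|_{\rm Frob}\|M^{(k)}\|_{\rm Frob}\big).$$ Projected stochastic gradient ascent: given a radius $R\ge 0$, a step size $\eta$ and frequencies $\kappa_0,\dots,\kappa_{T-1}$, set $A_0=0$, let $A_{i+1}$ be the Frobenius projection of $A_i+\eta\nabla L_{\kappa_i}(A_i)$ onto $\{A\text{ PSD}:\|A\|_{\rm Frob}\le R\}$, and output $\bar A_T=\frac1T\sum_{i=1}^TA_i$. Here $\nabla L_k$ is the gradient on the real inner product space of Hermitian matrices, and a fixed but arbitrary supergradient where $L_k$ is not differentiable. **Claim.** There is a constant $C_f$ depending only on $f,m,d$ such that the following holds for every integer $t\ge1$. 1. (A priori.) Let $R\ge\|A^*\|_{\rm Frob}$ for some PSD matrix $A^*$ which, together with some $c\in\mathbb R$, maximizes $c-\|f-c-g_A\|_F$ over all $c\in\mathbb R$ and all PSD $A$. Let $T,K\ge1$ and $\delta\in(0,1)$, and let $\eta=R/(G\sqrt T)$, where $G$ is any number with $\sup_k\|M^{(k)}\|_{\rm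 Frob}/\pi_k\le G\le\sum_kw_k$. Let $\bar A_T$ be computed from $T$ frequencies and $\hat c_{1-\delta}(\bar A_T)$ from $K$ further frequencies, all $T+K$ of them i.i.d. with law $\pi$. Then with probability at least $1-2\delta$ $$c_*\ \ge\ \hat c_{1-\delta}(\bar A_T)\ \ge\ c_*-C_ft^{-m}-8^d\,n\,t^d\left(\frac{20R\log(2/\delta)}{\sqrt T}+\frac{2\big(\sqrt{d+1}\,\|f\|_{C^{d+1}}+R\big)\sqrt{2\log(2/\delta)}}{\sqrt K}\right).$$ 2. (A posteriori.) For every point $x$ and every PSD matrix $A$: $f(x)\ge c_*\ge\hat c_1(A)$ for every cutoff $K\ge0$; and for all $K\ge1$ and $\delta\in(0,1)$, if $\hat c_{1-\delta}(A)$ is computed from $K$ i.i.d. frequencies with law $\pi$, then $f(x)\ge c_*\ge\hat c_{1-\delta}(A)$ with probability at least $1-\delta$. -/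

import Mathlib

open MeasureTheory ProbabilityTheory
open scoped Matrix ComplexOrder

namespace FourierPSD

noncomputable section

/-- The cube `[0,1]^d`. -/
def cube (d : ℕ) : Set (Fin d → ℝ) := Set.Icc 0 1

/-- `1`-periodicity in every coordinate. -/
def IsPeriodic {d : ℕ} (f : (Fin d → ℝ) → ℝ) : Prop :=
  ∀ (x : Fin d → ℝ) (k : Fin d → ℤ), f (x + fun j => (k j : ℝ)) = f x

/-- The infimum `c_*` of `f` over the cube. -/
def globalMin {d : ℕ} (f : (Fin d → ℝ) → ℝ) : ℝ := sInf (f '' cube d)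

/-- The global minimizers of `f` in the cube. -/
def minimizers {d : ℕ} (f : (Fin d → ℝ) → ℝ) : Set (Fin d → ℝ) :=
  {x | x ∈ cube d ∧ f x = globalMin f}

/-- The Hessian of `f` at `x` is positive definite. -/
def HasPosHessian {d : ℕ} (f : (Fin d → ℝ) → ℝ) (x : Fin d → ℝ) : Prop :=
  ∀ v : Fin d → ℝ, v ≠ 0 → 0 < iteratedFDeriv ℝ 2 f x (fun _ => v)

/-- The pure partial derivative `∂^q f / ∂ x_j^q` at `x`. -/
def partialDeriv {d : ℕ} (f : (Fin d → ℝ) → ℝ) (j : Fin d) (q : ℕ) (x : Fin d → ℝ) : ℝ :=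
  iteratedFDeriv ℝ q f x (fun _ => Pi.single j 1)

/-- The norm `‖f‖_{C^s}`: the largest supremum over the cube of a pure partial derivative
`∂^q f / ∂ x_j^q`, `1 ≤ j ≤ d`, `0 ≤ q ≤ s`. -/
def CNorm {d : ℕ} (s : ℕ) (f : (Fin d → ℝ) → ℝ) : ℝ :=
  ⨆ j : Fin d, ⨆ q : Fin (s + 1), ⨆ x : cube d, |partialDeriv f j q x|

/-- The `ℓ¹` length `|k|` of a frequency. -/
def len {d : ℕ} (k : Fin d → ℤ) : ℤ := ∑ j, |k j|

/-- The frequencies `k ∈ ℤ^d` with `|k| ≤ t` (every such `k` has all coordinates in `[-t, t]`). -/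
def band (d t : ℕ) : Finset (Fin d → ℤ) :=
  (Finset.Icc (fun _ => -(t : ℤ)) (fun _ => (t : ℤ))).filter (fun k => len k ≤ t)

theorem mem_band {d t : ℕ} {k : Fin d → ℤ} : k ∈ band d t ↔ len k ≤ t := by
  refine ⟨fun h => (Finset.mem_filter.mp h).2, fun h => Finset.mem_filter.mpr ⟨?_, h⟩⟩
  have hj : ∀ j, |k j| ≤ (t : ℤ) := fun j =>
    (Finset.single_le_sum (f := fun j => |k j|) (fun i _ => abs_nonneg (k i))
      (Finset.mem_univ j)).trans h
  exact Finset.mem_Icc.mpr ⟨fun j => (abs_le.mp (hj j)).1, fun j => (abs_le.mp (hj j)).2⟩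

/-- Complex matrices indexed by the frequencies `|k| ≤ t`. -/
abbrev BandMatrix (d t : ℕ) : Type := Matrix (band d t) (band d t) ℂ

/-- `e_k(x) = exp(-2πi k·x)`. -/
def expo {d : ℕ} (k : Fin d → ℤ) (x : Fin d → ℝ) : ℂ :=
  Complex.exp (-(2 * Real.pi * Complex.I) * ∑ j, (k j : ℂ) * (x j : ℂ))

/-- The `k`-th Fourier coefficient over the unit cube. -/
def fcoeff {d : ℕ} (u : (Fin d → ℝ) → ℂ) (k : Fin d → ℤ) : ℂ :=
  ∫ x in cube d, expo k x * u x

/-- The `F` norm of a periodic function: the `ℓ¹` norm of its Fourier coefficients. -/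
def FNorm {d : ℕ} (u : (Fin d → ℝ) → ℂ) : ℝ := ∑' k : Fin d → ℤ, ‖fcoeff u k‖

/-- The feature map `φ_t`. -/
def feature (d t : ℕ) (x : Fin d → ℝ) : band d t → ℂ := fun k => expo k.1 x

/-- The PSD model `g_A(x) = φ_t(x)^* A φ_t(x)`. -/
def model {d t : ℕ} (A : BandMatrix d t) (x : Fin d → ℝ) : ℂ :=
  star (feature d t x) ⬝ᵥ (A *ᵥ feature d t x)

/-- The objective `c - ‖f - c - g_A‖_F` of the relaxed problem. -/
def relaxObj {d t : ℕ} (f : (Fin d → ℝ) → ℝ) (c : ℝ) (A : BandMatrix d t) : ℝ :=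
  c - FNorm (fun x => (f x : ℂ) - (c : ℂ) - model A x)

/-- `A` is a positive semidefinite matrix which, together with some `c`, attains the maximum of
the relaxed problem. -/
def IsMaximizer {d t : ℕ} (f : (Fin d → ℝ) → ℝ) (A : BandMatrix d t) : Prop :=
  A.PosSemidef ∧ ∃ c : ℝ, ∀ (c' : ℝ) (A' : BandMatrix d t), A'.PosSemidef →
    relaxObj f c' A' ≤ relaxObj f c A

/-- The Frobenius inner product. -/
def frobInner {d t : ℕ} (A B : BandMatrix d t) : ℂ := (Aᴴ * B).trace

/-- The Frobenius norm. -/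
def frobNorm {d t : ℕ} (A : BandMatrix d t) : ℝ := √(∑ i, ∑ j, ‖A i j‖ ^ 2)

/-- `M^{(k)}`: the `k`-th Fourier coefficient of `x ↦ φ_t(x) φ_t(x)^*`, entry by entry. -/
def featCoeff (d t : ℕ) (k : Fin d → ℤ) : BandMatrix d t :=
  Matrix.of fun k₁ k₂ => fcoeff (fun x => feature d t x k₁ * star (feature d t x k₂)) k

/-- The unnormalized sampling weight of the frequency `k`. -/
def weight (d t : ℕ) (k : Fin d → ℤ) : ℝ :=
  frobNorm (featCoeff d t k) + (1 + ∑ j, |2 * Real.pi * (k j : ℝ)| ^ (d + 1))⁻¹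

/-- The sampling probability `π_k`. -/
def prob (d t : ℕ) (k : Fin d → ℤ) : ℝ := weight d t k / ∑' l : Fin d → ℤ, weight d t l

/-- The stochastic objective `L_k(A)`. For real `f` and Hermitian `A` the number under `re` is
real. -/
def stochObj {d t : ℕ} (f : (Fin d → ℝ) → ℝ) (k : Fin d → ℤ) (A : BandMatrix d t) : ℝ :=
  if k = 0 then
    (fcoeff (fun x => (f x : ℂ)) k - frobInner A (featCoeff d t k)).re / prob d t k
  else
    -‖fcoeff (fun x => (f x : ℂ)) k - frobInner A (featCoeff d t k)‖ / prob d t k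

/-- `D k A` is, for every `k` and every Hermitian `A`, a supergradient at `A` of the concave
function `L_k` on the real inner product space of Hermitian matrices (hence the gradient of `L_k`
wherever `L_k` is differentiable). -/
def IsSupergradient {d t : ℕ} (f : (Fin d → ℝ) → ℝ)
    (D : (Fin d → ℤ) → BandMatrix d t → BandMatrix d t) : Prop :=
  ∀ (k : Fin d → ℤ) (A : BandMatrix d t), A.IsHermitian → (D k A).IsHermitian ∧
    ∀ B : BandMatrix d t, B.IsHermitian →
      stochObj f k B ≤ stochObj f k A + (frobInner (D k A) (B - A)).re

/-- The feasible set of the projection step. -/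
def feasible (d t : ℕ) (R : ℝ) : Set (BandMatrix d t) :=
  {A | A.PosSemidef ∧ frobNorm A ≤ R}

/-- The Frobenius projection of `X` onto the feasible set, which is compact and convex, and
nonempty for `R ≥ 0`. -/
def proj {d t : ℕ} (R : ℝ) (X : BandMatrix d t) : BandMatrix d t :=
  Classical.epsilon fun A => A ∈ feasible d t R ∧
    ∀ B ∈ feasible d t R, frobNorm (A - X) ≤ frobNorm (B - X)

/-- The iterates `A_0, …, A_T` of projected stochastic gradient ascent with step size `η` along
the sampled frequencies `ks`. -/
def iterates {d t T : ℕ} (D : (Fin d → ℤ) → BandMatrix d t → BandMatrix d t) (R η : ℝ)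
    (ks : Fin T → (Fin d → ℤ)) : Fin (T + 1) → BandMatrix d t :=
  Fin.induction (motive := fun _ => BandMatrix d t) 0
    (fun i A => proj R (A + (η : ℂ) • D (ks i) A))

/-- The output `(1/T) ∑_{i=1}^T A_i`. -/
def sgaOutput {d t T : ℕ} (D : (Fin d → ℤ) → BandMatrix d t → BandMatrix d t) (R η : ℝ)
    (ks : Fin T → (Fin d → ℤ)) : BandMatrix d t :=
  (1 / (T : ℂ)) • ∑ i : Fin T, iterates D R η ks i.succ

/-- `Err_{1-δ}` for `K` samples. -/
def errSample {d t : ℕ} (f : (Fin d → ℝ) → ℝ) (δ : ℝ) (K : ℕ) (A : BandMatrix d t) : ℝ :=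
  (√((d : ℝ) + 1) * CNorm (d + 1) f + frobNorm A) * √(2 * Real.log (2 / δ) / (K : ℝ)) *
    (1 + ∑' k : Fin d → ℤ, frobNorm (featCoeff d t k))

/-- The sampled lower bound `ĉ_{1-δ}(A)` computed from the sampled frequencies `ks`. -/
def lowerSample {d t K : ℕ} (f : (Fin d → ℝ) → ℝ) (δ : ℝ) (ks : Fin K → (Fin d → ℤ))
    (A : BandMatrix d t) : ℝ :=
  1 / (K : ℝ) * ∑ i, stochObj f (ks i) A - errSample f δ K A

/-- The deterministic lower bound `ĉ_1(A)` with cutoff `K`. -/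
def lowerDet {d t : ℕ} (f : (Fin d → ℝ) → ℝ) (K : ℕ) (A : BandMatrix d t) : ℝ :=
  ∑ k ∈ band d K, prob d t k * stochObj f k A -
    ∑' k : {k : Fin d → ℤ // (K : ℤ) < len k},
      (‖fcoeff (fun x => (f x : ℂ)) k.1‖ + frobNorm A * frobNorm (featCoeff d t k.1))

/-- The random frequencies `κ i` are i.i.d. with law `π`. -/
def IsIIDSample {d : ℕ} (t : ℕ) {ι Ω : Type*} [MeasurableSpace Ω] (P : Measure Ω)
    (κ : ι → Ω → (Fin d → ℤ)) : Prop :=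
  (∀ i, Measurable (κ i)) ∧ iIndepFun κ P ∧ ∀ i k, P.real (κ i ⁻¹' {k}) = prob d t k

end

end FourierPSD

open FourierPSD

/-!
# Sampled lower bounds for the minimum of a smooth periodic function

Write `H(A) = ∑_k π_k L_k(A) = Re r_0 - ∑_{k ≠ 0} |r_k|`, where `r_k` is the `k`-th Fourier
coefficient of `f - g_A`; this is `expectedObj`. Three facts about `H` carry the result.

*Validity.* If `A` is positive semidefinite then `g_A ≥ 0`, hence `f ≥ f - g_A ≥ H(A)` pointwise by
Fourier inversion, and `H(A) ≤ c_*` (`expectedObj_le_globalMin`). The deterministic bound only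
replaces the terms of `H(A)` beyond the cutoff by lower bounds, and the sampled bound lies below
`H(A)` with high probability.

*Tightness.* `H(A) ≥ c - ‖f - c - g_A‖_F` for every `c`, and some `A` makes the right side at least
`c_* - C t^{-m}` for `c = c_*` (`exists_relaxObj_ge`). Indeed `f - c_*` is a finite sum of squares
of periodic functions `g_i` of class `C^{N-2}` (`exists_sum_sq`): near a minimizer this follows from
Taylor's formula with integral remainder and the positive Hessian, which loses two derivatives. With
`A` built from the truncated Fourier series of the `g_i`, the error is bounded by the `ℓ¹` tails of
the Fourier coefficients of the `g_i`, and the tail of a `C^s` function is `O(t^{-m})` for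
`s ≥ m + d/2` by Parseval's identity (`exists_tail_fcoeff_le`).

*Optimization and sampling.* `H` is concave and each `L_k` is Lipschitz with constant `G`. The
regret bound of projected supergradient ascent is deterministic (`IsSupergradient.regret_le`), and
passes to `H` by an Azuma-Hoeffding bound along the iterates (`measure_expectedObj_sgaOutput_lt`).
For a fixed `A`, Hoeffding's inequality controls how far the sample mean of `L_k(A)` falls below
`H(A)` (`measure_lowerSample_lt`). The constant in `Err` is too small for Hoeffding's inequality in
the upper direction; instead `measure_expectedObj_lt_lowerSample` uses that `L_k(A)` is bounded
above by a small `u`, so that its upper tail is sub-Gaussian with variance proxy the second moment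
of `u - L_k(A)`, which Minkowski's inequality bounds.

Each of the three bad events has probability at most `δ/2`.
-/

namespace FourierPSD

/-! ### Fourier series of lattice-periodic functions on the unit cube -/

section

attribute [local instance] instMeasureSpaceUnitAddCircle instIsAddHaarMeasureUnitAddCircleVolume
  instIsProbabilityMeasureUnitAddCircleVolume

/-- Periodicity with respect to `ℤ^d`, for functions with arbitrary values. -/
def LatticePeriodic {d : ℕ} {E : Type*} (u : (Fin d → ℝ) → E) : Prop :=
  ∀ (x : Fin d → ℝ) (k : Fin d → ℤ), u (x + fun j => (k j : ℝ)) = u x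

/-- The quotient map from `ℝ^d` to the torus. -/
def toTorus {d : ℕ} (x : Fin d → ℝ) : UnitAddTorus (Fin d) := fun j => (x j : UnitAddCircle)

variable {d : ℕ}

theorem isOpenQuotientMap_toTorus : IsOpenQuotientMap (toTorus (d := d)) :=
  IsOpenQuotientMap.piMap (f := fun (_ : Fin d) (y : ℝ) => (y : UnitAddCircle))
    fun _ => QuotientAddGroup.isOpenQuotientMap_mk

theorem toTorus_add (x y : Fin d → ℝ) : toTorus (x + y) = toTorus x + toTorus y := rfl

theorem mFourier_toTorus (k : Fin d → ℤ) (x : Fin d → ℝ) :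
    UnitAddTorus.mFourier (-k) (toTorus x) = expo k x := by
  simp only [UnitAddTorus.mFourier, toTorus, ContinuousMap.coe_mk, fourier_coe_apply, expo,
    ← Complex.exp_sum, Finset.mul_sum]
  congr 1
  refine Finset.sum_congr rfl fun j _ => ?_
  simp
  ring

theorem mFourier_toTorus' (k : Fin d → ℤ) (x : Fin d → ℝ) :
    UnitAddTorus.mFourier k (toTorus x) = star (expo k x) := by
  rw [← mFourier_toTorus, UnitAddTorus.mFourier_neg]
  simp

theorem integral_cube_toTorus {E : Type*} [NormedAddCommGroup E] [NormedSpace ℝ E]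
    (v : UnitAddTorus (Fin d) → E) : ∫ x in cube d, v (toTorus x) = ∫ y, v y := by
  rw [UnitAddTorus.integral_preimage v 0]
  have h := Measure.univ_pi_Ioc_ae_eq_Icc (ι := Fin d) (α := fun _ => ℝ) (μ := fun _ => volume)
    (f := 0) (g := 1)
  have h2 : {x : Fin d → ℝ | ∀ i, x i ∈ Set.Ioc ((0 : Fin d → ℝ) i) ((0 : Fin d → ℝ) i + 1)}
      = Set.univ.pi fun i => Set.Ioc ((0 : Fin d → ℝ) i) ((1 : Fin d → ℝ) i) := by
    ext x; simp [Set.mem_pi]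
  rw [h2]
  exact setIntegral_congr_set h.symm

/-- A continuous periodic function factors continuously through the torus. -/
theorem exists_torus_lift {E : Type*} [TopologicalSpace E] {u : (Fin d → ℝ) → E}
    (hc : Continuous u) (hp : LatticePeriodic u) :
    ∃ U : C(UnitAddTorus (Fin d), E), ∀ x, U (toTorus x) = u x := by
  have hfac : ∀ x y, toTorus x = toTorus y → u x = u y := by
    intro x y hxy
    have h : ∀ j, ∃ n : ℤ, x j = y j + n := by
      intro j
      have hj : ((x j : ℝ) : UnitAddCircle) = y j := congrFun hxy j
      have h0 : ((x j - y j : ℝ) : UnitAddCircle) = 0 := by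
        rw [AddCircle.coe_sub, hj, sub_self]
      obtain ⟨n, hn⟩ := (AddCircle.coe_eq_zero_iff (1 : ℝ)).1 h0
      refine ⟨n, ?_⟩
      simp at hn
      linarith
    choose k hk using h
    rw [show x = y + fun j => (k j : ℝ) from funext hk, hp]
  refine ⟨⟨fun y => u (Function.surjInv isOpenQuotientMap_toTorus.surjective y), ?_⟩, fun x => ?_⟩
  · rw [isOpenQuotientMap_toTorus.isQuotientMap.continuous_iff]
    exact hc.congr fun x => hfac _ _ (Function.surjInv_eq _ _).symm
  · exact hfac _ _ (Function.surjInv_eq _ _)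

theorem fcoeff_eq_mFourierCoeff {u : (Fin d → ℝ) → ℂ} {U : UnitAddTorus (Fin d) → ℂ}
    (hU : ∀ x, U (toTorus x) = u x) (k : Fin d → ℤ) :
    fcoeff u k = UnitAddTorus.mFourierCoeff U k := by
  unfold fcoeff UnitAddTorus.mFourierCoeff
  rw [← integral_cube_toTorus]
  simp only [mFourier_toTorus, hU, smul_eq_mul]

theorem norm_expo (k : Fin d → ℤ) (x : Fin d → ℝ) : ‖expo k x‖ = 1 := by
  unfold expo
  rw [show -(2 * (Real.pi : ℂ) * Complex.I) * ∑ j, (k j : ℂ) * (x j : ℂ)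
    = ((-(2 * Real.pi) * ∑ j, (k j : ℝ) * x j : ℝ) : ℂ) * Complex.I by push_cast; ring]
  exact Complex.norm_exp_ofReal_mul_I _

theorem continuous_expo (k : Fin d → ℤ) : Continuous (expo k) := by
  unfold expo; fun_prop

theorem expo_add (k l : Fin d → ℤ) (x : Fin d → ℝ) : expo (k + l) x = expo k x * expo l x := by
  unfold expo
  rw [← Complex.exp_add, ← mul_add, ← Finset.sum_add_distrib]
  simp [add_mul]

theorem expo_add_right (k : Fin d → ℤ) (x y : Fin d → ℝ) :
    expo k (x + y) = expo k x * expo k y := by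
  unfold expo
  rw [← Complex.exp_add, ← mul_add, ← Finset.sum_add_distrib]
  simp [mul_add]

@[simp] theorem expo_zero (x : Fin d → ℝ) : expo 0 x = 1 := by simp [expo]

theorem star_expo (k : Fin d → ℤ) (x : Fin d → ℝ) : star (expo k x) = expo (-k) x := by
  rw [← mFourier_toTorus', ← mFourier_toTorus, neg_neg]

theorem latticePeriodic_expo (k : Fin d → ℤ) : LatticePeriodic (expo k) := by
  intro x l
  rw [← mFourier_toTorus, ← mFourier_toTorus]
  congr 1
  funext j
  simp [toTorus]

theorem volume_cube : volume (cube d) = 1 := by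
  rw [cube, Real.volume_Icc_pi]; simp

instance isProbabilityMeasure_cube : IsProbabilityMeasure (volume.restrict (cube d)) :=
  ⟨by simp [volume_cube]⟩

theorem isCompact_cube : IsCompact (cube d) := isCompact_Icc

theorem integrableOn_cube_of_continuous {E : Type*} [NormedAddCommGroup E] {u : (Fin d → ℝ) → E}
    (hu : Continuous u) : IntegrableOn u (cube d) :=
  hu.continuousOn.integrableOn_compact isCompact_cube

/-- Orthogonality of the exponentials. -/
theorem integral_expo (k : Fin d → ℤ) : ∫ x in cube d, expo k x = if k = 0 then 1 else 0 := by
  have h := orthonormal_iff_ite.mp (UnitAddTorus.orthonormal_mFourier (d := Fin d)) k 0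
  simp only [ContinuousMap.inner_toLp, ← UnitAddTorus.mFourier_neg, ← UnitAddTorus.mFourier_add]
    at h
  rw [← h, ← integral_cube_toTorus]
  simp only [zero_add, mFourier_toTorus]

/-- Parseval's identity on the cube. -/
theorem hasSum_sq_fcoeff {u : (Fin d → ℝ) → ℂ} (hc : Continuous u) (hp : LatticePeriodic u) :
    HasSum (fun k => ‖fcoeff u k‖ ^ 2) (∫ x in cube d, ‖u x‖ ^ 2) := by
  obtain ⟨U, hU⟩ := exists_torus_lift hc hp
  have h := UnitAddTorus.hasSum_sq_mFourierCoeff (ContinuousMap.toLp 2 volume ℂ U)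
  simp only [UnitAddTorus.mFourierCoeff_toLp] at h
  simp only [fcoeff_eq_mFourierCoeff hU]
  convert h using 1
  simp only [← hU]
  rw [integral_cube_toTorus (fun y => ‖U y‖ ^ 2)]
  refine integral_congr_ae ?_
  filter_upwards [ContinuousMap.coeFn_toLp (p := 2) (𝕜 := ℂ) volume U] with y hy
  rw [hy]

/-- Fourier inversion for absolutely summable coefficients. -/
theorem hasSum_fourier_series {u : (Fin d → ℝ) → ℂ} (hc : Continuous u) (hp : LatticePeriodic u)
    (hs : Summable fun k => ‖fcoeff u k‖) (x : Fin d → ℝ) :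
    HasSum (fun k => fcoeff u k * star (expo k x)) (u x) := by
  obtain ⟨U, hU⟩ := exists_torus_lift hc hp
  have hs' : Summable (UnitAddTorus.mFourierCoeff U) := by
    refine Summable.of_norm (hs.congr fun k => ?_)
    rw [fcoeff_eq_mFourierCoeff hU]
  have h := UnitAddTorus.hasSum_mFourier_series_apply_of_summable hs' (toTorus x)
  simpa only [fcoeff_eq_mFourierCoeff hU, ← mFourier_toTorus', ← hU, smul_eq_mul] using h

/-- Integrals of periodic functions over the cube are invariant under translations. -/
theorem integral_cube_translate {u : (Fin d → ℝ) → ℂ} (hc : Continuous u)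
    (hp : LatticePeriodic u) (h : Fin d → ℝ) :
    ∫ x in cube d, u (x + h) = ∫ x in cube d, u x := by
  obtain ⟨U, hU⟩ := exists_torus_lift hc hp
  simp only [← hU, toTorus_add]
  rw [integral_cube_toTorus (fun y => U (y + toTorus h)), integral_cube_toTorus]
  exact integral_add_right_eq_self (μ := (volume : Measure (UnitAddTorus (Fin d)))) _ _

theorem norm_fcoeff_le {u : (Fin d → ℝ) → ℂ} {B : ℝ} (hB : ∀ x ∈ cube d, ‖u x‖ ≤ B)
    (k : Fin d → ℤ) : ‖fcoeff u k‖ ≤ B := by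
  have h := norm_setIntegral_le_of_norm_le_const (μ := volume) (s := cube d)
    (f := fun x => expo k x * u x) (C := B) (by rw [volume_cube]; exact ENNReal.one_lt_top)
    (fun x hx => by rw [norm_mul, norm_expo, one_mul]; exact hB x hx)
  simpa [fcoeff, Measure.real, volume_cube] using h

end

/-! ### Fourier coefficients of partial derivatives -/

section

variable {d : ℕ}

theorem LatticePeriodic.ofReal {u : (Fin d → ℝ) → ℝ} (h : LatticePeriodic u) :
    LatticePeriodic fun x => (u x : ℂ) := fun x k => by simp only [h x k]

theorem LatticePeriodic.mul {u v : (Fin d → ℝ) → ℂ} (hu : LatticePeriodic u)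
    (hv : LatticePeriodic v) : LatticePeriodic fun x => u x * v x :=
  fun x k => by simp only [hu x k, hv x k]

/-- Differentiating `h ↦ ∫ e_k(x) u(x + h e_j) dx = exp(2πi k_j h) û_k` at `h = 0` in both
expressions gives the Fourier coefficients of `∂_j u`. -/
theorem fcoeff_fderiv {u : (Fin d → ℝ) → ℝ} (hu : ContDiff ℝ 1 u) (hp : LatticePeriodic u)
    (j : Fin d) (k : Fin d → ℤ) :
    fcoeff (fun x => ((fderiv ℝ u x (Pi.single j 1) : ℝ) : ℂ)) k =
      2 * Real.pi * Complex.I * k j * fcoeff (fun x => (u x : ℂ)) k := by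
  set e : Fin d → ℝ := Pi.single j 1 with he
  have hcont : Continuous fun x => fderiv ℝ u x e :=
    (hu.continuous_fderiv (by norm_num)).clm_apply continuous_const
  -- the translated coefficient, in closed form
  have hexp : ∀ h : ℝ, expo k (-(h • e)) = Complex.exp (2 * Real.pi * Complex.I * k j * h) := by
    intro h
    unfold expo
    rw [Finset.sum_eq_single j]
    · simp [he]; ring_nf
    · intro b _ hb; simp [he, hb]
    · simp
  have hclosed : ∀ h : ℝ, ∫ x in cube d, expo k x * (u (x + h • e) : ℂ) =
      Complex.exp (2 * Real.pi * Complex.I * k j * h) * fcoeff (fun x => (u x : ℂ)) k := by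
    intro h
    have h1 := integral_cube_translate (u := fun x => expo k x * (u x : ℂ))
      ((continuous_expo k).mul (Complex.continuous_ofReal.comp hu.continuous))
      ((latticePeriodic_expo k).mul hp.ofReal) (h • e)
    rw [fcoeff, ← h1, ← hexp, ← integral_const_mul]
    refine integral_congr_ae (Filter.Eventually.of_forall fun x => ?_)
    have : expo k (-(h • e)) * expo k (h • e) = 1 := by
      rw [← expo_add_right]; simp [expo]
    simp only [expo_add_right]
    linear_combination (-(expo k x * (u (x + h • e) : ℂ))) * this
  -- differentiation under the integral sign
  obtain ⟨M, hM⟩ := (isCompact_closedBall (0 : Fin d → ℝ) 2).exists_bound_of_continuousOn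
    hcont.continuousOn
  have hdiff : ∀ (x : Fin d → ℝ) (h : ℝ),
      HasDerivAt (fun h : ℝ => expo k x * (u (x + h • e) : ℂ))
        (expo k x * ((fderiv ℝ u (x + h • e) e : ℝ) : ℂ)) h := by
    intro x h
    have h1 : HasDerivAt (fun h : ℝ => x + h • e) e h := by
      simpa using ((hasDerivAt_id h).smul_const e).const_add x
    have h2 := ((hu.differentiable (by norm_num)) (x + h • e)).hasFDerivAt.comp_hasDerivAt h h1
    exact h2.ofReal_comp.const_mul _
  have hmain := hasDerivAt_integral_of_dominated_loc_of_deriv_le (𝕜 := ℝ)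
    (μ := volume.restrict (cube d)) (F := fun (h : ℝ) x => expo k x * (u (x + h • e) : ℂ))
    (F' := fun h x => expo k x * ((fderiv ℝ u (x + h • e) e : ℝ) : ℂ)) (x₀ := (0 : ℝ))
    (s := Metric.ball 0 1) (bound := fun _ => M)
    (Metric.ball_mem_nhds _ one_pos)
    (Filter.Eventually.of_forall fun h => by
      have : Continuous fun x => expo k x * (u (x + h • e) : ℂ) :=
        (continuous_expo k).mul (Complex.continuous_ofReal.comp
          (hu.continuous.comp (continuous_id.add continuous_const)))
      exact this.aestronglyMeasurable)
    (by
      have : Continuous fun x => expo k x * (u (x + (0 : ℝ) • e) : ℂ) :=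
        (continuous_expo k).mul (Complex.continuous_ofReal.comp
          (hu.continuous.comp (continuous_id.add continuous_const)))
      exact integrableOn_cube_of_continuous this)
    (by
      have : Continuous fun x => expo k x * ((fderiv ℝ u (x + (0 : ℝ) • e) e : ℝ) : ℂ) :=
        (continuous_expo k).mul (Complex.continuous_ofReal.comp
          (hcont.comp (continuous_id.add continuous_const)))
      exact this.aestronglyMeasurable)
    (by
      refine (ae_restrict_iff' (measurableSet_Icc)).2 (Filter.Eventually.of_forall ?_)
      intro x hx h hh
      rw [norm_mul, norm_expo, one_mul, Complex.norm_real]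
      refine hM _ ?_
      rw [mem_closedBall_zero_iff]
      have hxn : ‖x‖ ≤ 1 := by
        rw [pi_norm_le_iff_of_nonneg zero_le_one]
        intro i
        rw [Real.norm_eq_abs, abs_le]
        have h0 := hx.1 i
        have h1 := hx.2 i
        simp at h0 h1
        constructor <;> linarith
      have hen : ‖h • e‖ ≤ 1 := by
        rw [norm_smul, he, Pi.norm_single, norm_one, mul_one]
        exact (mem_ball_zero_iff.1 hh).le
      exact (norm_add_le _ _).trans (by linarith))
    (integrable_const M)
    (Filter.Eventually.of_forall fun x h _ => hdiff x h)
  have h1 : HasDerivAt (fun h : ℝ => ∫ x in cube d, expo k x * (u (x + h • e) : ℂ))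
      (2 * Real.pi * Complex.I * k j * fcoeff (fun x => (u x : ℂ)) k) 0 := by
    rw [show (fun h : ℝ => ∫ x in cube d, expo k x * (u (x + h • e) : ℂ)) =
      fun h : ℝ => Complex.exp (2 * Real.pi * Complex.I * k j * h) *
        fcoeff (fun x => (u x : ℂ)) k from funext hclosed]
    have hl : HasDerivAt (fun h : ℝ => 2 * Real.pi * Complex.I * k j * (h : ℂ))
        (2 * Real.pi * Complex.I * k j * ((1 : ℝ) : ℂ)) 0 :=
      (hasDerivAt_id (0 : ℝ)).ofReal_comp.const_mul _
    have := hl.cexp.mul_const (fcoeff (fun x => (u x : ℂ)) k)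
    simpa using this
  have h2 := hmain.2.unique h1
  simpa [fcoeff] using h2

theorem partialDeriv_zero (g : (Fin d → ℝ) → ℝ) (j : Fin d) : partialDeriv g j 0 = g := by
  funext x; simp [partialDeriv]

theorem partialDeriv_succ {g : (Fin d → ℝ) → ℝ} (j : Fin d) (q : ℕ)
    (hg : ContDiff ℝ (q + 1 : ℕ) g) (x : Fin d → ℝ) :
    partialDeriv g j (q + 1) x = fderiv ℝ (partialDeriv g j q) x (Pi.single j 1) := by
  have hd : DifferentiableAt ℝ (iteratedFDeriv ℝ q g) x :=
    (hg.differentiable_iteratedFDeriv (by exact_mod_cast Nat.lt_succ_self q)) x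
  unfold partialDeriv
  rw [iteratedFDeriv_succ_apply_left, fderiv_continuousMultilinear_apply_const_apply hd]
  rfl

theorem contDiff_partialDeriv {g : (Fin d → ℝ) → ℝ} (j : Fin d) (q r : ℕ)
    (hg : ContDiff ℝ (r + q : ℕ) g) : ContDiff ℝ r (partialDeriv g j q) := by
  have h : ContDiff ℝ r (iteratedFDeriv ℝ q g) :=
    hg.iteratedFDeriv_right (by exact_mod_cast le_rfl)
  exact (ContinuousMultilinearMap.apply ℝ (fun _ : Fin q => Fin d → ℝ) ℝ
    (fun _ => Pi.single j 1)).contDiff.comp h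

theorem continuous_partialDeriv {g : (Fin d → ℝ) → ℝ} (j : Fin d) (q : ℕ)
    (hg : ContDiff ℝ q g) : Continuous (partialDeriv g j q) :=
  (contDiff_partialDeriv j q 0 (by simpa using hg)).continuous

theorem LatticePeriodic.partialDeriv {g : (Fin d → ℝ) → ℝ} (hp : LatticePeriodic g) (j : Fin d)
    (q : ℕ) : LatticePeriodic (partialDeriv g j q) := by
  intro x k
  unfold FourierPSD.partialDeriv
  rw [← iteratedFDeriv_comp_add_right]
  simp only [hp _ k]

theorem fcoeff_partialDeriv {g : (Fin d → ℝ) → ℝ} (hp : LatticePeriodic g) (j : Fin d)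
    (q : ℕ) (hg : ContDiff ℝ q g) (k : Fin d → ℤ) :
    fcoeff (fun x => (partialDeriv g j q x : ℂ)) k =
      (2 * Real.pi * Complex.I * k j) ^ q * fcoeff (fun x => (g x : ℂ)) k := by
  induction q with
  | zero => simp [partialDeriv_zero]
  | succ q ih =>
    have hq : ContDiff ℝ q g := hg.of_le (by exact_mod_cast Nat.le_succ q)
    have h1 := fcoeff_fderiv (contDiff_partialDeriv j q 1 (by rwa [add_comm])) (hp.partialDeriv j q)
      j k
    simp only [partialDeriv_succ j q hg]
    rw [h1, ih hq, pow_succ]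
    ring

/-- Parseval's identity for a pure partial derivative. -/
theorem hasSum_sq_fcoeff_partialDeriv {g : (Fin d → ℝ) → ℝ} (hp : LatticePeriodic g)
    (j : Fin d) (q : ℕ) (hg : ContDiff ℝ q g) :
    HasSum (fun k : Fin d → ℤ =>
        (|2 * Real.pi * (k j : ℝ)| ^ q * ‖fcoeff (fun x => (g x : ℂ)) k‖) ^ 2)
      (∫ x in cube d, (partialDeriv g j q x) ^ 2) := by
  have h := hasSum_sq_fcoeff (Complex.continuous_ofReal.comp (continuous_partialDeriv j q hg))
    (hp.partialDeriv j q).ofReal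
  simp only [Function.comp_def] at h
  convert h using 2
  · rename_i k
    rw [fcoeff_partialDeriv hp j q hg, norm_mul, norm_pow]
    congr 4
    have : (2 * (Real.pi : ℂ) * Complex.I * (k j : ℂ)) =
      ((2 * Real.pi * (k j : ℝ) : ℝ) : ℂ) * Complex.I := by push_cast; ring
    rw [this, norm_mul, Complex.norm_I, mul_one, Complex.norm_real, Real.norm_eq_abs]
  · funext x
    rw [Complex.norm_real, Real.norm_eq_abs, sq_abs]

theorem integral_sq_le_of_abs_le {u : (Fin d → ℝ) → ℝ} (hc : Continuous u) {B : ℝ}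
    (hB : ∀ x ∈ cube d, |u x| ≤ B) : ∫ x in cube d, (u x) ^ 2 ≤ B ^ 2 := by
  have h := setIntegral_mono_on (μ := volume) (s := cube d) (f := fun x => (u x) ^ 2)
    (g := fun _ => B ^ 2) (integrableOn_cube_of_continuous (hc.pow 2)) (integrable_const _)
    measurableSet_Icc (fun x hx => sq_le_sq' (abs_le.1 (hB x hx)).1 (abs_le.1 (hB x hx)).2)
  simpa [Measure.real, volume_cube] using h

end

/-! ### Lattice sums -/

section

variable {d : ℕ}

/-- The sup norm of a frequency. -/
def supLen (k : Fin d → ℤ) : ℕ := Finset.univ.sup fun j => (k j).natAbs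

theorem natAbs_le_supLen (k : Fin d → ℤ) (j : Fin d) : (k j).natAbs ≤ supLen k :=
  Finset.le_sup (f := fun j => (k j).natAbs) (Finset.mem_univ j)

theorem supLen_le_iff {k : Fin d → ℤ} {r : ℕ} : supLen k ≤ r ↔ ∀ j, (k j).natAbs ≤ r := by
  simp [supLen, Finset.sup_le_iff]

theorem exists_natAbs_eq_supLen [NeZero d] (k : Fin d → ℤ) : ∃ j, (k j).natAbs = supLen k := by
  obtain ⟨j, -, hj⟩ := Finset.exists_mem_eq_sup Finset.univ Finset.univ_nonempty
    fun j => (k j).natAbs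
  exact ⟨j, hj.symm⟩

theorem supLen_eq_zero_iff {k : Fin d → ℤ} : supLen k = 0 ↔ k = 0 := by
  rw [← Nat.le_zero, supLen_le_iff]
  simp [funext_iff]

theorem len_le_mul_supLen (k : Fin d → ℤ) : len k ≤ d * supLen k := by
  have : len k ≤ ∑ _j : Fin d, (supLen k : ℤ) := by
    refine Finset.sum_le_sum fun j _ => ?_
    rw [Int.abs_eq_natAbs]
    exact_mod_cast natAbs_le_supLen k j
  simpa using this

/-- The frequencies of sup norm at most `r`. -/
noncomputable def box (d r : ℕ) : Finset (Fin d → ℤ) :=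
  Fintype.piFinset fun _ => Finset.Icc (-(r : ℤ)) r

theorem mem_box {r : ℕ} {k : Fin d → ℤ} : k ∈ box d r ↔ supLen k ≤ r := by
  simp only [box, Fintype.mem_piFinset, Finset.mem_Icc, supLen_le_iff]
  refine forall_congr' fun j => ?_
  omega

theorem card_box (d r : ℕ) : (box d r).card = (2 * r + 1) ^ d := by
  simp only [box, Fintype.card_piFinset, Int.card_Icc, Finset.prod_const, Finset.card_univ,
    Fintype.card_fin]
  congr 1
  omega

/-- The frequencies of sup norm exactly `r`. -/
noncomputable def shell (d r : ℕ) : Finset (Fin d → ℤ) := (box d r).filter fun k => supLen k = r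

theorem mem_shell {r : ℕ} {k : Fin d → ℤ} : k ∈ shell d r ↔ supLen k = r := by
  simp only [shell, Finset.mem_filter, mem_box, and_iff_right_iff_imp]
  exact fun h => h.le

theorem card_shell_zero : (shell d 0).card = 1 := by
  rw [Finset.card_eq_one]
  exact ⟨0, by ext k; simp [mem_shell, supLen_eq_zero_iff]⟩

theorem card_shell_le {r : ℕ} (hr : 1 ≤ r) :
    ((shell d r).card : ℝ) ≤ 2 * d * (3 * (r : ℝ)) ^ (d - 1) := by
  have h1 : shell d r = box d r \ box d (r - 1) := by
    ext k
    simp only [mem_shell, Finset.mem_sdiff, mem_box]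
    omega
  have hsub : box d (r - 1) ⊆ box d r := fun k hk => by
    rw [mem_box] at hk ⊢
    omega
  have h2 : ((shell d r).card : ℝ) = (2 * (r : ℝ) + 1) ^ d - (2 * (r : ℝ) - 1) ^ d := by
    rw [h1, Finset.card_sdiff_of_subset hsub, Nat.cast_sub (Finset.card_le_card hsub), card_box,
      card_box]
    push_cast [Nat.cast_sub hr]
    ring
  have hr' : (1 : ℝ) ≤ r := by exact_mod_cast hr
  have h3 := abs_pow_sub_pow_le (2 * (r : ℝ) + 1) (2 * (r : ℝ) - 1) d
  rw [abs_of_nonneg (by linarith : (0 : ℝ) ≤ 2 * (r : ℝ) + 1),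
    abs_of_nonneg (by linarith : (0 : ℝ) ≤ 2 * (r : ℝ) - 1),
    max_eq_left (by linarith)] at h3
  rw [h2]
  refine (le_abs_self _).trans (h3.trans ?_)
  rw [show 2 * (r : ℝ) + 1 - (2 * (r : ℝ) - 1) = 2 by ring, abs_two]
  gcongr
  linarith

/-- Summation by shells of constant sup norm. -/
theorem tsum_comp_supLen (φ : ℕ → ENNReal) :
    ∑' k : Fin d → ℤ, φ (supLen k) = ∑' r : ℕ, (shell d r).card * φ r := by
  have h1 : ∀ k : Fin d → ℤ, φ (supLen k) = ∑' r : ℕ, if supLen k = r then φ r else 0 := by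
    intro k
    rw [tsum_eq_single (supLen k) (fun r hr => if_neg hr.symm), if_pos rfl]
  simp_rw [h1]
  rw [ENNReal.tsum_comm]
  refine tsum_congr fun r => ?_
  rw [tsum_eq_sum (s := shell d r) (fun k hk => if_neg (by rwa [mem_shell] at hk)),
    Finset.sum_congr rfl (fun k hk => if_pos (mem_shell.1 hk))]
  simp

theorem tsum_inv_sq_tail_le (a : ℕ) :
    ∑' r : ℕ, (if a < r then ENNReal.ofReal (((r : ℝ) ^ 2)⁻¹) else 0) ≤
      ENNReal.ofReal (2 / (a + 1)) := by
  refine ENNReal.tsum_le_of_sum_range_le fun n => ?_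
  rw [← Finset.sum_filter, ← ENNReal.ofReal_sum_of_nonneg (fun _ _ => by positivity)]
  refine ENNReal.ofReal_le_ofReal ?_
  refine le_trans (le_of_eq ?_) (sum_Ioo_inv_sq_le (α := ℝ) a n)
  refine Finset.sum_congr ?_ fun _ _ => rfl
  ext r; simp [and_comm]

/-- On the shell of sup norm `r ≥ 1`, which has `O(r^{d-1})` points, the terms are at most
`(6 r)^{-(d+1)}`, because `6 ≤ 2π`. -/
theorem tsum_inv_one_add_sum_pow_le (hd : 1 ≤ d) :
    ∑' k : Fin d → ℤ,
      ENNReal.ofReal ((1 + ∑ j, |2 * Real.pi * (k j : ℝ)| ^ (d + 1))⁻¹) ≤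
        ENNReal.ofReal (3 / 2) := by
  have : NeZero d := ⟨by omega⟩
  set φ : ℕ → ENNReal := fun r =>
    ENNReal.ofReal (if r = 0 then 1 else ((6 * (r : ℝ)) ^ (d + 1))⁻¹) with hφ
  have hle : ∀ k : Fin d → ℤ,
      ENNReal.ofReal ((1 + ∑ j, |2 * Real.pi * (k j : ℝ)| ^ (d + 1))⁻¹) ≤ φ (supLen k) := by
    intro k
    refine ENNReal.ofReal_le_ofReal ?_
    have hnn : 0 ≤ ∑ j, |2 * Real.pi * (k j : ℝ)| ^ (d + 1) :=
      Finset.sum_nonneg fun j _ => by positivity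
    split_ifs with h0
    · exact inv_le_one_of_one_le₀ (by linarith)
    · obtain ⟨j, hj⟩ := exists_natAbs_eq_supLen k
      have hpos : (0 : ℝ) < supLen k := by exact_mod_cast Nat.pos_of_ne_zero h0
      refine inv_anti₀ (by positivity) ?_
      have h1 : (6 * (supLen k : ℝ)) ^ (d + 1) ≤ |2 * Real.pi * (k j : ℝ)| ^ (d + 1) := by
        gcongr
        rw [abs_mul, abs_of_pos (by positivity : (0 : ℝ) < 2 * Real.pi), ← hj, Nat.cast_natAbs,
          Int.cast_abs]
        gcongr
        linarith [Real.pi_gt_three]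
      have h2 := Finset.single_le_sum (f := fun j => |2 * Real.pi * (k j : ℝ)| ^ (d + 1))
        (fun i _ => by positivity) (Finset.mem_univ j)
      linarith
  have hterm : ∀ r : ℕ, ((shell d r).card : ENNReal) * φ r ≤
      (if r = 0 then 1 else 0) + ENNReal.ofReal (1 / 18) *
        (if 0 < r then ENNReal.ofReal (((r : ℝ) ^ 2)⁻¹) else 0) := by
    intro r
    rcases Nat.eq_zero_or_pos r with rfl | hr
    · simp [card_shell_zero, hφ]
    · have hr' : (0 : ℝ) < r := by exact_mod_cast hr
      rw [if_neg hr.ne', if_pos hr, zero_add, hφ]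
      simp only [if_neg hr.ne']
      rw [← ENNReal.ofReal_natCast, ← ENNReal.ofReal_mul (by positivity),
        ← ENNReal.ofReal_mul (by positivity)]
      refine ENNReal.ofReal_le_ofReal ?_
      obtain ⟨e, rfl⟩ : ∃ e, d = e + 1 := ⟨d - 1, by omega⟩
      have h1 := card_shell_le (d := e + 1) hr
      have h2 : ((e : ℝ) + 1) ≤ 2 ^ e := by exact_mod_cast Nat.lt_two_pow_self
      calc ((shell (e + 1) r).card : ℝ) * ((6 * (r : ℝ)) ^ (e + 1 + 1))⁻¹
          ≤ (2 * (e + 1 : ℕ) * (3 * (r : ℝ)) ^ (e + 1 - 1)) *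
            ((6 * (r : ℝ)) ^ (e + 1 + 1))⁻¹ := by gcongr
        _ = ((e : ℝ) + 1) / 2 ^ e * (1 / 18 * ((r : ℝ) ^ 2)⁻¹) := by
            rw [Nat.add_sub_cancel, show (6 : ℝ) * r = 2 * (3 * r) by ring, mul_pow 2 (3 * (r : ℝ)),
              pow_succ (3 * (r : ℝ)), pow_succ (3 * (r : ℝ))]
            push_cast
            field_simp
            ring
        _ ≤ 1 * (1 / 18 * ((r : ℝ) ^ 2)⁻¹) := by
            gcongr
            exact (div_le_one (by positivity)).2 h2
        _ = _ := one_mul _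
  calc _ ≤ ∑' k : Fin d → ℤ, φ (supLen k) := ENNReal.tsum_le_tsum hle
    _ = ∑' r : ℕ, ((shell d r).card : ENNReal) * φ r := tsum_comp_supLen φ
    _ ≤ _ := ENNReal.tsum_le_tsum hterm
    _ ≤ 1 + ENNReal.ofReal (1 / 18) * ENNReal.ofReal (2 / ((0 : ℕ) + 1)) := by
        rw [ENNReal.tsum_add, ENNReal.tsum_mul_left, tsum_ite_eq]
        gcongr
        exact tsum_inv_sq_tail_le 0
    _ ≤ ENNReal.ofReal (3 / 2) := by
        rw [← ENNReal.ofReal_mul (by norm_num), ← ENNReal.ofReal_one,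
          ← ENNReal.ofReal_add (by norm_num) (by norm_num)]
        exact ENNReal.ofReal_le_ofReal (by norm_num)

/-- The shells of sup norm `r > t / d` give `∑_{|k| > t} ‖k‖_∞^{-2s} = O(t^{d - 2s})`. -/
theorem exists_tsum_tail_supLen_le (hd : 1 ≤ d) {s : ℕ} (hs : d < 2 * s) :
    ∃ C : ℝ, 0 ≤ C ∧ ∀ t : ℕ, 1 ≤ t →
      ∑' k : Fin d → ℤ, (if (t : ℤ) < len k then
        ENNReal.ofReal (((supLen k : ℝ) ^ (2 * s))⁻¹) else 0) ≤
        ENNReal.ofReal (C * ((t : ℝ) ^ (2 * s - d))⁻¹) := by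
  obtain ⟨p, hp⟩ : ∃ p, 2 * s = d + 1 + p := ⟨2 * s - d - 1, by omega⟩
  refine ⟨4 * d * 3 ^ (d - 1) * (d : ℝ) ^ (p + 1), by positivity, fun t ht => ?_⟩
  have hd' : (0 : ℝ) < d := by exact_mod_cast hd
  have ht' : (0 : ℝ) < t := by exact_mod_cast ht
  set φ : ℕ → ENNReal := fun r => if t < d * r then
    ENNReal.ofReal (((r : ℝ) ^ (2 * s))⁻¹) else 0 with hφ
  have hle : ∀ k : Fin d → ℤ, (if (t : ℤ) < len k then
      ENNReal.ofReal (((supLen k : ℝ) ^ (2 * s))⁻¹) else 0) ≤ φ (supLen k) := by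
    intro k
    split_ifs with h
    · have : t < d * supLen k := by
        have := len_le_mul_supLen k
        zify
        omega
      simp only [hφ, if_pos this, le_refl]
    · exact zero_le
  have hterm : ∀ r : ℕ, ((shell d r).card : ENNReal) * φ r ≤
      ENNReal.ofReal (2 * d * 3 ^ (d - 1) * (d : ℝ) ^ p * ((t : ℝ) ^ p)⁻¹) *
        (if t / d < r then ENNReal.ofReal (((r : ℝ) ^ 2)⁻¹) else 0) := by
    intro r
    simp only [hφ]
    by_cases h : t < d * r
    · have hr : 1 ≤ r := by
        rcases Nat.eq_zero_or_pos r with rfl | hr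
        · omega
        · exact hr
      have hr' : (0 : ℝ) < r := by exact_mod_cast hr
      have h' : t / d < r := Nat.div_lt_of_lt_mul h
      have hreal : (t : ℝ) ≤ d * r := by exact_mod_cast h.le
      rw [if_pos h, if_pos h', ← ENNReal.ofReal_natCast, ← ENNReal.ofReal_mul (by positivity),
        ← ENNReal.ofReal_mul (by positivity)]
      refine ENNReal.ofReal_le_ofReal ?_
      calc ((shell d r).card : ℝ) * ((r : ℝ) ^ (2 * s))⁻¹
          ≤ (2 * d * (3 * (r : ℝ)) ^ (d - 1)) * ((r : ℝ) ^ (2 * s))⁻¹ := by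
            gcongr; exact card_shell_le hr
        _ = 2 * d * 3 ^ (d - 1) * ((r : ℝ) ^ p)⁻¹ * ((r : ℝ) ^ 2)⁻¹ := by
            rw [hp, mul_pow, show d + 1 + p = (d - 1) + p + 2 by omega, pow_add, pow_add]
            field_simp
        _ ≤ 2 * d * 3 ^ (d - 1) * ((d : ℝ) ^ p * ((t : ℝ) ^ p)⁻¹) * ((r : ℝ) ^ 2)⁻¹ := by
            gcongr
            rw [← div_eq_mul_inv, ← div_pow, ← inv_pow]
            gcongr
            rw [inv_le_comm₀ hr' (by positivity), inv_div, div_le_iff₀ hd']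
            linarith
        _ = _ := by ring
    · rw [if_neg h, mul_zero]; exact zero_le
  calc _ ≤ ∑' k : Fin d → ℤ, φ (supLen k) := ENNReal.tsum_le_tsum hle
    _ = ∑' r : ℕ, ((shell d r).card : ENNReal) * φ r := tsum_comp_supLen φ
    _ ≤ _ := ENNReal.tsum_le_tsum hterm
    _ ≤ ENNReal.ofReal (2 * d * 3 ^ (d - 1) * (d : ℝ) ^ p * ((t : ℝ) ^ p)⁻¹) *
          ENNReal.ofReal (2 * d * (t : ℝ)⁻¹) := by
        rw [ENNReal.tsum_mul_left]
        gcongr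
        refine (tsum_inv_sq_tail_le _).trans (ENNReal.ofReal_le_ofReal ?_)
        have h1 : (t : ℝ) ≤ d * ((t / d : ℕ) + 1) := by
          exact_mod_cast (Nat.lt_mul_div_succ t hd).le
        rw [← div_eq_mul_inv, div_le_div_iff₀ (by positivity) ht']
        linarith
    _ ≤ _ := by
        rw [← ENNReal.ofReal_mul (by positivity)]
        refine ENNReal.ofReal_le_ofReal (le_of_eq ?_)
        rw [show 2 * s - d = p + 1 by omega, pow_succ, pow_succ]
        field_simp
        ring

/-! ### Decay of the Fourier coefficients of smooth periodic functions -/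

/-- The `ℓ¹` tail of the Fourier coefficients `a_k` of a `C^s` function. With `c = t^{-m}`, the
inequality `a_k ≤ c ‖k‖^{2s} a_k² / 2 + ‖k‖^{-2s} / (2c)` splits it into a Parseval sum for the
derivatives of order `s` and a lattice sum. -/
theorem exists_tail_fcoeff_le (hd : 1 ≤ d) {m : ℝ} (hm : 0 < m) {s : ℕ}
    (hs : m + (d : ℝ) / 2 ≤ s) {g : (Fin d → ℝ) → ℝ} (hg : ContDiff ℝ s g)
    (hp : LatticePeriodic g) :
    ∃ C : ℝ, 0 ≤ C ∧ ∀ t : ℕ, 1 ≤ t →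
      ∑' k : Fin d → ℤ, (if (t : ℤ) < len k then ‖fcoeff (fun x => (g x : ℂ)) k‖ₑ else 0) ≤
        ENNReal.ofReal (C * (t : ℝ) ^ (-m)) := by
  have : NeZero d := ⟨by omega⟩
  have hds : d < 2 * s := by
    have : (d : ℝ) < 2 * s := by linarith
    exact_mod_cast this
  obtain ⟨C₁, hC₁, htail⟩ := exists_tsum_tail_supLen_le hd hds
  set a : (Fin d → ℤ) → ℝ := fun k => ‖fcoeff (fun x => (g x : ℂ)) k‖ with ha
  set D : ℝ := ∑ j : Fin d, ∫ x in cube d, (partialDeriv g j s x) ^ 2 with hD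
  have hsum : HasSum (fun k : Fin d → ℤ =>
      ∑ j, (|2 * Real.pi * (k j : ℝ)| ^ s * a k) ^ 2) D :=
    hasSum_sum fun j _ => hasSum_sq_fcoeff_partialDeriv hp j s hg
  have hD0 : 0 ≤ D := Finset.sum_nonneg fun j _ => integral_nonneg fun x => sq_nonneg _
  refine ⟨(D + C₁) / 2, by positivity, fun t ht => ?_⟩
  have ht' : (0 : ℝ) < t := by exact_mod_cast ht
  have ht1 : (1 : ℝ) ≤ t := by exact_mod_cast ht
  set c : ℝ := (t : ℝ) ^ (-m) with hc
  have hc0 : 0 < c := Real.rpow_pos_of_pos ht' _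
  have hterm : ∀ k : Fin d → ℤ, (if (t : ℤ) < len k then
      ‖fcoeff (fun x => (g x : ℂ)) k‖ₑ else 0) ≤
      ENNReal.ofReal (c / 2) * ENNReal.ofReal (∑ j, (|2 * Real.pi * (k j : ℝ)| ^ s * a k) ^ 2) +
      ENNReal.ofReal (1 / (2 * c)) * (if (t : ℤ) < len k then
        ENNReal.ofReal (((supLen k : ℝ) ^ (2 * s))⁻¹) else 0) := by
    intro k
    split_ifs with h
    · obtain ⟨j, hj⟩ := exists_natAbs_eq_supLen k
      have hpos : (0 : ℝ) < supLen k := by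
        have h1 := len_le_mul_supLen k
        rcases Nat.eq_zero_or_pos (supLen k) with h0 | h0
        · rw [h0] at h1; simp at h1; omega
        · exact_mod_cast h0
      have hle : (supLen k : ℝ) ^ s ≤ |2 * Real.pi * (k j : ℝ)| ^ s := by
        gcongr
        rw [abs_mul, abs_of_pos (by positivity : (0 : ℝ) < 2 * Real.pi), ← hj, Nat.cast_natAbs,
          Int.cast_abs]
        have : (0 : ℝ) ≤ |(k j : ℝ)| := abs_nonneg _
        nlinarith [Real.pi_gt_three]
      have ha0 : 0 ≤ a k := norm_nonneg _
      have h2 : ((supLen k : ℝ) ^ s * a k) ^ 2 ≤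
          ∑ j, (|2 * Real.pi * (k j : ℝ)| ^ s * a k) ^ 2 := by
        refine le_trans ?_ (Finset.single_le_sum
          (f := fun j => (|2 * Real.pi * (k j : ℝ)| ^ s * a k) ^ 2)
          (fun i _ => by positivity) (Finset.mem_univ j))
        gcongr
      rw [← ofReal_norm, ← ENNReal.ofReal_mul (by positivity),
        ← ENNReal.ofReal_mul (by positivity),
        ← ENNReal.ofReal_add (by positivity) (by positivity)]
      refine ENNReal.ofReal_le_ofReal ?_
      have h3 : a k ≤ c / 2 * ((supLen k : ℝ) ^ s * a k) ^ 2 +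
          1 / (2 * c) * ((supLen k : ℝ) ^ (2 * s))⁻¹ := by
        have hy : 0 < (supLen k : ℝ) ^ s := by positivity
        rw [mul_comm 2 s, pow_mul]
        set y := (supLen k : ℝ) ^ s
        have : 0 ≤ (c * y ^ 2 * a k - 1) ^ 2 / (2 * c * y ^ 2) := by positivity
        have h5 : (c * y ^ 2 * a k - 1) ^ 2 / (2 * c * y ^ 2) =
          c / 2 * (y * a k) ^ 2 + 1 / (2 * c) * (y ^ 2)⁻¹ - a k := by
          field_simp
          ring
        linarith
      refine h3.trans ?_
      gcongr
    · exact zero_le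
  calc _ ≤ _ := ENNReal.tsum_le_tsum hterm
    _ ≤ ENNReal.ofReal (c / 2) * ENNReal.ofReal D +
        ENNReal.ofReal (1 / (2 * c)) * ENNReal.ofReal (C₁ * ((t : ℝ) ^ (2 * s - d))⁻¹) := by
        rw [ENNReal.tsum_add, ENNReal.tsum_mul_left, ENNReal.tsum_mul_left,
          ← ENNReal.ofReal_tsum_of_nonneg (fun k => Finset.sum_nonneg fun j _ => sq_nonneg _)
            hsum.summable, hsum.tsum_eq]
        gcongr
        exact htail t ht
    _ ≤ ENNReal.ofReal ((D + C₁) / 2 * c) := by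
        rw [← ENNReal.ofReal_mul (by positivity), ← ENNReal.ofReal_mul (by positivity),
          ← ENNReal.ofReal_add (by positivity) (by positivity)]
        refine ENNReal.ofReal_le_ofReal ?_
        have h1 : ((t : ℝ) ^ (2 * s - d))⁻¹ ≤ c ^ 2 := by
          rw [hc, ← Real.rpow_natCast, ← Real.rpow_neg ht'.le, ← Real.rpow_natCast,
            ← Real.rpow_mul ht'.le]
          refine Real.rpow_le_rpow_of_exponent_le ht1 ?_
          rw [Nat.cast_sub hds.le]
          push_cast
          linarith
        have h2 : 1 / (2 * c) * (C₁ * ((t : ℝ) ^ (2 * s - d))⁻¹) ≤ 1 / (2 * c) * (C₁ * c ^ 2) := by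
          gcongr
        have h3 : 1 / (2 * c) * (C₁ * c ^ 2) = C₁ / 2 * c := by field_simp
        linarith

theorem summable_norm_of_tail {a : (Fin d → ℤ) → ℂ} {t : ℕ}
    (h : ∑' k : Fin d → ℤ, (if (t : ℤ) < len k then ‖a k‖ₑ else 0) ≠ ⊤) :
    Summable fun k => ‖a k‖ := by
  have hs : ∑' k, ‖a k‖ₑ ≠ ⊤ := by
    have h1 : ∀ k, ‖a k‖ₑ ≤ (if k ∈ band d t then ‖a k‖ₑ else 0) +
        (if (t : ℤ) < len k then ‖a k‖ₑ else 0) := by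
      intro k
      by_cases hk : (t : ℤ) < len k
      · simp [hk]
      · rw [if_pos (mem_band.2 (not_lt.1 hk))]; exact le_self_add
    refine ne_top_of_le_ne_top ?_ (ENNReal.tsum_le_tsum h1)
    rw [ENNReal.tsum_add]
    refine ENNReal.add_ne_top.2 ⟨?_, h⟩
    rw [tsum_eq_sum (s := band d t) (fun k hk => if_neg hk)]
    exact (ENNReal.sum_lt_top.2 fun k _ => by split_ifs; all_goals simp).ne
  have := ENNReal.summable_toReal hs
  simpa using this

theorem summable_fcoeff (hd : 1 ≤ d) {s : ℕ} (hs : d < 2 * s) {g : (Fin d → ℝ) → ℝ}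
    (hg : ContDiff ℝ s g) (hp : LatticePeriodic g) :
    Summable fun k => ‖fcoeff (fun x => (g x : ℂ)) k‖ := by
  have hds : (d : ℝ) < 2 * s := by exact_mod_cast hs
  obtain ⟨C, -, hC⟩ := exists_tail_fcoeff_le hd (m := s - (d : ℝ) / 2) (by linarith)
    (by linarith) hg hp
  exact summable_norm_of_tail (ne_top_of_le_ne_top ENNReal.ofReal_ne_top (hC 1 le_rfl))

end

/-! ### Local sums of squares at a nondegenerate minimum -/

section

section Local

variable {E : Type} [NormedAddCommGroup E] [NormedSpace ℝ E]

/-- The weighted mean `∫₀¹ (1 - s) G(x₀ + s (x - x₀)) ds` of `G` over a segment, which is the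
remainder term of Taylor's formula when `G` is a second derivative. -/
noncomputable def segmentMean {F : Type} [NormedAddCommGroup F] [NormedSpace ℝ F] (G : E → F)
    (x₀ x : E) : F :=
  ∫ s in (0 : ℝ)..1, (1 - s) • G (x₀ + s • (x - x₀))

theorem segmentMean_self {F : Type} [NormedAddCommGroup F] [NormedSpace ℝ F] [CompleteSpace F]
    (G : E → F) (x₀ : E) : segmentMean G x₀ x₀ = (1 / 2 : ℝ) • G x₀ := by
  simp only [segmentMean, sub_self, smul_zero, add_zero]
  rw [intervalIntegral.integral_smul_const]
  congr 1
  rw [intervalIntegral.integral_sub intervalIntegrable_const intervalIntegral.intervalIntegrable_id,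
    integral_id]
  norm_num

theorem continuous_segment_weight {F : Type} [NormedAddCommGroup F] [NormedSpace ℝ F] {G : E → F}
    (hG : ContDiff ℝ 0 G) (x₀ v : E) : Continuous fun s : ℝ => (1 - s) • G (x₀ + s • v) :=
  (continuous_const.sub continuous_id).smul (hG.continuous.comp
    (continuous_const.add (continuous_id.smul continuous_const)))

/-- Taylor's formula of order two with integral remainder. -/
theorem eq_add_segmentMean {F : E → ℝ} (hF : ContDiff ℝ 2 F) (x₀ x : E) :
    F x = F x₀ + fderiv ℝ F x₀ (x - x₀) +
      segmentMean (fderiv ℝ (fderiv ℝ F)) x₀ x (x - x₀) (x - x₀) := by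
  set v := x - x₀ with hv
  have h1 : ContDiff ℝ 1 (fderiv ℝ F) := hF.fderiv_right (by norm_num)
  have hG : ContDiff ℝ 0 (fderiv ℝ (fderiv ℝ F)) := h1.fderiv_right (by norm_num)
  have hline : ∀ s : ℝ, HasDerivAt (fun s : ℝ => x₀ + s • v) v s := fun s => by
    simpa using ((hasDerivAt_id s).smul_const v).const_add x₀
  have hφ : ∀ s : ℝ, HasDerivAt (fun s : ℝ => F (x₀ + s • v)) (fderiv ℝ F (x₀ + s • v) v) s :=
    fun s => ((hF.differentiable two_ne_zero) _).hasFDerivAt.comp_hasDerivAt s (hline s)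
  have hφ' : ∀ s : ℝ, HasDerivAt (fun s : ℝ => fderiv ℝ F (x₀ + s • v) v)
      (fderiv ℝ (fderiv ℝ F) (x₀ + s • v) v v) s := fun s => by
    have h := ((h1.differentiable one_ne_zero) _).hasFDerivAt.comp_hasDerivAt s (hline s)
    simpa using h.clm_apply (hasDerivAt_const s v)
  have hψ : ∀ s : ℝ, HasDerivAt
      (fun s : ℝ => (1 - s) * fderiv ℝ F (x₀ + s • v) v + F (x₀ + s • v))
      ((1 - s) * fderiv ℝ (fderiv ℝ F) (x₀ + s • v) v v) s := fun s => by
    have h1 : HasDerivAt (fun s : ℝ => 1 - s) (-1) s := (hasDerivAt_id s).const_sub 1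
    exact ((h1.mul (hφ' s)).add (hφ s)).congr_deriv (by ring)
  have hcont := continuous_segment_weight hG x₀ v
  have hcont' : Continuous fun s : ℝ => (1 - s) * fderiv ℝ (fderiv ℝ F) (x₀ + s • v) v v :=
    (hcont.clm_apply continuous_const).clm_apply continuous_const
  have h2 := intervalIntegral.integral_eq_sub_of_hasDerivAt (a := 0) (b := 1)
    (fun s _ => hψ s) (hcont'.intervalIntegrable _ _)
  have h3 : segmentMean (fderiv ℝ (fderiv ℝ F)) x₀ x v v =
      ∫ s in (0 : ℝ)..1, (1 - s) * fderiv ℝ (fderiv ℝ F) (x₀ + s • v) v v := by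
    rw [segmentMean, ContinuousLinearMap.intervalIntegral_apply (hcont.intervalIntegrable _ _),
      ContinuousLinearMap.intervalIntegral_apply
        ((hcont.clm_apply continuous_const).intervalIntegrable _ _)]
    rfl
  rw [h3, h2]
  have hx : x₀ + (1 : ℝ) • v = x := by simp [hv]
  rw [hx]
  simp only [sub_self, zero_mul, zero_add, sub_zero, one_mul, zero_smul, add_zero]
  ring

variable [FiniteDimensional ℝ E]

theorem hasFDerivAt_intervalIntegral_of_contDiff {F : Type} [NormedAddCommGroup F]
    [NormedSpace ℝ F] {Φ : E × ℝ → F} (hΦ : ContDiff ℝ 1 Φ) (x : E) :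
    HasFDerivAt (fun x => ∫ s in (0 : ℝ)..1, Φ (x, s))
      (∫ s in (0 : ℝ)..1, (fderiv ℝ Φ (x, s)).comp (ContinuousLinearMap.inl ℝ E ℝ)) x := by
  have hc : Continuous fun p : E × ℝ =>
      (fderiv ℝ Φ p).comp (ContinuousLinearMap.inl ℝ E ℝ) :=
    (hΦ.continuous_fderiv one_ne_zero).clm_comp continuous_const
  obtain ⟨M, hM⟩ := ((isCompact_closedBall x 1).prod (isCompact_Icc (a := (0 : ℝ))
    (b := 1))).exists_bound_of_continuousOn hc.continuousOn
  refine intervalIntegral.hasFDerivAt_integral_of_dominated_of_fderiv_le (𝕜 := ℝ)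
    (s := Metric.ball x 1) (bound := fun _ => M)
    (F' := fun x s => (fderiv ℝ Φ (x, s)).comp (ContinuousLinearMap.inl ℝ E ℝ))
    (Metric.ball_mem_nhds _ one_pos) ?_ ?_ ?_ ?_ ?_ ?_
  · exact Filter.Eventually.of_forall fun y =>
      (hΦ.continuous.comp (Continuous.prodMk_right y)).aestronglyMeasurable
  · exact (hΦ.continuous.comp (Continuous.prodMk_right x)).intervalIntegrable _ _
  · exact (hc.comp (Continuous.prodMk_right x)).aestronglyMeasurable
  · refine Filter.Eventually.of_forall fun s hs y hy => hM (y, s) ⟨?_, ?_⟩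
    · exact Metric.ball_subset_closedBall hy
    · rw [Set.uIoc_of_le zero_le_one] at hs
      exact ⟨hs.1.le, hs.2⟩
  · exact intervalIntegrable_const
  · refine Filter.Eventually.of_forall fun s _ y _ => ?_
    have h1 : HasFDerivAt (fun y : E => (y, s)) (ContinuousLinearMap.inl ℝ E ℝ) y :=
      hasFDerivAt_prodMk_left y s
    exact ((hΦ.differentiable one_ne_zero) (y, s)).hasFDerivAt.comp y h1

/-- An integral over `[0, 1]` of a `C^n` function of `(x, s)` is a `C^n` function of `x`. -/
theorem contDiff_intervalIntegral (n : ℕ) : ∀ {F : Type} [NormedAddCommGroup F]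
    [NormedSpace ℝ F] {Φ : E × ℝ → F}, ContDiff ℝ n Φ →
      ContDiff ℝ n fun x => ∫ s in (0 : ℝ)..1, Φ (x, s) := by
  induction n with
  | zero =>
    intro F _ _ Φ hΦ
    rw [Nat.cast_zero, contDiff_zero] at hΦ ⊢
    exact intervalIntegral.continuous_parametric_intervalIntegral_of_continuous'
      (f := fun x s => Φ (x, s)) hΦ 0 1
  | succ n ih =>
    intro F _ _ Φ hΦ
    rw [Nat.cast_succ, contDiff_succ_iff_hasFDerivAt]
    refine ⟨fun x => ∫ s in (0 : ℝ)..1,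
      (fderiv ℝ Φ (x, s)).comp (ContinuousLinearMap.inl ℝ E ℝ), ?_, fun x =>
      hasFDerivAt_intervalIntegral_of_contDiff (hΦ.of_le (by
        exact_mod_cast Nat.succ_le_succ (Nat.zero_le n))) x⟩
    have h1 : ContDiff ℝ n (fderiv ℝ Φ) := hΦ.fderiv_right (by exact_mod_cast le_rfl)
    exact ih (Φ := fun p => (fderiv ℝ Φ p).comp (ContinuousLinearMap.inl ℝ E ℝ))
      (h1.clm_comp contDiff_const)

theorem contDiff_segmentMean {F : Type} [NormedAddCommGroup F] [NormedSpace ℝ F] {G : E → F}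
    {n : ℕ} (hG : ContDiff ℝ n G) (x₀ : E) : ContDiff ℝ n (segmentMean G x₀) :=
  contDiff_intervalIntegral n (Φ := fun p : E × ℝ => (1 - p.2) • G (x₀ + p.2 • (p.1 - x₀)))
    ((contDiff_const.sub contDiff_snd).smul (hG.comp
      (contDiff_const.add (contDiff_snd.smul (contDiff_fst.sub contDiff_const)))))

/-- Diagonal dominance turned into squares: a small perturbation `e` of a positive diagonal form is
a combination, with nonnegative coefficients affine in `e`, of the squares of `y_i ± y_j` and of
`y_i`. -/
theorem sum_perturbed_squares {n : ℕ} (a y : Fin n → ℝ) (e : Fin n → Fin n → ℝ) (ε : ℝ) :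
    ∑ i, a i * y i ^ 2 + ∑ i, ∑ j, e i j * (y i * y j) =
      ∑ i, (a i - n * ε) * y i ^ 2 + ∑ i, ∑ j, ((ε + e i j) / 4 * (y i + y j) ^ 2 +
        (ε - e i j) / 4 * (y i - y j) ^ 2) := by
  have h1 : ∀ i j, (ε + e i j) / 4 * (y i + y j) ^ 2 + (ε - e i j) / 4 * (y i - y j) ^ 2 =
      (ε / 2 * y i ^ 2 + ε / 2 * y j ^ 2) + e i j * (y i * y j) := fun i j => by ring
  simp only [h1, Finset.sum_add_distrib, Finset.sum_const, Finset.card_univ, Fintype.card_fin,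
    nsmul_eq_mul, sub_mul, Finset.sum_sub_distrib, ← Finset.mul_sum]
  rw [Finset.mul_sum]
  simp only [mul_assoc, ← Finset.mul_sum]
  ring

/-- Near a nondegenerate zero `x₀`, a nonnegative `C^{s+2}` function is a finite sum of squares of
`C^s` functions: by Taylor's formula it is a quadratic form in `x - x₀` with `C^s` coefficients,
close to a positive definite one, which is diagonalized. -/
theorem exists_local_sum_sq {F : E → ℝ} {s : ℕ} (hF : ContDiff ℝ (s + 2 : ℕ) F)
    (hnn : ∀ x, 0 ≤ F x) {x₀ : E} (h0 : F x₀ = 0)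
    (hpos : ∀ v : E, v ≠ 0 → 0 < fderiv ℝ (fderiv ℝ F) x₀ v v) :
    ∃ (ι : Type) (_ : Fintype ι) (g : ι → E → ℝ) (r : ℝ), 0 < r ∧
      ∀ x ∈ Metric.ball x₀ r, (∀ i, ContDiffAt ℝ s (g i) x) ∧ F x = ∑ i, g i x ^ 2 := by
  have hF2 : ContDiff ℝ 2 F := hF.of_le (by exact_mod_cast Nat.le_add_left 2 s)
  have hcrit : fderiv ℝ F x₀ = 0 :=
    IsLocalMin.fderiv_eq_zero (Filter.Eventually.of_forall fun x => by rw [h0]; exact hnn x)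
  set B := segmentMean (fderiv ℝ (fderiv ℝ F)) x₀ with hB
  have hBs : ContDiff ℝ s B := contDiff_segmentMean
    (ContDiff.fderiv_right (m := s) (n := (s + 1 : ℕ))
      (ContDiff.fderiv_right hF (by exact_mod_cast le_rfl)) (by exact_mod_cast le_rfl)) x₀
  have hB0 : B x₀ = (1 / 2 : ℝ) • fderiv ℝ (fderiv ℝ F) x₀ := segmentMean_self _ x₀
  have hBpos : ∀ v : E, v ≠ 0 → 0 < B x₀ v v := fun v hv => by
    rw [hB0]; simpa using hpos v hv
  -- an orthogonal basis for the Hessian form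
  let b : LinearMap.BilinForm ℝ E := ContinuousLinearMap.toBilinForm (B x₀)
  have hbapp : ∀ v w, b v w = B x₀ v w := fun v w => rfl
  have hsymm : LinearMap.IsSymm b := by
    refine ⟨fun v w => ?_⟩
    have h := (hF2.contDiffAt (x := x₀)).isSymmSndFDerivAt (by simp) v w
    simp only [hbapp, hB0]
    simp [h]
  obtain ⟨n, u, hu⟩ : ∃ (n : ℕ) (u : Module.Basis (Fin n) ℝ E), LinearMap.IsOrthoᵢ b u :=
    ⟨_, LinearMap.BilinForm.exists_orthogonal_basis hsymm⟩
  set a : Fin n → ℝ := fun i => B x₀ (u i) (u i) with ha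
  have hapos : ∀ i, 0 < a i := fun i => hBpos _ (u.ne_zero i)
  have horth : ∀ i j, i ≠ j → B x₀ (u i) (u j) = 0 := fun i j hij => by
    rw [← hbapp]; exact hu hij
  obtain ⟨ε, hε, hεa⟩ : ∃ ε : ℝ, 0 < ε ∧ ∀ i, n * ε ≤ a i := by
    rcases isEmpty_or_nonempty (Fin n) with h | h
    · exact ⟨1, one_pos, fun i => h.elim i⟩
    · obtain ⟨i₀, hi₀⟩ := Finite.exists_min a
      refine ⟨a i₀ / (n + 1), by have := hapos i₀; positivity, fun i => le_trans ?_ (hi₀ i)⟩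
      have := hapos i₀
      rw [mul_div_assoc', div_le_iff₀ (by positivity)]
      nlinarith
  set e : Fin n → Fin n → E → ℝ := fun i j x => (B x - B x₀) (u i) (u j) with he
  have hes : ∀ i j, ContDiff ℝ s (e i j) := fun i j =>
    ((hBs.sub contDiff_const).clm_apply contDiff_const).clm_apply contDiff_const
  let y : Fin n → E → ℝ := fun i x => u.repr (x - x₀) i
  have hys : ∀ i, ContDiff ℝ s (y i) := fun i =>
    (LinearMap.toContinuousLinearMap (u.coord i)).contDiff.comp (contDiff_id.sub contDiff_const)
  have hFx : ∀ x, F x = ∑ i, a i * y i x ^ 2 + ∑ i, ∑ j, e i j x * (y i x * y j x) := by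
    intro x
    have hv : x - x₀ = ∑ i, y i x • u i := (u.sum_repr (x - x₀)).symm
    have hquad : ∀ Q : E →L[ℝ] E →L[ℝ] ℝ, Q (x - x₀) (x - x₀) =
        ∑ i, ∑ j, Q (u i) (u j) * (y i x * y j x) := by
      intro Q
      rw [hv]
      simp only [map_sum, map_smul, _root_.sum_apply, _root_.smul_apply,
        smul_eq_mul, Finset.mul_sum]
      rw [Finset.sum_comm]
      exact Finset.sum_congr rfl fun i _ => Finset.sum_congr rfl fun j _ => by ring
    have h1 := eq_add_segmentMean hF2 x₀ x
    rw [h0, hcrit] at h1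
    have h2 : B x = B x₀ + (B x - B x₀) := by abel
    rw [← hB, h2, _root_.add_apply, _root_.add_apply, hquad (B x₀),
      hquad (B x - B x₀)] at h1
    rw [h1]
    simp only [_root_.zero_apply, zero_add, he]
    congr 1
    refine Finset.sum_congr rfl fun i _ => ?_
    rw [Finset.sum_eq_single i (fun j _ hj => by rw [horth i j hj.symm, zero_mul]) (by simp)]
    simp only [ha]
    ring
  have hnear : ∀ᶠ x in nhds x₀, ∀ i j, |e i j x| < ε := by
    refine Filter.eventually_all.2 fun i => Filter.eventually_all.2 fun j => ?_
    have h : Filter.Tendsto (fun x => |e i j x|) (nhds x₀) (nhds |e i j x₀|) :=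
      ((hes i j).continuous.abs.tendsto x₀)
    refine h.eventually_lt_const ?_
    simpa [he] using hε
  obtain ⟨r, hr, hball⟩ := Metric.eventually_nhds_iff_ball.1 hnear
  refine ⟨Fin n ⊕ (Fin n × Fin n) ⊕ (Fin n × Fin n), inferInstance,
    Sum.elim (fun i x => √(a i - n * ε) * y i x) (Sum.elim
      (fun p x => √((ε + e p.1 p.2 x) / 4) * (y p.1 x + y p.2 x))
      (fun p x => √((ε - e p.1 p.2 x) / 4) * (y p.1 x - y p.2 x))), r, hr, fun x hx => ?_⟩
  have hp : ∀ i j, 0 < ε + e i j x := fun i j => by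
    linarith [(abs_lt.1 (hball x hx i j)).1]
  have hm : ∀ i j, 0 < ε - e i j x := fun i j => by
    linarith [(abs_lt.1 (hball x hx i j)).2]
  constructor
  · rintro (i | ⟨i, j⟩ | ⟨i, j⟩)
    · exact (contDiff_const.mul (hys i)).contDiffAt
    · exact ((((contDiff_const.add (hes i j)).div_const 4).contDiffAt).sqrt
        (by have := hp i j; positivity)).mul ((hys i).add (hys j)).contDiffAt
    · exact ((((contDiff_const.sub (hes i j)).div_const 4).contDiffAt).sqrt
        (by have := hm i j; positivity)).mul ((hys i).sub (hys j)).contDiffAt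
  · rw [hFx x, sum_perturbed_squares a (fun i => y i x) (fun i j => e i j x) ε]
    simp only [Fintype.sum_sum_type, Sum.elim_inl, Sum.elim_inr, mul_pow, Fintype.sum_prod_type]
    simp only [← Finset.sum_add_distrib (f := fun i => ∑ j, _)]
    simp only [← Finset.sum_add_distrib]
    refine Finset.sum_congr rfl fun i _ => ?_
    rw [Real.sq_sqrt (by linarith [hεa i])]
    congr 1
    refine Finset.sum_congr rfl fun j _ => ?_
    rw [Real.sq_sqrt (by have := hp i j; positivity),
      Real.sq_sqrt (by have := hm i j; positivity)]

end Local

end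

/-! ### Global sums of squares of periodic functions -/

section

variable {d : ℕ}

/-- A periodic measure of the distance of `x` to `z + ℤ^d`. -/
noncomputable def periodicDist (z x : Fin d → ℝ) : ℝ :=
  ∑ j, Real.sin (Real.pi * (x j - z j)) ^ 2

/-- Near `z + ℤ^d`, the representative of `x` modulo `ℤ^d` close to `z`; away from it, a junk but
still periodic value. -/
noncomputable def wrap (z x : Fin d → ℝ) : Fin d → ℝ := fun j =>
  z j + Real.arcsin (Real.sin (2 * Real.pi * (x j - z j))) / (2 * Real.pi)

theorem contDiff_periodicDist (z : Fin d → ℝ) {n : WithTop ℕ∞} :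
    ContDiff ℝ n (periodicDist z) := by
  unfold periodicDist
  fun_prop

theorem latticePeriodic_periodicDist (z : Fin d → ℝ) : LatticePeriodic (periodicDist z) := by
  intro x k
  refine Finset.sum_congr rfl fun j _ => ?_
  have : Real.pi * ((x + fun j => (k j : ℝ)) j - z j) = Real.pi * (x j - z j) + k j * Real.pi := by
    simp only [Pi.add_apply]; ring
  rw [this, Real.sin_add_int_mul_pi, mul_pow]
  rcases Int.even_or_odd (k j) with h | h
  · simp [h.neg_one_zpow]
  · simp [h.neg_one_zpow]

theorem latticePeriodic_wrap (z : Fin d → ℝ) : LatticePeriodic (wrap z) := by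
  intro x k
  funext j
  have : 2 * Real.pi * ((x + fun j => (k j : ℝ)) j - z j) =
      2 * Real.pi * (x j - z j) + k j * (2 * Real.pi) := by
    simp only [Pi.add_apply]; ring
  simp only [wrap]
  rw [this, Real.sin_add_int_mul_two_pi]

theorem periodicDist_self (z : Fin d → ℝ) : periodicDist z z = 0 := by simp [periodicDist]

/-- If `sin²(π u)` is small then `u` is close to an integer, and the arcsine recovers its distance
to that integer. -/
theorem arcsin_sin_two_pi {u δ : ℝ} (hδ : δ ≤ 1 / 2) (h : Real.sin (Real.pi * u) ^ 2 < δ) :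
    Real.cos (2 * Real.pi * u) ≠ 0 ∧
      Real.arcsin (Real.sin (2 * Real.pi * u)) / (2 * Real.pi) = u - round u ∧
      (2 * |u - round u|) ^ 2 < δ := by
  set v := u - round u with hv
  have hvle : |v| ≤ 1 / 2 := abs_sub_round u
  have hpi := Real.pi_pos
  have hcos : 0 < Real.cos (2 * Real.pi * u) := by
    rw [mul_assoc, Real.cos_two_mul, Real.cos_sq']
    linarith
  have huv : 2 * Real.pi * u = 2 * Real.pi * v + (round u : ℤ) * (2 * Real.pi) := by
    rw [hv]; ring
  have hcosv : 0 < Real.cos (2 * Real.pi * v) := by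
    rwa [huv, Real.cos_add_int_mul_two_pi] at hcos
  have hsmall : |2 * Real.pi * v| < Real.pi / 2 := by
    by_contra hcon
    rw [not_lt] at hcon
    have h1 : |2 * Real.pi * v| ≤ Real.pi + Real.pi / 2 := by
      rw [abs_mul, abs_of_pos (by positivity)]
      nlinarith
    have h2 := Real.cos_nonpos_of_pi_div_two_le_of_le hcon h1
    rw [Real.cos_abs] at h2
    linarith
  refine ⟨hcos.ne', ?_, ?_⟩
  · rw [huv, Real.sin_add_int_mul_two_pi, Real.arcsin_sin (by linarith [(abs_lt.1 hsmall).1])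
      (by linarith [(abs_lt.1 hsmall).2])]
    field_simp
  · have hsq : Real.sin (Real.pi * v) ^ 2 = Real.sin (Real.pi * u) ^ 2 := by
      have : Real.pi * u = Real.pi * v + (round u : ℤ) * Real.pi := by rw [hv]; ring
      rw [this, Real.sin_add_int_mul_pi, mul_pow]
      rcases Int.even_or_odd (round u) with h | h
      · simp [h.neg_one_zpow]
      · simp [h.neg_one_zpow]
    have h1 : |Real.pi * v| ≤ Real.pi / 2 := by
      rw [abs_mul, abs_of_pos hpi]; nlinarith
    have h2 := Real.mul_abs_le_abs_sin h1
    rw [abs_mul, abs_of_pos hpi] at h2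
    have h3 : 2 / Real.pi * (Real.pi * |v|) = 2 * |v| := by field_simp
    rw [h3] at h2
    calc (2 * |v|) ^ 2 ≤ |Real.sin (Real.pi * v)| ^ 2 := by gcongr
      _ = Real.sin (Real.pi * u) ^ 2 := by rw [sq_abs, hsq]
      _ < δ := h

theorem wrap_of_periodicDist_lt {z x : Fin d → ℝ} {r δ : ℝ} (hr : 0 < r) (hδ : δ ≤ 1 / 2)
    (hδr : δ ≤ r ^ 2) (h : periodicDist z x < δ) :
    ContDiffAt ℝ ⊤ (wrap z) x ∧ wrap z x ∈ Metric.ball z r ∧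
      ∃ k : Fin d → ℤ, x = wrap z x + fun j => (k j : ℝ) := by
  have hj : ∀ j, Real.sin (Real.pi * (x j - z j)) ^ 2 < δ := fun j =>
    (Finset.single_le_sum (f := fun j => Real.sin (Real.pi * (x j - z j)) ^ 2)
      (fun i _ => sq_nonneg _) (Finset.mem_univ j)).trans_lt h
  have hA := fun j => arcsin_sin_two_pi hδ (hj j)
  refine ⟨?_, ?_, fun j => round (x j - z j), ?_⟩
  · rw [contDiffAt_pi]
    intro j
    have hs : Real.sin (2 * Real.pi * (x j - z j)) ^ 2 ≠ 1 := by
      rw [Real.sin_sq]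
      have := (hA j).1
      simpa using this
    have h1 : Real.sin (2 * Real.pi * (x j - z j)) ≠ -1 := fun h => hs (by rw [h]; norm_num)
    have h2 : Real.sin (2 * Real.pi * (x j - z j)) ≠ 1 := fun h => hs (by rw [h]; norm_num)
    have h3 : ContDiff ℝ ⊤ fun x : Fin d → ℝ => Real.sin (2 * Real.pi * (x j - z j)) := by
      fun_prop
    exact contDiffAt_const.add ((ContDiffAt.comp x (Real.contDiffAt_arcsin h1 h2)
      h3.contDiffAt).div_const _)
  · rw [Metric.mem_ball, dist_pi_lt_iff hr]
    intro j
    have h1 := (hA j).2.2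
    rw [Real.dist_eq, wrap, (hA j).2.1, add_sub_cancel_left]
    have h2 : (2 * |x j - z j - round (x j - z j)|) ^ 2 < r ^ 2 := h1.trans_le hδr
    have h3 := lt_of_pow_lt_pow_left₀ 2 hr.le h2
    have := abs_nonneg (x j - z j - round (x j - z j))
    linarith
  · funext j
    simp only [Pi.add_apply, wrap, (hA j).2.1]
    ring

/-- The local sum of squares, cut off and made periodic. -/
theorem exists_periodic_local_sum_sq {F : (Fin d → ℝ) → ℝ} {s : ℕ}
    (hF : ContDiff ℝ (s + 2 : ℕ) F) (hp : LatticePeriodic F) (hnn : ∀ x, 0 ≤ F x)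
    {z : Fin d → ℝ} (h0 : F z = 0)
    (hpos : ∀ v, v ≠ 0 → 0 < fderiv ℝ (fderiv ℝ F) z v v) :
    ∃ (θ : (Fin d → ℝ) → ℝ) (ι : Type) (_ : Fintype ι) (G : ι → (Fin d → ℝ) → ℝ),
      ContDiff ℝ s θ ∧ LatticePeriodic θ ∧ 0 < θ z ∧
      (∀ i, ContDiff ℝ s (G i) ∧ LatticePeriodic (G i)) ∧
      ∀ x, θ x ^ 2 * F x = ∑ i, G i x ^ 2 := by
  obtain ⟨ι, hι, g, r, hr, hg⟩ := exists_local_sum_sq hF hnn h0 hpos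
  set δ : ℝ := min (1 / 2) (r ^ 2) with hδ
  have hδ0 : 0 < δ := lt_min (by norm_num) (by positivity)
  have hnear := fun x => wrap_of_periodicDist_lt (z := z) (x := x) hr (min_le_left _ _)
    (min_le_right _ _)
  set θ : (Fin d → ℝ) → ℝ := fun x => Real.smoothTransition (δ / 2 - periodicDist z x) with hθ
  have hθs : ContDiff ℝ s θ :=
    Real.smoothTransition.contDiff.comp (contDiff_const.sub (contDiff_periodicDist z))
  refine ⟨θ, ι, hι, fun i x => θ x * g i (wrap z x), hθs, ?_, ?_, fun i => ⟨?_, ?_⟩, ?_⟩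
  · intro x k
    simp only [hθ, latticePeriodic_periodicDist z x k]
  · simp only [hθ, periodicDist_self]
    exact Real.smoothTransition.pos_of_pos (by linarith)
  · rw [contDiff_iff_contDiffAt]
    intro x
    rcases lt_or_ge (periodicDist z x) δ with h | h
    · obtain ⟨h1, h2, -⟩ := hnear x h
      exact hθs.contDiffAt.mul (((hg _ h2).1 i).comp x (h1.of_le le_top))
    · have hev : ∀ᶠ y in nhds x, δ / 2 < periodicDist z y :=
        ((contDiff_periodicDist z (n := 0)).continuous.tendsto x).eventually_const_lt
          (by linarith)
      refine (contDiffAt_const (c := (0 : ℝ))).congr_of_eventuallyEq ?_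
      filter_upwards [hev] with y hy
      simp only [hθ]
      rw [Real.smoothTransition.zero_of_nonpos (by linarith), zero_mul]
  · intro x k
    simp only [hθ, latticePeriodic_periodicDist z x k, latticePeriodic_wrap z x k]
  · intro x
    simp only [mul_pow, ← Finset.mul_sum]
    rcases lt_or_ge (periodicDist z x) (δ / 2) with h | h
    · obtain ⟨-, h2, k, hk⟩ := hnear x (by linarith)
      have h3 : F x = F (wrap z x) := by
        conv_lhs => rw [hk]
        exact hp _ k
      rw [h3, (hg _ h2).2]
    · simp only [hθ]
      rw [Real.smoothTransition.zero_of_nonpos (by linarith)]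
      simp

theorem exists_cube_add_int (x : Fin d → ℝ) :
    ∃ y ∈ cube d, ∃ k : Fin d → ℤ, x = y + fun j => (k j : ℝ) := by
  refine ⟨fun j => Int.fract (x j), ⟨fun j => Int.fract_nonneg _, fun j => (Int.fract_lt_one _).le⟩,
    fun j => ⌊x j⌋, ?_⟩
  funext j
  simp [Int.fract_add_floor]

theorem globalMin_le {f : (Fin d → ℝ) → ℝ} (hc : Continuous f) (hp : LatticePeriodic f)
    (x : Fin d → ℝ) : globalMin f ≤ f x := by
  obtain ⟨y, hy, k, rfl⟩ := exists_cube_add_int x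
  rw [hp]
  exact csInf_le (isCompact_cube.image hc).bddBelow ⟨y, hy, rfl⟩

/-- With cutoffs `θ_z` such that every `θ_z² F` is a sum of squares and `W = ∑_z θ_z²` is positive
at the zeros of `F`, the identity `F (W + F) = W F + F²` exhibits `F` as a sum of squares after
division by the positive function `W + F`; no partition of unity is needed. -/
theorem exists_sum_sq {f : (Fin d → ℝ) → ℝ} {s : ℕ} (hf : ContDiff ℝ (s + 2 : ℕ) f)
    (hp : LatticePeriodic f) (hfin : (minimizers f).Finite)
    (hhess : ∀ x ∈ minimizers f, HasPosHessian f x) :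
    ∃ (ι : Type) (_ : Fintype ι) (g : ι → (Fin d → ℝ) → ℝ),
      (∀ i, ContDiff ℝ s (g i) ∧ LatticePeriodic (g i)) ∧
      ∀ x, f x - globalMin f = ∑ i, g i x ^ 2 := by
  set F : (Fin d → ℝ) → ℝ := fun x => f x - globalMin f with hF
  have hFs : ContDiff ℝ (s + 2 : ℕ) F := hf.sub contDiff_const
  have hFp : LatticePeriodic F := fun x k => by simp only [hF, hp x k]
  have hnn : ∀ x, 0 ≤ F x := fun x => sub_nonneg.2 (globalMin_le hf.continuous hp x)
  have hloc : ∀ z : minimizers f, ∃ (θ : (Fin d → ℝ) → ℝ) (ι : Type) (_ : Fintype ι)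
      (G : ι → (Fin d → ℝ) → ℝ),
      ContDiff ℝ s θ ∧ LatticePeriodic θ ∧ 0 < θ z ∧
      (∀ i, ContDiff ℝ s (G i) ∧ LatticePeriodic (G i)) ∧
      ∀ x, θ x ^ 2 * F x = ∑ i, G i x ^ 2 := by
    intro z
    refine exists_periodic_local_sum_sq hFs hFp hnn (sub_eq_zero.2 z.2.2) fun v hv => ?_
    have h1 := hhess z z.2 v hv
    rw [iteratedFDeriv_two_apply] at h1
    have h2 : fderiv ℝ F = fderiv ℝ f := by
      funext x; simp only [hF, fderiv_sub_const]
    rw [h2]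
    exact h1
  choose θ ι hι G hθs hθp hθz hG hsq using hloc
  have : Fintype (minimizers f) := hfin.fintype
  set W : (Fin d → ℝ) → ℝ := fun x => ∑ z, θ z x ^ 2 with hW
  have hWs : ContDiff ℝ s W := ContDiff.sum fun z _ => (hθs z).pow 2
  have hWp : LatticePeriodic W := fun x k => by simp only [hW, hθp _ x k]
  have hpos : ∀ x, 0 < W x + F x := by
    intro x
    have hW0 : 0 ≤ W x := Finset.sum_nonneg fun z _ => sq_nonneg _
    rcases (hnn x).eq_or_lt with h | h
    · obtain ⟨y, hy, k, rfl⟩ := exists_cube_add_int x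
      rw [hFp] at h ⊢
      rw [hWp]
      have hmem : y ∈ minimizers f := ⟨hy, by simp only [hF] at h; linarith⟩
      have h1 : 0 < θ ⟨y, hmem⟩ y ^ 2 := pow_pos (hθz ⟨y, hmem⟩) 2
      have h2 : θ ⟨y, hmem⟩ y ^ 2 ≤ W y :=
        Finset.single_le_sum (f := fun z => θ z y ^ 2) (fun z _ => sq_nonneg _)
          (Finset.mem_univ (⟨y, hmem⟩ : minimizers f))
      linarith
    · linarith
  have hroot : ContDiff ℝ s fun x => √(W x + F x) :=
    (hWs.add (hFs.of_le (by exact_mod_cast Nat.le_add_right s 2))).sqrt fun x => (hpos x).ne'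
  have hrootp : LatticePeriodic fun x => √(W x + F x) := fun x k => by
    simp only [hWp x k, hFp x k]
  refine ⟨(Σ z, ι z) ⊕ Unit, inferInstance,
    Sum.elim (fun p x => G p.1 p.2 x / √(W x + F x)) (fun _ x => F x / √(W x + F x)), ?_, ?_⟩
  · rintro (p | u)
    · refine ⟨(hG p.1 p.2).1.div hroot fun x => (Real.sqrt_pos.2 (hpos x)).ne', fun x k => ?_⟩
      simp only [Sum.elim_inl, (hG p.1 p.2).2 x k, hWp x k, hFp x k]
    · refine ⟨(hFs.of_le (by exact_mod_cast Nat.le_add_right s 2)).div hroot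
        fun x => (Real.sqrt_pos.2 (hpos x)).ne', fun x k => ?_⟩
      simp only [Sum.elim_inr, hWp x k, hFp x k]
  · intro x
    simp only [Fintype.sum_sum_type, Sum.elim_inl, Sum.elim_inr, div_pow,
      Real.sq_sqrt (hpos x).le, ← Finset.sum_div, Fintype.sum_sigma, ← hsq,
      Finset.univ_unique, Finset.sum_singleton]
    rw [← Finset.sum_mul, ← add_div, eq_div_iff (hpos x).ne']
    simp only [hW]
    ring

end

/-! ### Frobenius geometry and the moment matrices -/

section

variable {d t : ℕ}

/-- A matrix as a vector of the Euclidean space of its entries: the Frobenius norm and inner product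
become those of this space. -/
noncomputable def vec : BandMatrix d t →ₗ[ℂ] EuclideanSpace ℂ (band d t × band d t) where
  toFun A := WithLp.toLp 2 fun p => A p.1 p.2
  map_add' _ _ := rfl
  map_smul' _ _ := rfl

@[simp] theorem vec_apply (A : BandMatrix d t) (p : band d t × band d t) :
    vec A p = A p.1 p.2 := rfl

theorem frobNorm_eq_norm_vec (A : BandMatrix d t) : frobNorm A = ‖vec A‖ := by
  rw [frobNorm, EuclideanSpace.norm_eq, Fintype.sum_prod_type]
  rfl

theorem frobInner_eq_inner_vec (A B : BandMatrix d t) :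
    frobInner A B = inner ℂ (vec A) (vec B) := by
  rw [frobInner, PiLp.inner_apply, Fintype.sum_prod_type, Finset.sum_comm]
  simp [Matrix.trace, Matrix.mul_apply, mul_comm]

theorem frobNorm_nonneg (A : BandMatrix d t) : 0 ≤ frobNorm A := Real.sqrt_nonneg _

theorem norm_frobInner_le (A B : BandMatrix d t) :
    ‖frobInner A B‖ ≤ frobNorm A * frobNorm B := by
  rw [frobInner_eq_inner_vec, frobNorm_eq_norm_vec, frobNorm_eq_norm_vec]
  exact norm_inner_le_norm _ _

theorem frobInner_sub_left (A B M : BandMatrix d t) :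
    frobInner (A - B) M = frobInner A M - frobInner B M := by
  simp only [frobInner_eq_inner_vec, map_sub, inner_sub_left]

theorem continuous_feature (x : band d t) : Continuous fun y => feature d t y x :=
  continuous_expo _

theorem featCoeff_apply (k : Fin d → ℤ) (i j : band d t) :
    featCoeff d t k i j = if k + i.1 - j.1 = 0 then 1 else 0 := by
  rw [← integral_expo]
  simp only [featCoeff, Matrix.of_apply, fcoeff, feature, star_expo, ← expo_add, sub_eq_add_neg,
    add_assoc]

/-- The pairs of frequencies at which `M^{(k)}` has an entry `1`. -/
noncomputable def diffPairs (d t : ℕ) (k : Fin d → ℤ) : Finset (band d t × band d t) :=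
  Finset.univ.filter fun p => k + p.1.1 - p.2.1 = 0

theorem frobNorm_featCoeff (k : Fin d → ℤ) :
    frobNorm (featCoeff d t k) = √((diffPairs d t k).card : ℝ) := by
  rw [frobNorm, diffPairs, Finset.card_filter, ← Fintype.sum_prod_type']
  congr 1
  push_cast
  refine Finset.sum_congr rfl fun p _ => ?_
  rw [featCoeff_apply]
  split_ifs <;> simp

/-- The frequencies `k` with `M^{(k)} ≠ 0`. -/
noncomputable def diffSet (d t : ℕ) : Finset (Fin d → ℤ) :=
  Finset.univ.image fun p : band d t × band d t => p.2.1 - p.1.1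

theorem featCoeff_eq_zero {k : Fin d → ℤ} (hk : k ∉ diffSet d t) : featCoeff d t k = 0 := by
  ext i j
  rw [featCoeff_apply, Matrix.zero_apply, if_neg]
  intro h
  exact hk (Finset.mem_image.2 ⟨(i, j), Finset.mem_univ _, by
    simp only; rw [sub_eq_zero] at h; rw [← h]; abel⟩)

theorem frobNorm_zero : frobNorm (0 : BandMatrix d t) = 0 := by
  rw [frobNorm_eq_norm_vec, map_zero, norm_zero]

theorem frobNorm_featCoeff_eq_zero {k : Fin d → ℤ} (hk : k ∉ diffSet d t) :
    frobNorm (featCoeff d t k) = 0 := by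
  rw [featCoeff_eq_zero hk, frobNorm_zero]

theorem summable_frobNorm_featCoeff :
    Summable fun k : Fin d → ℤ => frobNorm (featCoeff d t k) :=
  summable_of_ne_finset_zero (s := diffSet d t) fun _ hk => frobNorm_featCoeff_eq_zero hk

theorem tsum_frobNorm_featCoeff : ∑' k : Fin d → ℤ, frobNorm (featCoeff d t k) =
    ∑ k ∈ diffSet d t, frobNorm (featCoeff d t k) :=
  tsum_eq_sum fun _ hk => frobNorm_featCoeff_eq_zero hk

/-- By counting: `‖M^{(k)}‖` is the square root of the number of pairs of frequencies with
difference `k`, and there are `n²` pairs in total. -/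
theorem tsum_frobNorm_featCoeff_le : ∑' k : Fin d → ℤ, frobNorm (featCoeff d t k) ≤
    ((band d t).card : ℝ) ^ 2 := by
  rw [tsum_frobNorm_featCoeff]
  have h1 : ∀ k ∈ diffSet d t, frobNorm (featCoeff d t k) ≤ ((diffPairs d t k).card : ℝ) := by
    intro k _
    rw [frobNorm_featCoeff, Real.sqrt_le_left (by positivity)]
    exact_mod_cast Nat.le_self_pow two_ne_zero _
  refine (Finset.sum_le_sum h1).trans (le_of_eq ?_)
  have h2 := Finset.card_eq_sum_card_image
    (fun p : band d t × band d t => p.2.1 - p.1.1) Finset.univ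
  have h3 : ∀ k, (Finset.univ.filter fun p : band d t × band d t => p.2.1 - p.1.1 = k) =
      diffPairs d t k := by
    intro k
    unfold diffPairs
    refine Finset.filter_congr fun p _ => ?_
    rw [sub_eq_iff_eq_add, sub_eq_zero]
    exact eq_comm
  simp only [h3] at h2
  rw [Finset.card_univ, Fintype.card_prod, Fintype.card_coe] at h2
  rw [sq]
  exact_mod_cast h2.symm

theorem zero_mem_band : (0 : Fin d → ℤ) ∈ band d t := by
  rw [mem_band]; simp [len]

theorem one_le_frobNorm_featCoeff {k : Fin d → ℤ} (hk : k ∈ band d t) :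
    1 ≤ frobNorm (featCoeff d t k) := by
  rw [frobNorm_featCoeff, Real.one_le_sqrt]
  have : 0 < (diffPairs d t k).card :=
    Finset.card_pos.2 ⟨(⟨0, zero_mem_band⟩, ⟨k, hk⟩), by simp [diffPairs]⟩
  exact_mod_cast this

theorem card_band_le_tsum :
    ((band d t).card : ℝ) ≤ ∑' k : Fin d → ℤ, frobNorm (featCoeff d t k) := by
  have h1 : ((band d t).card : ℝ) = ∑ k ∈ band d t, (1 : ℝ) := by simp
  rw [h1]
  exact (Finset.sum_le_sum fun k hk => one_le_frobNorm_featCoeff hk).trans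
    (summable_frobNorm_featCoeff.sum_le_tsum _ fun k _ => frobNorm_nonneg _)

theorem three_le_card_band (hd : 1 ≤ d) (ht : 1 ≤ t) : 3 ≤ (band d t).card := by
  set e : ℤ → Fin d → ℤ := fun a => Pi.single ⟨0, hd⟩ a with he
  have hinj : Function.Injective e := fun a b h => by simpa [he] using congrFun h ⟨0, hd⟩
  have hsub : (Finset.Icc (-1 : ℤ) 1).image e ⊆ band d t := by
    intro k hk
    obtain ⟨a, ha, rfl⟩ := Finset.mem_image.1 hk
    rw [mem_band, len, Finset.sum_eq_single ⟨0, hd⟩]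
    · rw [Finset.mem_Icc] at ha
      simp only [he, Pi.single_eq_same]
      rw [abs_le]
      omega
    · intro j _ hj
      simp [he, hj]
    · simp
  have := Finset.card_le_card hsub
  rw [Finset.card_image_of_injective _ hinj] at this
  simpa using this

theorem card_band_le (ht : 1 ≤ t) : ((band d t).card : ℝ) ≤ 3 ^ d * (t : ℝ) ^ d := by
  have h1 : band d t ⊆ box d t := by
    intro k hk
    rw [mem_box, supLen_le_iff]
    intro j
    have h2 : |k j| ≤ len k :=
      Finset.single_le_sum (f := fun j => |k j|) (fun i _ => abs_nonneg _) (Finset.mem_univ j)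
    have h3 := h2.trans (mem_band.1 hk)
    rw [Int.abs_eq_natAbs] at h3
    exact_mod_cast h3
  have h2 := Finset.card_le_card h1
  rw [card_box] at h2
  have h3 : (2 * t + 1) ^ d ≤ (3 * t) ^ d := Nat.pow_le_pow_left (by omega) d
  rw [← mul_pow]
  exact_mod_cast h2.trans h3

/-! ### The model and its Fourier coefficients -/

theorem model_eq_sum (A : BandMatrix d t) (x : Fin d → ℝ) :
    model A x = ∑ i, ∑ j, A i j * (feature d t x j * star (feature d t x i)) := by
  simp only [model, dotProduct, Matrix.mulVec, Finset.mul_sum, Pi.star_apply]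
  exact Finset.sum_congr rfl fun i _ => Finset.sum_congr rfl fun j _ => by ring

theorem continuous_model (A : BandMatrix d t) : Continuous (model A) := by
  rw [show model A = _ from funext (model_eq_sum A)]
  exact continuous_finsetSum _ fun i _ => continuous_finsetSum _ fun j _ =>
    continuous_const.mul ((continuous_feature j).mul (continuous_feature i).star)

theorem latticePeriodic_model (A : BandMatrix d t) : LatticePeriodic (model A) := by
  intro x k
  simp only [model_eq_sum, feature, latticePeriodic_expo _ x k]

theorem fcoeff_model {A : BandMatrix d t} (hA : A.IsHermitian) (k : Fin d → ℤ) :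
    fcoeff (model A) k = frobInner A (featCoeff d t k) := by
  have hint : ∀ i j : band d t, IntegrableOn
      (fun x => A i j * (expo k x * (feature d t x j * star (feature d t x i)))) (cube d) :=
    fun i j => integrableOn_cube_of_continuous (continuous_const.mul ((continuous_expo k).mul
      ((continuous_feature j).mul (continuous_feature i).star)))
  have h1 : ∀ x, expo k x * model A x =
      ∑ i, ∑ j, A i j * (expo k x * (feature d t x j * star (feature d t x i))) := by
    intro x
    rw [model_eq_sum, Finset.mul_sum]
    refine Finset.sum_congr rfl fun i _ => ?_
    rw [Finset.mul_sum]
    exact Finset.sum_congr rfl fun j _ => by ring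
  rw [fcoeff]
  simp only [h1]
  rw [integral_finsetSum _ fun i _ => integrable_finsetSum _ fun j _ => hint i j, frobInner]
  simp only [Matrix.trace, Matrix.diag, Matrix.mul_apply, hA.eq]
  refine Finset.sum_congr rfl fun i _ => ?_
  rw [integral_finsetSum _ fun j _ => hint i j]
  refine Finset.sum_congr rfl fun j _ => ?_
  rw [integral_const_mul]
  rfl

theorem re_model_nonneg {A : BandMatrix d t} (hA : A.PosSemidef) (x : Fin d → ℝ) :
    0 ≤ (model A x).re :=
  hA.re_dotProduct_nonneg _

/-! ### The expected objective -/

/-- The Fourier coefficient of `f - g_A` at `k`, for Hermitian `A`. -/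
noncomputable def residual (f : (Fin d → ℝ) → ℝ) (A : BandMatrix d t) (k : Fin d → ℤ) : ℂ :=
  fcoeff (fun x => (f x : ℂ)) k - frobInner A (featCoeff d t k)

/-- The unnormalized stochastic objective `π_k L_k(A)`. -/
noncomputable def objTerm (f : (Fin d → ℝ) → ℝ) (A : BandMatrix d t) (k : Fin d → ℤ) : ℝ :=
  if k = 0 then (residual f A k).re else -‖residual f A k‖

/-- The objective `∑_k π_k L_k(A)`, which is the expectation of the stochastic objective. -/
noncomputable def expectedObj (f : (Fin d → ℝ) → ℝ) (A : BandMatrix d t) : ℝ :=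
  ∑' k, objTerm f A k

theorem stochObj_eq (f : (Fin d → ℝ) → ℝ) (A : BandMatrix d t) (k : Fin d → ℤ) :
    stochObj f k A = objTerm f A k / prob d t k := by
  unfold stochObj objTerm residual
  split_ifs <;> rfl

theorem abs_objTerm_le (f : (Fin d → ℝ) → ℝ) (A : BandMatrix d t) (k : Fin d → ℤ) :
    |objTerm f A k| ≤ ‖residual f A k‖ := by
  unfold objTerm
  split_ifs
  · exact Complex.abs_re_le_norm _
  · rw [abs_neg, abs_norm]

theorem abs_objTerm_sub_le (f : (Fin d → ℝ) → ℝ) (A B : BandMatrix d t) (k : Fin d → ℤ) :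
    |objTerm f A k - objTerm f B k| ≤ frobNorm (A - B) * frobNorm (featCoeff d t k) := by
  have h : residual f A k - residual f B k = -frobInner (A - B) (featCoeff d t k) := by
    simp only [residual, frobInner_sub_left]; ring
  have h2 : ‖residual f A k - residual f B k‖ ≤ frobNorm (A - B) * frobNorm (featCoeff d t k) := by
    rw [h, norm_neg]; exact norm_frobInner_le _ _
  refine le_trans ?_ h2
  unfold objTerm
  split_ifs
  · rw [← Complex.sub_re]; exact Complex.abs_re_le_norm _
  · rw [neg_sub_neg, abs_sub_comm]; exact abs_norm_sub_norm_le _ _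

theorem summable_norm_residual {f : (Fin d → ℝ) → ℝ}
    (hsum : Summable fun k => ‖fcoeff (fun x => (f x : ℂ)) k‖)
    (A : BandMatrix d t) : Summable fun k => ‖residual f A k‖ := by
  refine Summable.of_nonneg_of_le (fun _ => norm_nonneg _) (fun k => ?_)
    (hsum.add ((summable_frobNorm_featCoeff (t := t)).mul_left (frobNorm A)))
  exact (norm_sub_le _ _).trans (by gcongr; exact norm_frobInner_le _ _)

theorem summable_objTerm {f : (Fin d → ℝ) → ℝ}
    (hsum : Summable fun k => ‖fcoeff (fun x => (f x : ℂ)) k‖)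
    (A : BandMatrix d t) : Summable (objTerm f A) :=
  Summable.of_norm_bounded (summable_norm_residual hsum A) fun k => abs_objTerm_le f A k

theorem abs_expectedObj_sub_le {f : (Fin d → ℝ) → ℝ}
    (hsum : Summable fun k => ‖fcoeff (fun x => (f x : ℂ)) k‖)
    (A B : BandMatrix d t) :
    |expectedObj f A - expectedObj f B| ≤
      frobNorm (A - B) * ∑' k : Fin d → ℤ, frobNorm (featCoeff d t k) := by
  have hd := (summable_objTerm hsum A).sub (summable_objTerm hsum B)
  rw [expectedObj, expectedObj, ← (summable_objTerm hsum A).tsum_sub (summable_objTerm hsum B),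
    ← tsum_mul_left]
  have hb := (summable_frobNorm_featCoeff (d := d) (t := t)).mul_left (frobNorm (A - B))
  exact tsum_of_norm_bounded (f := fun k => objTerm f A k - objTerm f B k) hb.hasSum
    fun k => abs_objTerm_sub_le f A B k

/-- A nonnegative model certifies a lower bound: `f = g_A + (f - g_A)`, and the Fourier series of
`f - g_A` is at least the expected objective. -/
theorem expectedObj_le {f : (Fin d → ℝ) → ℝ}
    (hsum : Summable fun k => ‖fcoeff (fun x => (f x : ℂ)) k‖)
    (hc : Continuous f) (hp : LatticePeriodic f) {A : BandMatrix d t}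
    (hA : A.PosSemidef) (x : Fin d → ℝ) : expectedObj f A ≤ f x := by
  set u : (Fin d → ℝ) → ℂ := fun x => (f x : ℂ) - model A x with hu
  have hfc : Continuous fun x => (f x : ℂ) := Complex.continuous_ofReal.comp hc
  have hcoef : ∀ k, fcoeff u k = residual f A k := by
    intro k
    rw [residual, ← fcoeff_model hA.isHermitian, fcoeff, fcoeff, fcoeff, ← integral_sub]
    · exact integral_congr_ae (Filter.Eventually.of_forall fun x => mul_sub _ _ _)
    · exact integrableOn_cube_of_continuous ((continuous_expo k).mul hfc)
    · exact integrableOn_cube_of_continuous ((continuous_expo k).mul (continuous_model A))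
  have huc : Continuous u := hfc.sub (continuous_model A)
  have hup : LatticePeriodic u := fun x k => by
    simp only [hu, hp x k, latticePeriodic_model A x k]
  have hs := hasSum_fourier_series huc hup
    ((summable_norm_residual hsum A).congr fun k => by rw [hcoef]) x
  have hre : HasSum (fun k => (fcoeff u k * star (expo k x)).re) (u x).re := Complex.hasSum_re hs
  have hle : ∀ k, objTerm f A k ≤ (fcoeff u k * star (expo k x)).re := by
    intro k
    rw [hcoef, objTerm]
    split_ifs with h
    · simp [h]
    · have h1 := Complex.abs_re_le_norm (residual f A k * star (expo k x))
      rw [norm_mul, norm_star, norm_expo, mul_one] at h1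
      exact (abs_le.1 h1).1
  have h1 := (summable_objTerm hsum A).hasSum
  have h2 := hasSum_le hle h1 hre
  have h3 := re_model_nonneg hA x
  simp only [hu, Complex.sub_re, Complex.ofReal_re] at h2
  rw [expectedObj]
  linarith

theorem expectedObj_le_globalMin {f : (Fin d → ℝ) → ℝ}
    (hsum : Summable fun k => ‖fcoeff (fun x => (f x : ℂ)) k‖)
    (hc : Continuous f) (hp : LatticePeriodic f)
    {A : BandMatrix d t} (hA : A.PosSemidef) : expectedObj f A ≤ globalMin f := by
  refine le_csInf ⟨f 0, 0, ⟨le_rfl, zero_le_one⟩, rfl⟩ ?_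
  rintro _ ⟨x, -, rfl⟩
  exact expectedObj_le hsum hc hp hA x

theorem relaxObj_le_expectedObj {f : (Fin d → ℝ) → ℝ}
    (hsum : Summable fun k => ‖fcoeff (fun x => (f x : ℂ)) k‖)
    (hc : Continuous f) {A : BandMatrix d t}
    (hA : A.IsHermitian) (c : ℝ) : relaxObj f c A ≤ expectedObj f A := by
  have hfc : Continuous fun x => (f x : ℂ) := Complex.continuous_ofReal.comp hc
  have hcoef : ∀ k, fcoeff (fun x => (f x : ℂ) - (c : ℂ) - model A x) k =
      residual f A k - if k = 0 then (c : ℂ) else 0 := by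
    intro k
    have h1 : (if k = 0 then (c : ℂ) else 0) = ∫ x in cube d, c * expo k x := by
      rw [integral_const_mul, integral_expo]; split_ifs <;> simp
    have i1 : IntegrableOn (fun x => expo k x * (f x : ℂ)) (cube d) :=
      integrableOn_cube_of_continuous ((continuous_expo k).mul hfc)
    have i2 : IntegrableOn (fun x => expo k x * model A x) (cube d) :=
      integrableOn_cube_of_continuous ((continuous_expo k).mul (continuous_model A))
    have i3 : IntegrableOn (fun x => (c : ℂ) * expo k x) (cube d) :=
      integrableOn_cube_of_continuous (continuous_const.mul (continuous_expo k))
    have i12 : IntegrableOn (fun x => expo k x * (f x : ℂ) - expo k x * model A x) (cube d) :=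
      i1.sub i2
    rw [residual, ← fcoeff_model hA, h1, fcoeff, fcoeff, fcoeff,
      ← integral_sub i1 i2,
      ← integral_sub i12 i3]
    refine integral_congr_ae (Filter.Eventually.of_forall fun x => ?_)
    simp only
    ring
  set δ : (Fin d → ℤ) → ℝ := fun k => if k = 0 then c else 0 with hδ
  have hδs : HasSum δ c := hasSum_ite_eq 0 c
  have hbs : Summable fun k => ‖residual f A k - if k = 0 then (c : ℂ) else 0‖ := by
    refine Summable.of_nonneg_of_le (fun _ => norm_nonneg _) (fun k => norm_sub_le _ _)
      ((summable_norm_residual hsum A).add ?_)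
    refine hδs.summable.norm.congr fun k => ?_
    simp only [hδ]
    split_ifs <;> simp
  rw [relaxObj, FNorm]
  simp only [hcoef]
  refine hasSum_le (fun k => ?_) (hδs.sub hbs.hasSum) (summable_objTerm hsum A).hasSum
  simp only [hδ, objTerm]
  split_ifs with h
  · have h1 := Complex.abs_re_le_norm (residual f A k - c)
    rw [Complex.sub_re, Complex.ofReal_re] at h1
    linarith [(abs_le.1 h1).1]
  · simp

theorem le_objTerm_convex {ι : Type*} [Fintype ι] (f : (Fin d → ℝ) → ℝ) (w : ι → ℝ)
    (hw : ∀ i, 0 ≤ w i) (hw1 : ∑ i, w i = 1) (A : ι → BandMatrix d t) (k : Fin d → ℤ) :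
    ∑ i, w i * objTerm f (A i) k ≤ objTerm f (∑ i, (w i : ℂ) • A i) k := by
  have hres : residual f (∑ i, (w i : ℂ) • A i) k = ∑ i, (w i : ℂ) * residual f (A i) k := by
    simp only [residual, mul_sub, Finset.sum_sub_distrib, ← Finset.sum_mul]
    rw [← Complex.ofReal_sum, hw1]
    simp only [frobInner_eq_inner_vec, map_sum, map_smul, sum_inner, inner_smul_left,
      Complex.conj_ofReal, Complex.ofReal_one, one_mul]
  unfold objTerm
  split_ifs
  · rw [hres, Complex.re_sum]
    exact (Finset.sum_congr rfl fun i _ => by simp).le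
  · simp only [mul_neg, Finset.sum_neg_distrib, neg_le_neg_iff]
    rw [hres]
    refine (norm_sum_le _ _).trans (Finset.sum_le_sum fun i _ => ?_)
    rw [norm_mul, Complex.norm_real, Real.norm_of_nonneg (hw i)]

theorem le_expectedObj_convex {ι : Type*} [Fintype ι] {f : (Fin d → ℝ) → ℝ}
    (hsum : Summable fun k => ‖fcoeff (fun x => (f x : ℂ)) k‖) (w : ι → ℝ)
    (hw : ∀ i, 0 ≤ w i) (hw1 : ∑ i, w i = 1) (A : ι → BandMatrix d t) :
    ∑ i, w i * expectedObj f (A i) ≤ expectedObj f (∑ i, (w i : ℂ) • A i) :=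
  hasSum_le (fun k => le_objTerm_convex f w hw hw1 A k)
    (hasSum_sum fun i _ => (summable_objTerm hsum (A i)).hasSum.mul_left (w i))
    (summable_objTerm hsum _).hasSum

end

/-! ### The gap of the relaxation -/

section

variable {d t : ℕ}

/-- The `F` norm of an absolutely convergent exponential series is at most the sum of the absolute
values of its coefficients. -/
theorem tsum_enorm_fcoeff_le {P : Type*} [Countable P] {b : P → ℂ} {ν : P → Fin d → ℤ}
    (hb : Summable fun p => ‖b p‖) {u : (Fin d → ℝ) → ℂ}
    (hu : ∀ x, HasSum (fun p => b p * expo (ν p) x) (u x)) :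
    ∑' k, ‖fcoeff u k‖ₑ ≤ ∑' p, ‖b p‖ₑ := by
  have hcoef : ∀ k, fcoeff u k = ∑' p, if k + ν p = 0 then b p else 0 := by
    intro k
    have hF : ∀ p, Integrable (fun x => b p * expo (k + ν p) x) (volume.restrict (cube d)) :=
      fun p => integrableOn_cube_of_continuous (continuous_const.mul (continuous_expo _))
    have hn : Summable fun p => ∫ x in cube d, ‖b p * expo (k + ν p) x‖ := by
      refine hb.congr fun p => ?_
      simp [norm_expo, Measure.real]
    have h1 := (hasSum_integral_of_summable_integral_norm hF hn).tsum_eq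
    have h2 : fcoeff u k = ∫ x in cube d, ∑' p, b p * expo (k + ν p) x := by
      refine integral_congr_ae (Filter.Eventually.of_forall fun x => ?_)
      have h3 := ((hu x).mul_left (expo k x)).tsum_eq
      simp only
      rw [← h3]
      refine tsum_congr fun p => ?_
      rw [expo_add]; ring
    rw [h2, ← h1]
    refine tsum_congr fun p => ?_
    rw [integral_const_mul, integral_expo]
    split_ifs <;> simp
  calc ∑' k, ‖fcoeff u k‖ₑ ≤ ∑' k, ∑' p, if k + ν p = 0 then ‖b p‖ₑ else 0 := by
        refine ENNReal.tsum_le_tsum fun k => ?_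
        rw [hcoef]
        refine enorm_tsum_le_tsum_enorm.trans (ENNReal.tsum_le_tsum fun p => ?_)
        split_ifs <;> simp
    _ = ∑' p, ∑' k, if k + ν p = 0 then ‖b p‖ₑ else 0 := ENNReal.tsum_comm
    _ = ∑' p, ‖b p‖ₑ := by
        refine tsum_congr fun p => ?_
        rw [tsum_eq_single (-ν p)]
        · simp
        · intro k hk
          rw [if_neg]
          exact fun h => hk (eq_neg_of_add_eq_zero_left h)

/-- The vector of the Fourier coefficients of `g` at the frequencies `|k| ≤ t`. -/
noncomputable def coeffVec (t : ℕ) (g : (Fin d → ℝ) → ℝ) : band d t → ℂ :=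
  fun k => fcoeff (fun x => (g x : ℂ)) k.1

/-- The rank one matrix `ĝ ĝ^*`, whose model is `|∑_{|k| ≤ t} ĝ_k conj(e_k)|²`, the squared modulus
of the truncated Fourier series of `g`. -/
noncomputable def truncMatrix (t : ℕ) (g : (Fin d → ℝ) → ℝ) : BandMatrix d t :=
  Matrix.vecMulVec (coeffVec t g) (star (coeffVec t g))

/-- The Fourier coefficients of `g`, set to `0` outside `|k| ≤ t`. -/
noncomputable def truncCoeff (t : ℕ) (g : (Fin d → ℝ) → ℝ) (k : Fin d → ℤ) : ℂ :=
  if k ∈ band d t then fcoeff (fun x => (g x : ℂ)) k else 0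

theorem hasSum_mul_of_summable_norm {Z : Type*} {b c : Z → ℂ} (hb : Summable fun k => ‖b k‖)
    (hc : Summable fun k => ‖c k‖) {y z : ℂ} (h : HasSum b y) (h' : HasSum c z) :
    HasSum (fun p : Z × Z => b p.1 * c p.2) (y * z) :=
  h.mul h' (summable_mul_of_summable_norm hb hc)

theorem hasSum_mul_star {Z : Type*} {b : Z → ℂ} (hb : Summable fun k => ‖b k‖) {y : ℂ}
    (h : HasSum b y) : HasSum (fun p : Z × Z => b p.1 * star (b p.2)) (y * star y) :=
  hasSum_mul_of_summable_norm hb (hb.congr fun _ => (norm_star _).symm) h h.star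

theorem expo_sub (k l : Fin d → ℤ) (x : Fin d → ℝ) :
    expo (l - k) x = star (expo k x) * expo l x := by
  rw [sub_eq_add_neg, expo_add, star_expo, mul_comm]

theorem hasSum_prod_expo {a : (Fin d → ℤ) → ℂ} (ha : Summable fun k => ‖a k‖) {x : Fin d → ℝ}
    {y : ℂ} (h : HasSum (fun k => a k * star (expo k x)) y) :
    HasSum (fun p : (Fin d → ℤ) × (Fin d → ℤ) => a p.1 * star (a p.2) * expo (p.2 - p.1) x)
      (y * star y) := by
  have h2 : Summable fun k => ‖a k * star (expo k x)‖ :=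
    ha.congr fun k => by rw [norm_mul, norm_star, norm_expo, mul_one]
  refine (hasSum_mul_star h2 h).congr_fun fun p => ?_
  rw [star_mul', star_star, expo_sub]
  ring

theorem model_truncMatrix (g : (Fin d → ℝ) → ℝ) (x : Fin d → ℝ) :
    model (truncMatrix t g) x =
      (∑ k ∈ band d t, truncCoeff t g k * star (expo k x)) *
        star (∑ k ∈ band d t, truncCoeff t g k * star (expo k x)) := by
  have h1 : ∑ k ∈ band d t, truncCoeff t g k * star (expo k x) =
      ∑ k : band d t, coeffVec t g k * star (feature d t x k) := by
    rw [← Finset.sum_coe_sort]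
    refine Finset.sum_congr rfl fun k _ => ?_
    rw [truncCoeff, if_pos k.2]; rfl
  rw [h1, model_eq_sum, star_sum, Finset.sum_mul_sum]
  refine Finset.sum_congr rfl fun i _ => Finset.sum_congr rfl fun j _ => ?_
  simp only [truncMatrix, Matrix.vecMulVec_apply, Pi.star_apply, star_mul', star_star]
  ring

/-- In the algebra of absolutely convergent Fourier series, `g² - |g_t|²` is as small as `g - g_t`,
where `g_t` is the truncated Fourier series of `g`. -/
theorem tsum_enorm_fcoeff_sq_sub_model_le {g : (Fin d → ℝ) → ℝ} (hc : Continuous g)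
    (hp : LatticePeriodic g) (hs : Summable fun k => ‖fcoeff (fun x => (g x : ℂ)) k‖) :
    ∑' k, ‖fcoeff (fun x => ((g x ^ 2 : ℝ) : ℂ) - model (truncMatrix t g) x) k‖ₑ ≤
      2 * (∑' k, ‖fcoeff (fun x => (g x : ℂ)) k‖ₑ) *
        ∑' k, (if (t : ℤ) < len k then ‖fcoeff (fun x => (g x : ℂ)) k‖ₑ else 0) := by
  set a : (Fin d → ℤ) → ℂ := fcoeff (fun x => (g x : ℂ)) with ha
  set a' := truncCoeff t g with ha'
  have ha's : Summable fun k => ‖a' k‖ := by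
    refine Summable.of_nonneg_of_le (fun _ => norm_nonneg _) (fun k => ?_) hs
    simp only [ha', truncCoeff]
    split_ifs
    · exact le_rfl
    · simp
  have hser : ∀ x, HasSum (fun k => a k * star (expo k x)) (g x : ℂ) := fun x =>
    hasSum_fourier_series (Complex.continuous_ofReal.comp hc) hp.ofReal hs x
  have hser' : ∀ x, HasSum (fun k => a' k * star (expo k x))
      (∑ k ∈ band d t, a' k * star (expo k x)) := fun x =>
    hasSum_sum_of_ne_finset_zero fun k hk => by
      simp only [ha', truncCoeff, if_neg hk, zero_mul]
  set b : (Fin d → ℤ) × (Fin d → ℤ) → ℂ :=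
    fun p => a p.1 * star (a p.2) - a' p.1 * star (a' p.2) with hb
  have hprod : ∀ c : (Fin d → ℤ) → ℂ, (Summable fun k => ‖c k‖) →
      Summable fun p : (Fin d → ℤ) × (Fin d → ℤ) => ‖c p.1 * star (c p.2)‖ := fun c hcs => by
    have h1 : Summable fun k => ‖‖c k‖‖ := by simpa using hcs
    simpa [norm_mul] using summable_mul_of_summable_norm h1 h1
  have hbs : Summable fun p => ‖b p‖ :=
    Summable.of_nonneg_of_le (fun _ => norm_nonneg _) (fun p => norm_sub_le _ _)
      ((hprod a hs).add (hprod a' ha's))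
  have hu : ∀ x, HasSum (fun p => b p * expo (p.2 - p.1) x)
      (((g x ^ 2 : ℝ) : ℂ) - model (truncMatrix t g) x) := by
    intro x
    have h1 := (hasSum_prod_expo hs (hser x)).sub (hasSum_prod_expo ha's (hser' x))
    rw [← model_truncMatrix] at h1
    have h2 : ((g x ^ 2 : ℝ) : ℂ) = (g x : ℂ) * star (g x : ℂ) := by
      rw [sq, Complex.ofReal_mul, Complex.star_def, Complex.conj_ofReal]
    rw [h2]
    exact h1.congr_fun fun p => by simp only [hb]; ring
  refine (tsum_enorm_fcoeff_le hbs hu).trans ?_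
  have hterm : ∀ p : (Fin d → ℤ) × (Fin d → ℤ), ‖b p‖ₑ ≤
      (if (t : ℤ) < len p.1 then ‖a p.1‖ₑ else 0) * ‖a p.2‖ₑ +
        ‖a p.1‖ₑ * (if (t : ℤ) < len p.2 then ‖a p.2‖ₑ else 0) := by
    intro p
    have hband : ∀ k : Fin d → ℤ, k ∉ band d t ↔ (t : ℤ) < len k := fun k => by
      rw [mem_band, not_le]
    simp only [← hband, hb, ha', truncCoeff]
    by_cases h1 : p.1 ∈ band d t <;> by_cases h2 : p.2 ∈ band d t
    all_goals simp [h1, h2, ← ha]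
  refine (ENNReal.tsum_le_tsum hterm).trans (le_of_eq ?_)
  rw [ENNReal.tsum_add, ENNReal.tsum_prod', ENNReal.tsum_prod']
  simp only [ENNReal.tsum_mul_left, ENNReal.tsum_mul_right]
  ring

/-- The value of the relaxation is within `O(t^{-m})` of the global minimum. -/
theorem exists_relaxObj_ge (hd : 1 ≤ d) {m : ℝ} (hm : 0 < m) {s : ℕ}
    (hs : m + (d : ℝ) / 2 ≤ s) {f : (Fin d → ℝ) → ℝ} (hf : ContDiff ℝ (s + 2 : ℕ) f)
    (hp : LatticePeriodic f) (hfin : (minimizers f).Finite)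
    (hhess : ∀ x ∈ minimizers f, HasPosHessian f x) :
    ∃ C : ℝ, ∀ t : ℕ, 1 ≤ t → ∃ A : BandMatrix d t, A.PosSemidef ∧
      globalMin f - C * (t : ℝ) ^ (-m) ≤ relaxObj f (globalMin f) A := by
  obtain ⟨ι, _, g, hg, hsq⟩ := exists_sum_sq hf hp hfin hhess
  have hds : d < 2 * s := by
    have : (d : ℝ) < 2 * s := by linarith
    exact_mod_cast this
  choose C hC0 hC using fun i => exists_tail_fcoeff_le hd hm hs (hg i).1 (hg i).2
  have hgs := fun i => summable_fcoeff hd hds (hg i).1 (hg i).2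
  set S : ι → ℝ := fun i => ∑' k, ‖fcoeff (fun x => (g i x : ℂ)) k‖ with hS
  have hSe : ∀ i, ∑' k, ‖fcoeff (fun x => (g i x : ℂ)) k‖ₑ = ENNReal.ofReal (S i) := fun i => by
    rw [hS, ENNReal.ofReal_tsum_of_nonneg (fun _ => norm_nonneg _) (hgs i)]
    simp only [ofReal_norm]
  have hS0 : ∀ i, 0 ≤ S i := fun i => tsum_nonneg fun _ => norm_nonneg _
  refine ⟨∑ i, 2 * S i * C i, fun t ht => ⟨∑ i, truncMatrix t (g i),
    Matrix.posSemidef_sum _ fun i _ => Matrix.posSemidef_vecMulVec_self_star _, ?_⟩⟩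
  have ht' : (0 : ℝ) < t := by exact_mod_cast ht
  have htm : 0 ≤ (t : ℝ) ^ (-m) := (Real.rpow_pos_of_pos ht' _).le
  set u : ι → (Fin d → ℝ) → ℂ := fun i x =>
    ((g i x ^ 2 : ℝ) : ℂ) - model (truncMatrix t (g i)) x with hu
  have huc : ∀ i, Continuous (u i) := fun i =>
    (Complex.continuous_ofReal.comp ((hg i).1.continuous.pow 2)).sub (continuous_model _)
  have hfun : (fun x => (f x : ℂ) - (globalMin f : ℂ) - model (∑ i, truncMatrix t (g i)) x) =
      fun x => ∑ i, u i x := by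
    funext x
    rw [← Complex.ofReal_sub, hsq x]
    simp only [hu, Finset.sum_sub_distrib, Complex.ofReal_sum]
    congr 1
    simp only [model, Matrix.sum_mulVec, dotProduct_sum]
  have hcoef : ∀ k, fcoeff (fun x => ∑ i, u i x) k = ∑ i, fcoeff (u i) k := by
    intro k
    simp only [fcoeff, Finset.mul_sum]
    exact integral_finsetSum _ fun i _ =>
      integrableOn_cube_of_continuous ((continuous_expo k).mul (huc i))
  have hF : ∑' k, ‖fcoeff (fun x => ∑ i, u i x) k‖ₑ ≤
      ENNReal.ofReal (∑ i, 2 * S i * C i * (t : ℝ) ^ (-m)) := by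
    calc ∑' k, ‖fcoeff (fun x => ∑ i, u i x) k‖ₑ
        ≤ ∑' k, ∑ i, ‖fcoeff (u i) k‖ₑ := by
          refine ENNReal.tsum_le_tsum fun k => ?_
          rw [hcoef]
          exact enorm_sum_le _ _
      _ = ∑ i, ∑' k, ‖fcoeff (u i) k‖ₑ :=
          Summable.tsum_finsetSum fun i _ => ENNReal.summable
      _ ≤ ∑ i, ENNReal.ofReal (2 * S i * C i * (t : ℝ) ^ (-m)) := by
          refine Finset.sum_le_sum fun i _ => ?_
          refine (tsum_enorm_fcoeff_sq_sub_model_le (hg i).1.continuous (hg i).2 (hgs i)).trans ?_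
          rw [hSe, show (2 : ENNReal) = ENNReal.ofReal 2 by simp, mul_assoc (2 * S i),
            ENNReal.ofReal_mul (by have := hS0 i; positivity), ENNReal.ofReal_mul (by norm_num)]
          gcongr
          exact hC i t ht
      _ = _ := by
          rw [ENNReal.ofReal_sum_of_nonneg]
          intro i _
          have := hS0 i
          have := hC0 i
          positivity
  have hN : FNorm (fun x => ∑ i, u i x) ≤ ∑ i, 2 * S i * C i * (t : ℝ) ^ (-m) := by
    have h1 := ENNReal.toReal_mono ENNReal.ofReal_ne_top hF
    rw [ENNReal.toReal_ofReal (Finset.sum_nonneg fun i _ => by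
      have := hS0 i
      have := hC0 i
      positivity), ENNReal.tsum_toReal_eq (fun k => enorm_ne_top)] at h1
    simpa only [toReal_enorm, FNorm] using h1
  rw [relaxObj, hfun, Finset.sum_mul]
  linarith

end

/-! ### Concentration along a chain driven by i.i.d. samples -/

section

section Chain

variable {Z S : Type*}

/-- The states `s_0, …, s_T` of the recursion `s_{i+1} = F(s_i, k_i)`. -/
def chainState (F : S → Z → S) (s₀ : S) {T : ℕ} (ks : Fin T → Z) : Fin (T + 1) → S :=
  Fin.induction (motive := fun _ => S) s₀ fun i s => F s (ks i)

@[simp] theorem chainState_zero (F : S → Z → S) (s₀ : S) {T : ℕ} (ks : Fin T → Z) :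
    chainState F s₀ ks 0 = s₀ := rfl

theorem chainState_succ (F : S → Z → S) (s₀ : S) {T : ℕ} (ks : Fin T → Z) (i : Fin T) :
    chainState F s₀ ks i.succ = F (chainState F s₀ ks i.castSucc) (ks i) :=
  Fin.induction_succ _ _ _

theorem chainState_mem {F : S → Z → S} {s₀ : S} {I : Set S} (h0 : s₀ ∈ I)
    (hF : ∀ s ∈ I, ∀ z, F s z ∈ I) {T : ℕ} (ks : Fin T → Z) (i : Fin (T + 1)) :
    chainState F s₀ ks i ∈ I := by
  induction i using Fin.induction with
  | zero => exact h0
  | succ i ih => rw [chainState_succ]; exact hF _ ih _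

theorem chainState_cons (F : S → Z → S) (s₀ : S) {T : ℕ} (z : Z) (ks : Fin T → Z)
    (i : Fin (T + 1)) :
    chainState F s₀ (Fin.cons z ks : Fin (T + 1) → Z) i.succ = chainState F (F s₀ z) ks i := by
  induction i using Fin.induction with
  | zero => rw [chainState_succ]; rfl
  | succ i ih =>
    rw [chainState_succ, Fin.castSucc_succ, ih, chainState_succ, Fin.cons_succ]

variable [MeasurableSpace Z] [Countable Z] [MeasurableSingletonClass Z] (μ : Measure Z)
  [IsProbabilityMeasure μ]

/-- Conditioning on the first sample, by induction on the number of samples. -/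
theorem lintegral_prod_chain_le {F : S → Z → S} {ψ : S → Z → ENNReal} {c : ENNReal} {I : Set S}
    (hF : ∀ s ∈ I, ∀ z, F s z ∈ I) (hψ : ∀ s ∈ I, ∫⁻ z, ψ s z ∂μ ≤ c) (T : ℕ) :
    ∀ s₀ ∈ I, ∫⁻ ks, ∏ i : Fin T, ψ (chainState F s₀ ks i.castSucc) (ks i)
      ∂(Measure.pi fun _ : Fin T => μ) ≤ c ^ T := by
  induction T with
  | zero => intro s₀ _; simp
  | succ T ih =>
    intro s₀ h0
    have hmp := (measurePreserving_piFinSuccAbove (fun _ : Fin (T + 1) => μ) 0).symm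
    rw [← hmp.lintegral_comp (measurable_of_countable _),
      lintegral_prod _ (measurable_of_countable _).aemeasurable]
    have hcons : ∀ (z : Z) (ks : Fin T → Z),
        (MeasurableEquiv.piFinSuccAbove (fun _ : Fin (T + 1) => Z) 0).symm (z, ks) =
          (Fin.cons z ks : Fin (T + 1) → Z) := fun z ks => by
      simp [MeasurableEquiv.piFinSuccAbove, Fin.insertNthEquiv_zero]
      rfl
    calc _ = ∫⁻ z, ψ s₀ z * ∫⁻ ks, ∏ i : Fin T, ψ (chainState F (F s₀ z) ks i.castSucc) (ks i)
          ∂(Measure.pi fun _ : Fin T => μ) ∂μ := by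
          refine lintegral_congr fun z => ?_
          rw [← lintegral_const_mul _ (measurable_of_countable _)]
          refine lintegral_congr fun ks => ?_
          rw [hcons, Fin.prod_univ_succ]
          simp only [Fin.cons_zero, Fin.cons_succ, Fin.castSucc_zero, chainState_zero,
            ← Fin.succ_castSucc, chainState_cons]
      _ ≤ ∫⁻ z, ψ s₀ z * c ^ T ∂μ := by
          refine lintegral_mono fun z => ?_
          gcongr
          exact ih _ (hF _ h0 z)
      _ = (∫⁻ z, ψ s₀ z ∂μ) * c ^ T := lintegral_mul_const _ (measurable_of_countable _)
      _ ≤ c ^ (T + 1) := by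
          rw [pow_succ']
          gcongr
          exact hψ _ h0

theorem measure_chain_sum_ge_le {F : S → Z → S} {X : S → Z → ℝ} {v : ℝ} {I : Set S}
    (hF : ∀ s ∈ I, ∀ z, F s z ∈ I)
    (hX : ∀ s ∈ I, ∀ l : ℝ, 0 ≤ l →
      ∫⁻ z, ENNReal.ofReal (Real.exp (l * X s z)) ∂μ ≤ ENNReal.ofReal (Real.exp (l ^ 2 * v / 2)))
    {s₀ : S} (h0 : s₀ ∈ I) (T : ℕ) {l : ℝ} (hl : 0 ≤ l) (ε : ℝ) :
    (Measure.pi fun _ : Fin T => μ)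
      {ks | ε ≤ ∑ i, X (chainState F s₀ ks i.castSucc) (ks i)} ≤
      ENNReal.ofReal (Real.exp (T * (l ^ 2 * v / 2) - l * ε)) := by
  have h1 := lintegral_prod_chain_le μ hF (fun s hs => hX s hs l hl) T s₀ h0
  have h2 := meas_ge_le_lintegral_div (μ := Measure.pi fun _ : Fin T => μ)
    (f := fun ks => ∏ i : Fin T,
      ENNReal.ofReal (Real.exp (l * X (chainState F s₀ ks i.castSucc) (ks i))))
    (measurable_of_countable _).aemeasurable
    (ε := ENNReal.ofReal (Real.exp (l * ε)))
    (by simp [Real.exp_pos]) ENNReal.ofReal_ne_top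
  calc _ ≤ (Measure.pi fun _ : Fin T => μ) {ks | ENNReal.ofReal (Real.exp (l * ε)) ≤
        ∏ i : Fin T, ENNReal.ofReal (Real.exp (l * X (chainState F s₀ ks i.castSucc) (ks i)))} := by
        refine measure_mono fun ks hks => ?_
        rw [Set.mem_ofPred_eq] at hks ⊢
        rw [← ENNReal.ofReal_prod_of_nonneg fun _ _ => (Real.exp_pos _).le, ← Real.exp_sum,
          ← Finset.mul_sum]
        exact ENNReal.ofReal_le_ofReal (Real.exp_le_exp.2 (mul_le_mul_of_nonneg_left hks hl))
    _ ≤ _ := h2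
    _ ≤ ENNReal.ofReal (Real.exp (l ^ 2 * v / 2)) ^ T / ENNReal.ofReal (Real.exp (l * ε)) := by
        gcongr
    _ = _ := by
        rw [← ENNReal.ofReal_pow (Real.exp_pos _).le, ← ENNReal.ofReal_div_of_pos (Real.exp_pos _),
          ← Real.exp_nat_mul, ← Real.exp_sub]

/-- A tail bound of Azuma–Hoeffding type: the increments `X(s_i, k_i)` are sub-Gaussian with
variance proxy `v` conditionally on the past. -/
theorem measure_chain_sum_gt_le {F : S → Z → S} {X : S → Z → ℝ} {v : ℝ} (hv : 0 ≤ v) {I : Set S}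
    (hF : ∀ s ∈ I, ∀ z, F s z ∈ I)
    (hX : ∀ s ∈ I, ∀ l : ℝ, 0 ≤ l →
      ∫⁻ z, ENNReal.ofReal (Real.exp (l * X s z)) ∂μ ≤ ENNReal.ofReal (Real.exp (l ^ 2 * v / 2)))
    {s₀ : S} (h0 : s₀ ∈ I) {T : ℕ} (hT : 1 ≤ T) {ℓ : ℝ} (hℓ : 0 ≤ ℓ) :
    (Measure.pi fun _ : Fin T => μ)
      {ks | √(2 * v * T * ℓ) < ∑ i, X (chainState F s₀ ks i.castSucc) (ks i)} ≤
      ENNReal.ofReal (Real.exp (-ℓ)) := by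
  have hbound := fun (l : ℝ) (hl : 0 ≤ l) (ε : ℝ) =>
    measure_chain_sum_ge_le μ hF hX h0 T hl ε
  have hT' : (0 : ℝ) < T := by exact_mod_cast hT
  rcases hv.eq_or_lt with rfl | hv
  · -- without variance, every positive level has arbitrarily small probability
    have hnull : ∀ n : ℕ, (Measure.pi fun _ : Fin T => μ)
        {ks | 1 / ((n : ℝ) + 1) ≤ ∑ i, X (chainState F s₀ ks i.castSucc) (ks i)} = 0 := by
      intro n
      have htend : Filter.Tendsto (fun l : ℝ => ENNReal.ofReal
          (Real.exp (T * (l ^ 2 * 0 / 2) - l * (1 / ((n : ℝ) + 1))))) Filter.atTop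
          (nhds (ENNReal.ofReal 0)) := by
        refine ENNReal.tendsto_ofReal (Real.tendsto_exp_atBot.comp ?_)
        have h1 : Filter.Tendsto (fun l : ℝ => l * (1 / ((n : ℝ) + 1))) Filter.atTop
            Filter.atTop := Filter.tendsto_id.atTop_mul_const (by positivity)
        refine (Filter.tendsto_neg_atTop_atBot.comp h1).congr fun l => ?_
        simp
      rw [ENNReal.ofReal_zero] at htend
      refine le_antisymm (ge_of_tendsto htend ?_) zero_le
      filter_upwards [Filter.eventually_ge_atTop 0] with l hl using hbound l hl _
    have hsub : {ks : Fin T → Z |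
        √(2 * 0 * T * ℓ) < ∑ i, X (chainState F s₀ ks i.castSucc) (ks i)} ⊆
        ⋃ n : ℕ, {ks | 1 / ((n : ℝ) + 1) ≤ ∑ i, X (chainState F s₀ ks i.castSucc) (ks i)} := by
      intro ks hks
      simp only [mul_zero, zero_mul, Real.sqrt_zero, Set.mem_ofPred_eq] at hks
      obtain ⟨n, hn⟩ := exists_nat_one_div_lt hks
      exact Set.mem_iUnion.2 ⟨n, hn.le⟩
    exact (measure_mono hsub).trans (by rw [measure_iUnion_null hnull]; exact zero_le)
  · set ε := √(2 * v * T * ℓ) with hε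
    set l := √(2 * ℓ / (v * T)) with hl
    have h1 : l * ε = 2 * ℓ := by
      rw [hl, hε, ← Real.sqrt_mul (by positivity)]
      rw [show 2 * ℓ / (v * T) * (2 * v * T * ℓ) = (2 * ℓ) ^ 2 by field_simp]
      exact Real.sqrt_sq (by positivity)
    have h2 : l ^ 2 = 2 * ℓ / (v * T) := Real.sq_sqrt (by positivity)
    have h3 := hbound l (Real.sqrt_nonneg _) ε
    rw [h1, h2, show (T : ℝ) * (2 * ℓ / (v * T) * v / 2) - 2 * ℓ = -ℓ by field_simp; ring] at h3
    refine (measure_mono ?_).trans h3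
    intro ks hks
    rw [Set.mem_ofPred_eq] at hks ⊢
    exact hks.le

theorem measure_iid_sum_gt_le {X : Z → ℝ} {v : ℝ} (hv : 0 ≤ v)
    (hX : ∀ l : ℝ, 0 ≤ l →
      ∫⁻ z, ENNReal.ofReal (Real.exp (l * X z)) ∂μ ≤ ENNReal.ofReal (Real.exp (l ^ 2 * v / 2)))
    {K : ℕ} (hK : 1 ≤ K) {ℓ : ℝ} (hℓ : 0 ≤ ℓ) :
    (Measure.pi fun _ : Fin K => μ) {ks | √(2 * v * K * ℓ) < ∑ i, X (ks i)} ≤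
      ENNReal.ofReal (Real.exp (-ℓ)) :=
  measure_chain_sum_gt_le μ (S := Unit) (F := fun _ _ => ()) (X := fun _ => X) hv (I := Set.univ)
    (fun _ _ _ => trivial) (fun _ _ => hX) (s₀ := ()) trivial hK hℓ

theorem integrable_of_abs_le {X : Z → ℝ} {b : ℝ} (hb : ∀ z, |X z| ≤ b) : Integrable X μ :=
  Integrable.of_bound (measurable_of_countable X).aestronglyMeasurable b
    (Filter.Eventually.of_forall hb)

/-- Hoeffding's lemma. -/
theorem lintegral_exp_le_of_abs_le {X : Z → ℝ} {b : ℝ} (hb : ∀ z, |X z| ≤ b) (l : ℝ) :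
    ∫⁻ z, ENNReal.ofReal (Real.exp (l * (X z - ∫ z, X z ∂μ))) ∂μ ≤
      ENNReal.ofReal (Real.exp (l ^ 2 * b ^ 2 / 2)) := by
  have h1 := hasSubgaussianMGF_of_mem_Icc (μ := μ) (a := -b) (b := b)
    (measurable_of_countable X).aemeasurable
    (Filter.Eventually.of_forall fun z => abs_le.1 (hb z))
  have h2 := h1.mgf_le l
  rw [← ofReal_integral_eq_lintegral_ofReal (h1.integrable_exp_mul l)
    (Filter.Eventually.of_forall fun _ => (Real.exp_pos _).le)]
  refine ENNReal.ofReal_le_ofReal (h2.trans (le_of_eq ?_))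
  have h3 : ((‖b - -b‖₊ / 2) ^ 2 : NNReal) = (b ^ 2 : ℝ) := by
    push_cast
    rw [sub_neg_eq_add, ← two_mul, norm_mul, Real.norm_two,
      mul_div_cancel_left₀ _ two_ne_zero, Real.norm_eq_abs, sq_abs]
  rw [h3]
  congr 1
  ring

theorem exp_neg_le_quadratic {x : ℝ} (hx : 0 ≤ x) : Real.exp (-x) ≤ 1 - x + x ^ 2 / 2 := by
  have h1 := Real.quadratic_le_exp_of_nonneg hx
  have h2 : 0 < 1 + x + x ^ 2 / 2 := by positivity
  rw [Real.exp_neg]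
  refine (inv_anti₀ h2 h1).trans ?_
  rw [inv_le_iff_one_le_mul₀ h2]
  nlinarith [sq_nonneg (x ^ 2)]

/-- The lower tail of a nonnegative variable is sub-Gaussian with its second moment as variance
proxy, whatever its range. -/
theorem lintegral_exp_le_of_nonneg {Y : Z → ℝ} {b v : ℝ} (hY : ∀ z, 0 ≤ Y z)
    (hb : ∀ z, |Y z| ≤ b) (hv : ∫ z, Y z ^ 2 ∂μ ≤ v) {l : ℝ} (hl : 0 ≤ l) :
    ∫⁻ z, ENNReal.ofReal (Real.exp (l * (∫ z, Y z ∂μ - Y z))) ∂μ ≤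
      ENNReal.ofReal (Real.exp (l ^ 2 * v / 2)) := by
  set m := ∫ z, Y z ∂μ with hm
  have hi : Integrable Y μ := integrable_of_abs_le μ hb
  have hi2 : Integrable (fun z => Y z ^ 2) μ :=
    integrable_of_abs_le μ (b := b ^ 2) fun z => by
      rw [abs_of_nonneg (sq_nonneg _), ← sq_abs (Y z)]
      exact pow_le_pow_left₀ (abs_nonneg _) (hb z) 2
  have hexp : ∀ z, Real.exp (l * (m - Y z)) ≤
      Real.exp (l * m) * (1 - l * Y z + l ^ 2 / 2 * Y z ^ 2) := by
    intro z
    rw [show l * (m - Y z) = l * m + -(l * Y z) by ring, Real.exp_add]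
    gcongr
    refine (exp_neg_le_quadratic (mul_nonneg hl (hY z))).trans (le_of_eq (by ring))
  have hi3 : Integrable (fun z => 1 - l * Y z) μ := (integrable_const 1).sub (hi.const_mul l)
  have hi4 : Integrable (fun z => Real.exp (l * m) * (1 - l * Y z + l ^ 2 / 2 * Y z ^ 2)) μ :=
    (hi3.add (hi2.const_mul _)).const_mul _
  calc _ ≤ ∫⁻ z, ENNReal.ofReal (Real.exp (l * m) * (1 - l * Y z + l ^ 2 / 2 * Y z ^ 2)) ∂μ :=
        lintegral_mono fun z => ENNReal.ofReal_le_ofReal (hexp z)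
    _ = ENNReal.ofReal (∫ z, Real.exp (l * m) * (1 - l * Y z + l ^ 2 / 2 * Y z ^ 2) ∂μ) :=
        (ofReal_integral_eq_lintegral_ofReal hi4 (Filter.Eventually.of_forall fun z =>
          (Real.exp_pos _).le.trans (hexp z))).symm
    _ ≤ _ := by
        refine ENNReal.ofReal_le_ofReal ?_
        rw [integral_const_mul, integral_add hi3 (hi2.const_mul _),
          integral_sub (integrable_const 1) (hi.const_mul l), integral_const_mul,
          integral_const_mul, ← hm]
        simp only [integral_const, probReal_univ, one_smul]
        have h1 : 1 - l * m + l ^ 2 / 2 * ∫ z, Y z ^ 2 ∂μ ≤ 1 - l * m + l ^ 2 / 2 * v := by gcongr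
        have h2 := Real.add_one_le_exp (-(l * m) + l ^ 2 * v / 2)
        calc Real.exp (l * m) * (1 - l * m + l ^ 2 / 2 * ∫ z, Y z ^ 2 ∂μ)
            ≤ Real.exp (l * m) * Real.exp (-(l * m) + l ^ 2 * v / 2) := by
              gcongr
              linarith
          _ = _ := by rw [← Real.exp_add]; congr 1; ring

end Chain

/-! ### The joint law of the sampled frequencies -/

variable {d t : ℕ}

theorem IsIIDSample.exists_law {ι Ω : Type*} [Fintype ι] [Nonempty ι] [MeasurableSpace Ω]
    {P : Measure Ω} [IsProbabilityMeasure P] {κ : ι → Ω → (Fin d → ℤ)} (h : IsIIDSample t P κ) :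
    ∃ μ : Measure (Fin d → ℤ), IsProbabilityMeasure μ ∧ (∀ k, μ.real {k} = prob d t k) ∧
      ∀ E : Set (ι → Fin d → ℤ),
        P.real {ω | (fun i => κ i ω) ∈ E} = (Measure.pi fun _ : ι => μ).real E := by
  obtain ⟨hm, hind, hlaw⟩ := h
  have hmap : ∀ i k, (P.map (κ i)).real {k} = prob d t k := fun i k => by
    rw [map_measureReal_apply (hm i) (measurableSet_singleton k), hlaw]
  obtain ⟨i₀⟩ := ‹Nonempty ι›
  have hp : ∀ i, IsProbabilityMeasure (P.map (κ i)) := fun i =>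
    Measure.isProbabilityMeasure_map (hm i).aemeasurable
  have heq : ∀ i, P.map (κ i) = P.map (κ i₀) := fun i => by
    refine Measure.ext_of_singleton fun k => ?_
    have h1 := (hmap i k).trans (hmap i₀ k).symm
    rwa [measureReal_def, measureReal_def,
      ENNReal.toReal_eq_toReal_iff' (measure_ne_top _ _) (measure_ne_top _ _)] at h1
  refine ⟨P.map (κ i₀), hp i₀, hmap i₀, fun E => ?_⟩
  have h1 := (iIndepFun_iff_map_fun_eq_pi_map fun i => (hm i).aemeasurable).1 hind
  simp only [heq] at h1
  rw [← h1, map_measureReal_apply (measurable_pi_lambda _ hm) (Set.to_countable E).measurableSet]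
  rfl

end

/-! ### Weights, sampling probabilities and moments of the stochastic objective -/

section

variable {d t : ℕ}

theorem abs_partialDeriv_le_CNorm {s : ℕ} {f : (Fin d → ℝ) → ℝ} (hf : ContDiff ℝ s f)
    (j : Fin d) {q : ℕ} (hq : q ≤ s) {x : Fin d → ℝ} (hx : x ∈ cube d) :
    |partialDeriv f j q x| ≤ CNorm s f := by
  have hb : ∀ (j : Fin d) (q : Fin (s + 1)),
      BddAbove (Set.range fun x : cube d => |partialDeriv f j q x|) := by
    intro j q
    have hc : Continuous fun x => |partialDeriv f j q x| :=
      (continuous_partialDeriv j q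
        (hf.of_le (by exact_mod_cast Nat.lt_succ_iff.1 q.2))).abs
    have := (isCompact_cube.image hc).bddAbove
    rwa [Set.image_eq_range] at this
  have h1 := le_ciSup (hb j ⟨q, Nat.lt_succ_iff.2 hq⟩) ⟨x, hx⟩
  have h2 := le_ciSup (Set.finite_range
    fun q : Fin (s + 1) => ⨆ x : cube d, |partialDeriv f j q x|).bddAbove ⟨q, Nat.lt_succ_iff.2 hq⟩
  have h3 := le_ciSup (Set.finite_range
    fun j : Fin d => ⨆ q : Fin (s + 1), ⨆ x : cube d, |partialDeriv f j q x|).bddAbove j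
  exact h1.trans (h2.trans h3)

theorem zero_mem_cube : (0 : Fin d → ℝ) ∈ cube d := ⟨le_rfl, zero_le_one⟩

theorem CNorm_nonneg (hd : 1 ≤ d) {s : ℕ} {f : (Fin d → ℝ) → ℝ} (hf : ContDiff ℝ s f) :
    0 ≤ CNorm s f :=
  (abs_nonneg _).trans (abs_partialDeriv_le_CNorm hf ⟨0, hd⟩ (Nat.zero_le s) zero_mem_cube)

/-- The weight `1 + ∑_j |2π k_j|^{d+1}`, whose inverse is the smooth part of the sampling weight. -/
noncomputable def sobolevWeight (k : Fin d → ℤ) : ℝ :=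
  1 + ∑ j, |2 * Real.pi * (k j : ℝ)| ^ (d + 1)

theorem one_le_sobolevWeight (k : Fin d → ℤ) : 1 ≤ sobolevWeight k :=
  le_add_of_nonneg_right (Finset.sum_nonneg fun _ _ => by positivity)

theorem sobolevWeight_pos (k : Fin d → ℤ) : 0 < sobolevWeight k :=
  zero_lt_one.trans_le (one_le_sobolevWeight k)

theorem weight_eq (k : Fin d → ℤ) :
    weight d t k = frobNorm (featCoeff d t k) + (sobolevWeight k)⁻¹ := rfl

theorem weight_pos (k : Fin d → ℤ) : 0 < weight d t k :=
  add_pos_of_nonneg_of_pos (frobNorm_nonneg _) (inv_pos.2 (sobolevWeight_pos k))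

theorem frobNorm_featCoeff_le_weight (k : Fin d → ℤ) :
    frobNorm (featCoeff d t k) ≤ weight d t k :=
  le_add_of_nonneg_right (inv_pos.2 (sobolevWeight_pos k)).le

theorem inv_sobolevWeight_le_weight (k : Fin d → ℤ) : (sobolevWeight k)⁻¹ ≤ weight d t k :=
  le_add_of_nonneg_left (frobNorm_nonneg _)

theorem summable_inv_sobolevWeight (hd : 1 ≤ d) :
    Summable fun k : Fin d → ℤ => (sobolevWeight k)⁻¹ := by
  have h := ENNReal.summable_toReal
    (ne_top_of_le_ne_top ENNReal.ofReal_ne_top (tsum_inv_one_add_sum_pow_le hd))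
  refine h.congr fun k => ENNReal.toReal_ofReal (inv_pos.2 (sobolevWeight_pos k)).le

theorem tsum_inv_sobolevWeight_le (hd : 1 ≤ d) :
    ∑' k : Fin d → ℤ, (sobolevWeight k)⁻¹ ≤ 3 / 2 := by
  have h : ∑' k : Fin d → ℤ, ENNReal.ofReal ((sobolevWeight k)⁻¹) ≤ ENNReal.ofReal (3 / 2) :=
    tsum_inv_one_add_sum_pow_le hd
  rw [← ENNReal.ofReal_tsum_of_nonneg (fun k => (inv_pos.2 (sobolevWeight_pos k)).le)
    (summable_inv_sobolevWeight hd)] at h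
  exact (ENNReal.ofReal_le_ofReal_iff (by norm_num)).1 h

theorem summable_weight (hd : 1 ≤ d) : Summable (weight d t) :=
  summable_frobNorm_featCoeff.add (summable_inv_sobolevWeight hd)

theorem tsum_weight_eq (hd : 1 ≤ d) : ∑' k, weight d t k =
    ∑' k : Fin d → ℤ, frobNorm (featCoeff d t k) + ∑' k : Fin d → ℤ, (sobolevWeight k)⁻¹ :=
  summable_frobNorm_featCoeff.tsum_add (summable_inv_sobolevWeight hd)

theorem tsum_weight_pos (hd : 1 ≤ d) : 0 < ∑' k, weight d t k :=
  (summable_weight hd).tsum_pos (fun k => (weight_pos k).le) 0 (weight_pos 0)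

theorem prob_pos (hd : 1 ≤ d) (k : Fin d → ℤ) : 0 < prob d t k :=
  div_pos (weight_pos k) (tsum_weight_pos hd)

theorem hasSum_prob (hd : 1 ≤ d) : HasSum (prob d t) 1 := by
  have h := (summable_weight (t := t) hd).hasSum.div_const (∑' k, weight d t k)
  rwa [div_self (tsum_weight_pos hd).ne'] at h

theorem prob_mul_stochObj (hd : 1 ≤ d) (f : (Fin d → ℝ) → ℝ) (A : BandMatrix d t)
    (k : Fin d → ℤ) : prob d t k * stochObj f k A = objTerm f A k := by
  rw [stochObj_eq, mul_div_cancel₀ _ (prob_pos hd k).ne']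

section Fourier

variable {f : (Fin d → ℝ) → ℝ}

/-- The Fourier coefficients of `∂_j^{d+1} f` are bounded by its supremum. -/
theorem sobolevWeight_mul_norm_fcoeff_le (hd : 1 ≤ d) (hf : ContDiff ℝ (d + 1 : ℕ) f)
    (hp : LatticePeriodic f) (k : Fin d → ℤ) :
    sobolevWeight k * ‖fcoeff (fun x => (f x : ℂ)) k‖ ≤ ((d : ℝ) + 1) * CNorm (d + 1) f := by
  have h1 : ∀ (j : Fin d) (q : ℕ), q ≤ d + 1 →
      |2 * Real.pi * (k j : ℝ)| ^ q * ‖fcoeff (fun x => (f x : ℂ)) k‖ ≤ CNorm (d + 1) f := by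
    intro j q hq
    have hfq : ContDiff ℝ q f := hf.of_le (by exact_mod_cast hq)
    have h2 := fcoeff_partialDeriv hp j q hfq k
    have h3 : ‖fcoeff (fun x => (partialDeriv f j q x : ℂ)) k‖ ≤ CNorm (d + 1) f :=
      norm_fcoeff_le (fun x hx => by
        rw [Complex.norm_real, Real.norm_eq_abs]; exact abs_partialDeriv_le_CNorm hf j hq hx) k
    have h4 : ‖2 * (Real.pi : ℂ) * Complex.I * (k j : ℂ)‖ = |2 * Real.pi * (k j : ℝ)| := by
      rw [show 2 * (Real.pi : ℂ) * Complex.I * (k j : ℂ) =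
        ((2 * Real.pi * (k j : ℝ) : ℝ) : ℂ) * Complex.I by push_cast; ring, norm_mul,
        Complex.norm_I, mul_one, Complex.norm_real, Real.norm_eq_abs]
    rwa [h2, norm_mul, norm_pow, h4] at h3
  have h0 := h1 ⟨0, hd⟩ 0 (Nat.zero_le _)
  rw [pow_zero, one_mul] at h0
  have h2 := Finset.sum_le_sum fun (j : Fin d) (_ : j ∈ Finset.univ) => h1 j (d + 1) le_rfl
  rw [← Finset.sum_mul, Finset.sum_const, Finset.card_univ, Fintype.card_fin, nsmul_eq_mul] at h2
  rw [sobolevWeight]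
  linarith

/-- By Parseval's identity, and the arithmetic-geometric inequality
`|2π k_j|^{d+1} ≤ (1 + |2π k_j|^{2(d+1)}) / 2`. -/
theorem tsum_sobolevWeight_mul_sq_le (hd : 1 ≤ d) (hf : ContDiff ℝ (d + 1 : ℕ) f)
    (hp : LatticePeriodic f) :
    (Summable fun k => sobolevWeight k * ‖fcoeff (fun x => (f x : ℂ)) k‖ ^ 2) ∧
      ∑' k, sobolevWeight k * ‖fcoeff (fun x => (f x : ℂ)) k‖ ^ 2 ≤
        (√((d : ℝ) + 1) * CNorm (d + 1) f) ^ 2 := by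
  set a : (Fin d → ℤ) → ℝ := fun k => ‖fcoeff (fun x => (f x : ℂ)) k‖ with ha
  have hint : ∀ (j : Fin d) (q : ℕ), q ≤ d + 1 →
      ∫ x in cube d, (partialDeriv f j q x) ^ 2 ≤ CNorm (d + 1) f ^ 2 := fun j q hq =>
    integral_sq_le_of_abs_le (continuous_partialDeriv j q (hf.of_le (by exact_mod_cast hq)))
      fun x hx => abs_partialDeriv_le_CNorm hf j hq hx
  have hP := fun (j : Fin d) (q : ℕ) (hq : q ≤ d + 1) =>
    hasSum_sq_fcoeff_partialDeriv hp j q (hf.of_le (by exact_mod_cast hq))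
  have h0 := hP ⟨0, hd⟩ 0 (Nat.zero_le _)
  simp only [pow_zero, one_mul] at h0
  have h0i := hint ⟨0, hd⟩ 0 (Nat.zero_le _)
  have hS := hasSum_sum fun (j : Fin d) (_ : j ∈ Finset.univ) =>
    ((h0.add (hP j (d + 1) le_rfl)).div_const 2)
  have hT := h0.add hS
  have hle : ∀ k, sobolevWeight k * a k ^ 2 ≤ a k ^ 2 + ∑ j,
      (a k ^ 2 + (|2 * Real.pi * (k j : ℝ)| ^ (d + 1) * a k) ^ 2) / 2 := by
    intro k
    rw [sobolevWeight, add_mul, one_mul, Finset.sum_mul]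
    gcongr with j _
    nlinarith [sq_nonneg (a k - |2 * Real.pi * (k j : ℝ)| ^ (d + 1) * a k)]
  have hsummable : Summable fun k => sobolevWeight k * a k ^ 2 :=
    Summable.of_nonneg_of_le
      (fun k => mul_nonneg (sobolevWeight_pos k).le (sq_nonneg _)) hle hT.summable
  refine ⟨hsummable, (hasSum_le hle hsummable.hasSum hT).trans ?_⟩
  have h1 : ∀ j ∈ (Finset.univ : Finset (Fin d)),
      ((∫ x in cube d, (partialDeriv f ⟨0, hd⟩ 0 x) ^ 2) +
      ∫ x in cube d, (partialDeriv f j (d + 1) x) ^ 2) / 2 ≤ CNorm (d + 1) f ^ 2 := fun j _ => by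
    linarith [hint j (d + 1) le_rfl]
  have h2 := Finset.sum_le_sum h1
  rw [Finset.sum_const, Finset.card_univ, Fintype.card_fin, nsmul_eq_mul] at h2
  rw [mul_pow, Real.sq_sqrt (by positivity)]
  linarith

theorem abs_stochObj_le (hd : 1 ≤ d) (hf : ContDiff ℝ (d + 1 : ℕ) f)
    (hp : LatticePeriodic f) (A : BandMatrix d t) (k : Fin d → ℤ) :
    |stochObj f k A| ≤
      (((d : ℝ) + 1) * CNorm (d + 1) f + frobNorm A) * ∑' k, weight d t k := by
  have hC := CNorm_nonneg hd hf
  have hw := weight_pos (t := t) k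
  have hS := tsum_weight_pos (t := t) hd
  rw [stochObj_eq, abs_div, abs_of_pos (prob_pos hd k), div_le_iff₀ (prob_pos hd k), prob,
    mul_assoc, mul_div_cancel₀ _ hS.ne']
  refine (abs_objTerm_le f A k).trans ((norm_sub_le _ _).trans ?_)
  rw [add_mul]
  refine add_le_add ?_ ?_
  · have h1 := sobolevWeight_mul_norm_fcoeff_le hd hf hp k
    have h2 : ‖fcoeff (fun x => (f x : ℂ)) k‖ ≤
        ((d : ℝ) + 1) * CNorm (d + 1) f * (sobolevWeight k)⁻¹ := by
      rw [← div_eq_mul_inv, le_div_iff₀ (sobolevWeight_pos k), mul_comm]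
      exact h1
    refine h2.trans ?_
    gcongr
    exact inv_sobolevWeight_le_weight k
  · refine (norm_frobInner_le _ _).trans ?_
    gcongr
    · exact frobNorm_nonneg _
    · exact frobNorm_featCoeff_le_weight k

theorem featCoeff_zero : featCoeff d t 0 = 1 := by
  ext i j
  rw [featCoeff_apply, Matrix.one_apply]
  rw [zero_add]
  refine if_congr ?_ rfl rfl
  rw [sub_eq_zero, Subtype.ext_iff]

/-- Only the frequency `0` contributes positive values of the stochastic objective, and there the
trace of `A` can be dropped. -/
theorem stochObj_le (hd : 1 ≤ d) (hf : ContDiff ℝ (d + 1 : ℕ) f)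
    {A : BandMatrix d t} (hA : A.PosSemidef) (k : Fin d → ℤ) :
    stochObj f k A ≤ CNorm (d + 1) f * (∑' k, weight d t k) / 2 := by
  have hC := CNorm_nonneg hd hf
  have hS := tsum_weight_pos (t := t) hd
  rw [stochObj_eq, div_le_iff₀ (prob_pos hd k), objTerm]
  split_ifs with h
  · subst h
    have h1 : (residual f A 0).re ≤ CNorm (d + 1) f := by
      have h2 : 0 ≤ (frobInner A (featCoeff d t 0)).re := by
        rw [featCoeff_zero, frobInner, mul_one, hA.isHermitian.eq]
        exact (Complex.le_def.1 hA.trace_nonneg).1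
      have h3 : ‖fcoeff (fun x => (f x : ℂ)) 0‖ ≤ CNorm (d + 1) f :=
        norm_fcoeff_le (fun x hx => by
          have := abs_partialDeriv_le_CNorm hf ⟨0, hd⟩ (Nat.zero_le (d + 1)) hx
          rw [partialDeriv_zero] at this
          rw [Complex.norm_real, Real.norm_eq_abs]; exact this) 0
      have h4 := (Complex.abs_re_le_norm (fcoeff (fun x => (f x : ℂ)) 0)).trans h3
      rw [residual, Complex.sub_re]
      linarith [(abs_le.1 h4).2]
    have h5 : (2 : ℝ) ≤ weight d t 0 := by
      have h6 : sobolevWeight (0 : Fin d → ℤ) = 1 := by simp [sobolevWeight]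
      rw [weight_eq, h6]
      linarith [one_le_frobNorm_featCoeff (zero_mem_band (d := d) (t := t))]
    rw [prob]
    calc (residual f A 0).re ≤ CNorm (d + 1) f * (weight d t 0 / 2) :=
          h1.trans (le_mul_of_one_le_right hC (by linarith))
      _ = _ := by field_simp
  · refine (neg_nonpos.2 (norm_nonneg _)).trans ?_
    have := prob_pos (t := t) hd k
    positivity

/-- Minkowski's inequality in `ℓ²`. -/
theorem minkowski_sq {Z : Type*} {p q : Z → ℝ} (hp : ∀ z, 0 ≤ p z) (hq : ∀ z, 0 ≤ q z) {α β : ℝ}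
    (hα : 0 ≤ α) (hβ : 0 ≤ β) (hps : Summable fun z => p z ^ 2) (hpα : ∑' z, p z ^ 2 ≤ α ^ 2)
    (hqs : Summable fun z => q z ^ 2) (hqβ : ∑' z, q z ^ 2 ≤ β ^ 2) :
    (Summable fun z => (p z + q z) ^ 2) ∧ ∑' z, (p z + q z) ^ 2 ≤ (α + β) ^ 2 := by
  have h := Real.Lp_add_le_tsum_of_nonneg (p := 2) (by norm_num) hp hq
    (by simpa only [Real.rpow_two] using hps) (by simpa only [Real.rpow_two] using hqs)
  simp only [Real.rpow_two, ← Real.sqrt_eq_rpow] at h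
  refine ⟨h.1, ?_⟩
  have h1 : √(∑' z, p z ^ 2) ≤ α := Real.sqrt_le_iff.2 ⟨hα, hpα⟩
  have h2 : √(∑' z, q z ^ 2) ≤ β := Real.sqrt_le_iff.2 ⟨hβ, hqβ⟩
  exact (Real.sqrt_le_left (by positivity)).1 (h.2.trans (add_le_add h1 h2))

/-- The second moment of `u - L_k(A)`, split by Minkowski's inequality into the contributions of
`u`, of `f` and of `A`. -/
theorem tsum_prob_mul_sq_sub_stochObj_le (hd : 1 ≤ d) (hf : ContDiff ℝ (d + 1 : ℕ) f)
    (hp : LatticePeriodic f) (A : BandMatrix d t) {u : ℝ} (hu : 0 ≤ u) :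
    (Summable fun k => prob d t k * (u - stochObj f k A) ^ 2) ∧
    ∑' k, prob d t k * (u - stochObj f k A) ^ 2 ≤
      (u + √(∑' k, weight d t k) * (√((d : ℝ) + 1) * CNorm (d + 1) f) +
        √(∑' k, weight d t k) *
          (frobNorm A * √(∑' k : Fin d → ℤ, frobNorm (featCoeff d t k)))) ^ 2 := by
  set S := ∑' k, weight d t k with hS
  have hS0 : 0 < S := tsum_weight_pos hd
  have hC := CNorm_nonneg hd hf
  have hπ : ∀ k, 0 < prob d t k := prob_pos hd
  have hprob : ∀ k, prob d t k = weight d t k / S := fun k => rfl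
  set a : (Fin d → ℤ) → ℝ := fun k => ‖fcoeff (fun x => (f x : ℂ)) k‖ with ha
  -- the three square summable families
  have hp1 : HasSum (fun k => (u * √(prob d t k)) ^ 2) (u ^ 2) := by
    have := (hasSum_prob (t := t) hd).mul_left (u ^ 2)
    rw [mul_one] at this
    exact this.congr_fun fun k => by rw [mul_pow, Real.sq_sqrt (hπ k).le]
  obtain ⟨hs, hsle⟩ := tsum_sobolevWeight_mul_sq_le hd hf hp
  have hx : ∀ k, (a k / √(prob d t k)) ^ 2 ≤ S * (sobolevWeight k * a k ^ 2) := by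
    intro k
    rw [div_pow, Real.sq_sqrt (hπ k).le, hprob, div_div_eq_mul_div, div_le_iff₀ (weight_pos k)]
    have h1 := inv_sobolevWeight_le_weight (t := t) k
    have h2 : 1 ≤ sobolevWeight k * weight d t k := by
      rwa [inv_le_iff_one_le_mul₀' (sobolevWeight_pos k)] at h1
    calc a k ^ 2 * S = S * a k ^ 2 * 1 := by ring
      _ ≤ S * a k ^ 2 * (sobolevWeight k * weight d t k) := by gcongr
      _ = _ := by ring
  have hxs : Summable fun k => (a k / √(prob d t k)) ^ 2 :=
    Summable.of_nonneg_of_le (fun _ => sq_nonneg _) hx (hs.mul_left S)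
  have hxle : ∑' k, (a k / √(prob d t k)) ^ 2 ≤
      (√S * (√((d : ℝ) + 1) * CNorm (d + 1) f)) ^ 2 := by
    refine (hxs.tsum_le_tsum hx (hs.mul_left S)).trans ?_
    rw [tsum_mul_left, mul_pow √S, Real.sq_sqrt hS0.le]
    gcongr
  have hM := (summable_frobNorm_featCoeff (d := d) (t := t)).mul_left (S * frobNorm A ^ 2)
  have hy : ∀ k, (frobNorm A * frobNorm (featCoeff d t k) / √(prob d t k)) ^ 2 ≤
      S * frobNorm A ^ 2 * frobNorm (featCoeff d t k) := by
    intro k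
    rw [div_pow, Real.sq_sqrt (hπ k).le, hprob, div_div_eq_mul_div, div_le_iff₀ (weight_pos k)]
    have h1 := frobNorm_featCoeff_le_weight (t := t) k
    have h0 := frobNorm_nonneg (featCoeff d t k)
    calc (frobNorm A * frobNorm (featCoeff d t k)) ^ 2 * S =
          S * frobNorm A ^ 2 * frobNorm (featCoeff d t k) * frobNorm (featCoeff d t k) := by ring
      _ ≤ _ := by gcongr
  have hys : Summable fun k => (frobNorm A * frobNorm (featCoeff d t k) / √(prob d t k)) ^ 2 :=
    Summable.of_nonneg_of_le (fun _ => sq_nonneg _) hy hM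
  have hM0 : 0 ≤ ∑' k : Fin d → ℤ, frobNorm (featCoeff d t k) :=
    tsum_nonneg fun _ => frobNorm_nonneg _
  have hyle : ∑' k, (frobNorm A * frobNorm (featCoeff d t k) / √(prob d t k)) ^ 2 ≤
      (√S * (frobNorm A * √(∑' k : Fin d → ℤ, frobNorm (featCoeff d t k)))) ^ 2 := by
    refine (hys.tsum_le_tsum hy hM).trans (le_of_eq ?_)
    rw [tsum_mul_left, mul_pow, mul_pow, Real.sq_sqrt hS0.le, Real.sq_sqrt hM0]
    ring
  have hA0 := frobNorm_nonneg A
  have ha0 : ∀ k, 0 ≤ a k := fun k => norm_nonneg _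
  obtain ⟨m1, m2⟩ := minkowski_sq (fun k => by positivity)
    (fun k => div_nonneg (ha0 k) (Real.sqrt_nonneg _)) hu (by positivity) hp1.summable
    hp1.tsum_eq.le hxs hxle
  obtain ⟨m3, m4⟩ := minkowski_sq
    (fun k => add_nonneg (by positivity) (div_nonneg (ha0 k) (Real.sqrt_nonneg _)))
    (fun k => div_nonneg (mul_nonneg hA0 (frobNorm_nonneg _)) (Real.sqrt_nonneg _))
    (by positivity) (by positivity) m1 m2 hys hyle
  have hle : ∀ k, prob d t k * (u - stochObj f k A) ^ 2 ≤ (u * √(prob d t k) +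
      a k / √(prob d t k) + frobNorm A * frobNorm (featCoeff d t k) / √(prob d t k)) ^ 2 := by
    intro k
    have hr : 0 < √(prob d t k) := Real.sqrt_pos.2 (hπ k)
    have h1 : |stochObj f k A| * √(prob d t k) ≤
        a k / √(prob d t k) + frobNorm A * frobNorm (featCoeff d t k) / √(prob d t k) := by
      rw [← add_div, le_div_iff₀ hr, mul_assoc, Real.mul_self_sqrt (hπ k).le, mul_comm,
        ← abs_of_pos (hπ k), ← abs_mul, prob_mul_stochObj hd]
      refine (abs_objTerm_le f A k).trans ((norm_sub_le _ _).trans ?_)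
      gcongr
      exact norm_frobInner_le _ _
    have h2 : |u - stochObj f k A| ≤ u + |stochObj f k A| := by
      refine (abs_sub _ _).trans ?_
      rw [abs_of_nonneg hu]
    calc prob d t k * (u - stochObj f k A) ^ 2
        = (|u - stochObj f k A| * √(prob d t k)) ^ 2 := by
          rw [mul_pow, sq_abs, Real.sq_sqrt (hπ k).le, mul_comm]
      _ ≤ ((u + |stochObj f k A|) * √(prob d t k)) ^ 2 := by gcongr
      _ ≤ _ := by
          rw [add_mul, add_assoc (u * _)]
          gcongr
  have hsum : Summable fun k => prob d t k * (u - stochObj f k A) ^ 2 :=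
    Summable.of_nonneg_of_le (fun k => mul_nonneg (hπ k).le (sq_nonneg _)) hle m3
  exact ⟨hsum, (hsum.tsum_le_tsum hle m3).trans m4⟩

end Fourier

end

/-! ### Deviation of the sampled bound from the expected objective -/

section

variable {d t : ℕ} {f : (Fin d → ℝ) → ℝ}

theorem integral_eq_tsum_prob {μ : Measure (Fin d → ℤ)} (hμ : ∀ k, μ.real {k} = prob d t k)
    {g : (Fin d → ℤ) → ℝ} (hg : Integrable g μ) : ∫ k, g k ∂μ = ∑' k, prob d t k * g k := by
  rw [integral_countable hg]
  simp only [hμ, smul_eq_mul]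

theorem integrable_stochObj (hd : 1 ≤ d) (hf : ContDiff ℝ (d + 1 : ℕ) f) (hp : LatticePeriodic f)
    (μ : Measure (Fin d → ℤ)) [IsProbabilityMeasure μ] (A : BandMatrix d t) :
    Integrable (fun k => stochObj f k A) μ :=
  integrable_of_abs_le μ (abs_stochObj_le hd hf hp A)

theorem integral_stochObj (hd : 1 ≤ d) (hf : ContDiff ℝ (d + 1 : ℕ) f) (hp : LatticePeriodic f)
    {μ : Measure (Fin d → ℤ)} [IsProbabilityMeasure μ] (hμ : ∀ k, μ.real {k} = prob d t k)
    (A : BandMatrix d t) : ∫ k, stochObj f k A ∂μ = expectedObj f A := by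
  rw [integral_eq_tsum_prob hμ (integrable_stochObj hd hf hp μ A)]
  simp only [prob_mul_stochObj hd, expectedObj]

theorem tsum_weight_le (hd : 1 ≤ d) : ∑' k, weight d t k ≤
    ∑' k : Fin d → ℤ, frobNorm (featCoeff d t k) + 3 / 2 := by
  rw [tsum_weight_eq hd]
  gcongr
  exact tsum_inv_sobolevWeight_le hd

theorem seven_fifths_le_sqrt (hd : 1 ≤ d) : 7 / 5 ≤ √((d : ℝ) + 1) := by
  have : (1 : ℝ) ≤ d := by exact_mod_cast hd
  exact Real.le_sqrt_of_sq_le (by linarith)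

theorem three_le_tsum_frobNorm_featCoeff (hd : 1 ≤ d) (ht : 1 ≤ t) :
    3 ≤ ∑' k : Fin d → ℤ, frobNorm (featCoeff d t k) :=
  le_trans (by exact_mod_cast three_le_card_band hd ht) card_band_le_tsum

theorem sum_sqrt_mul_le {C D a m S : ℝ} (hC : 0 ≤ C) (ha : 0 ≤ a) (hD : 7 / 5 ≤ D) (hm : 3 ≤ m)
    (hS : 0 ≤ S) (hSm : S ≤ m + 3 / 2) :
    C * S / 2 + √S * (D * C) + √S * (a * √m) ≤ (D * C + a) * (1 + m) := by
  have h1 : √S * √m ≤ 1 + m := by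
    nlinarith [sq_nonneg (√S - √m), Real.sq_sqrt hS, Real.sq_sqrt (by linarith : 0 ≤ m)]
  have h2 : √S ≤ S / 4 + 1 := by nlinarith [sq_nonneg (√S - 2), Real.sq_sqrt hS]
  have h3 : S / 2 ≤ D * (5 / 14 * S) := by nlinarith
  have h4 : S / 2 + √S * D ≤ D * (1 + m) := by nlinarith
  calc _ = C * (S / 2 + √S * D) + a * (√S * √m) := by ring
    _ ≤ C * (D * (1 + m)) + a * (1 + m) := by gcongr
    _ = _ := by ring

theorem log_two_div_pos {δ : ℝ} (h0 : 0 < δ) (h1 : δ < 1) : 0 < Real.log (2 / δ) :=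
  Real.log_pos (by rw [lt_div_iff₀ h0]; linarith)

theorem exp_neg_log_two_div {δ : ℝ} (h0 : 0 < δ) : Real.exp (-Real.log (2 / δ)) = δ / 2 := by
  rw [Real.exp_neg, Real.exp_log (by positivity), inv_div]

theorem sqrt_sq_mul_mul {b K ℓ : ℝ} (hb : 0 ≤ b) (hK : 0 < K) :
    √(2 * b ^ 2 * K * ℓ) = K * (b * √(2 * ℓ / K)) := by
  rw [show 2 * b ^ 2 * K * ℓ = (K * b) ^ 2 * (2 * ℓ / K) by field_simp,
    Real.sqrt_mul (sq_nonneg _), Real.sqrt_sq (by positivity), mul_assoc]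

/-- The sampled bound rarely exceeds the expected objective. The stochastic objective is bounded
above by `u = ‖f‖ ∑ w / 2`, hence the upper tail of the sample mean is governed by the second moment
of `u - L_k(A)`. -/
theorem measure_expectedObj_lt_lowerSample (hd : 1 ≤ d) (ht : 1 ≤ t)
    (hf : ContDiff ℝ (d + 1 : ℕ) f) (hp : LatticePeriodic f)
    {μ : Measure (Fin d → ℤ)} [IsProbabilityMeasure μ] (hμ : ∀ k, μ.real {k} = prob d t k)
    {A : BandMatrix d t} (hA : A.PosSemidef) {K : ℕ} (hK : 1 ≤ K) {δ : ℝ} (h0 : 0 < δ)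
    (h1 : δ < 1) :
    (Measure.pi fun _ : Fin K => μ) {ks | expectedObj f A < lowerSample f δ ks A} ≤
      ENNReal.ofReal (δ / 2) := by
  have hC := CNorm_nonneg hd hf
  have hS := tsum_weight_pos (t := t) hd
  have hA0 := frobNorm_nonneg A
  have hK' : (0 : ℝ) < K := by exact_mod_cast hK
  have hM3 := three_le_tsum_frobNorm_featCoeff hd ht
  set u := CNorm (d + 1) f * (∑' k, weight d t k) / 2 with hu
  set b := (√((d : ℝ) + 1) * CNorm (d + 1) f + frobNorm A) *
    (1 + ∑' k : Fin d → ℤ, frobNorm (featCoeff d t k)) with hb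
  have hb0 : 0 ≤ b := by positivity
  have hi := integrable_stochObj hd hf hp μ A
  have hYb : ∀ k, |u - stochObj f k A| ≤ u +
      (((d : ℝ) + 1) * CNorm (d + 1) f + frobNorm A) * ∑' k, weight d t k := fun k => by
    refine (abs_sub _ _).trans ?_
    rw [abs_of_nonneg (by positivity)]
    gcongr
    exact abs_stochObj_le hd hf hp A k
  obtain ⟨-, hm2⟩ := tsum_prob_mul_sq_sub_stochObj_le hd hf hp A (u := u) (by positivity)
  have hsq : ∫ k, (u - stochObj f k A) ^ 2 ∂μ ≤ b ^ 2 := by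
    rw [integral_eq_tsum_prob hμ (integrable_of_abs_le μ fun k => by
      rw [abs_pow]; exact pow_le_pow_left₀ (abs_nonneg _) (hYb k) 2)]
    refine hm2.trans (pow_le_pow_left₀ (by positivity) ?_ 2)
    exact sum_sqrt_mul_le hC hA0 (seven_fifths_le_sqrt hd) hM3 hS.le (tsum_weight_le hd)
  have hmean : ∫ k, (u - stochObj f k A) ∂μ = u - expectedObj f A := by
    rw [integral_sub (integrable_const _) hi, integral_stochObj hd hf hp hμ]
    simp
  have htail := measure_iid_sum_gt_le μ (X := fun k => stochObj f k A - expectedObj f A)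
    (sq_nonneg b) (fun l hl => by
      have := lintegral_exp_le_of_nonneg μ (fun k => sub_nonneg.2 (stochObj_le hd hf hA k)) hYb
        hsq hl
      rw [hmean] at this
      refine le_trans (le_of_eq (lintegral_congr fun k => ?_)) this
      congr 3
      ring) hK (log_two_div_pos h0 h1).le
  rw [exp_neg_log_two_div h0, sqrt_sq_mul_mul hb0 hK'] at htail
  refine (measure_mono fun ks hks => ?_).trans htail
  rw [Set.mem_ofPred_eq] at hks ⊢
  rw [lowerSample, errSample] at hks
  rw [Finset.sum_sub_distrib, Finset.sum_const, Finset.card_univ, Fintype.card_fin, nsmul_eq_mul]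
  have h2 : b * √(2 * Real.log (2 / δ) / K) <
      1 / (K : ℝ) * ∑ i, stochObj f (ks i) A - expectedObj f A := by
    rw [hb]
    linarith
  have h3 := mul_lt_mul_of_pos_left h2 hK'
  rw [mul_sub, ← mul_assoc, ← mul_assoc (K : ℝ) (1 / K), mul_one_div_cancel hK'.ne', one_mul] at h3
  rwa [← mul_assoc]

/-- The sampled bound rarely falls far below the expected objective, by Hoeffding's inequality. -/
theorem measure_lowerSample_lt (hd : 1 ≤ d)
    (hf : ContDiff ℝ (d + 1 : ℕ) f) (hp : LatticePeriodic f)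
    {μ : Measure (Fin d → ℤ)} [IsProbabilityMeasure μ] (hμ : ∀ k, μ.real {k} = prob d t k)
    (A : BandMatrix d t) {K : ℕ} (hK : 1 ≤ K) {δ : ℝ} (h0 : 0 < δ) (h1 : δ < 1) :
    (Measure.pi fun _ : Fin K => μ) {ks | lowerSample f δ ks A < expectedObj f A -
      errSample f δ K A - (((d : ℝ) + 1) * CNorm (d + 1) f + frobNorm A) *
        (∑' k, weight d t k) * √(2 * Real.log (2 / δ) / K)} ≤
      ENNReal.ofReal (δ / 2) := by
  have hC := CNorm_nonneg hd hf
  have hS := tsum_weight_pos (t := t) hd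
  have hA0 := frobNorm_nonneg A
  have hK' : (0 : ℝ) < K := by exact_mod_cast hK
  set b := (((d : ℝ) + 1) * CNorm (d + 1) f + frobNorm A) * (∑' k, weight d t k) with hb
  have hb0 : 0 ≤ b := by positivity
  have htail := measure_iid_sum_gt_le μ (X := fun k => expectedObj f A - stochObj f k A)
    (sq_nonneg b) (fun l _ => by
      have := lintegral_exp_le_of_abs_le μ (X := fun k => -stochObj f k A)
        (fun k => by rw [abs_neg]; exact abs_stochObj_le hd hf hp A k) l
      rw [integral_neg, integral_stochObj hd hf hp hμ] at this
      refine le_trans (le_of_eq (lintegral_congr fun k => ?_)) this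
      congr 3
      ring) hK (log_two_div_pos h0 h1).le
  rw [exp_neg_log_two_div h0, sqrt_sq_mul_mul hb0 hK'] at htail
  refine (measure_mono fun ks hks => ?_).trans htail
  rw [Set.mem_ofPred_eq] at hks ⊢
  rw [lowerSample] at hks
  rw [Finset.sum_sub_distrib, Finset.sum_const, Finset.card_univ, Fintype.card_fin, nsmul_eq_mul]
  have h2 : b * √(2 * Real.log (2 / δ) / K) <
      expectedObj f A - 1 / (K : ℝ) * ∑ i, stochObj f (ks i) A := by
    linarith
  have h3 := mul_lt_mul_of_pos_left h2 hK'
  rwa [mul_sub, ← mul_assoc (K : ℝ) (1 / K), mul_one_div_cancel hK'.ne', one_mul] at h3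

end

/-! ### The projection onto the feasible set -/

section

variable {d t : ℕ}

theorem zero_mem_feasible {R : ℝ} (hR : 0 ≤ R) : (0 : BandMatrix d t) ∈ feasible d t R :=
  ⟨.zero, by rwa [frobNorm_zero]⟩

theorem frobNorm_add_le (A B : BandMatrix d t) : frobNorm (A + B) ≤ frobNorm A + frobNorm B := by
  simp only [frobNorm_eq_norm_vec, map_add]
  exact norm_add_le _ _

theorem sum_smul_mem_feasible {R : ℝ} {ι : Type*} [Fintype ι] {w : ι → ℝ} (hw : ∀ i, 0 ≤ w i)
    (hw1 : ∑ i, w i = 1) {A : ι → BandMatrix d t} (hA : ∀ i, A i ∈ feasible d t R) :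
    ∑ i, (w i : ℂ) • A i ∈ feasible d t R := by
  refine ⟨Matrix.posSemidef_sum _ fun i _ =>
    (hA i).1.smul (Complex.zero_le_real.2 (hw i)), ?_⟩
  calc frobNorm (∑ i, (w i : ℂ) • A i) ≤ ∑ i, w i * frobNorm (A i) := by
        simp only [frobNorm_eq_norm_vec, map_sum, map_smul]
        refine (norm_sum_le _ _).trans (Finset.sum_le_sum fun i _ => ?_)
        rw [norm_smul, Complex.norm_real, Real.norm_of_nonneg (hw i)]
    _ ≤ ∑ i, w i * R := by
        gcongr with i _
        · exact hw i
        · exact (hA i).2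
    _ = R := by rw [← Finset.sum_mul, hw1, one_mul]

theorem isClosed_feasible (R : ℝ) : IsClosed (feasible d t R) := by
  have h1 : feasible d t R = ({A | Aᴴ = A} ∩ ⋂ x : band d t → ℂ, {A | 0 ≤ star x ⬝ᵥ (A *ᵥ x)}) ∩
      {A | frobNorm A ≤ R} := by
    ext A
    simp only [feasible, Set.mem_ofPred_eq, Set.mem_inter_iff, Set.mem_iInter,
      Matrix.posSemidef_iff_dotProduct_mulVec, Matrix.IsHermitian]
  rw [h1]
  refine ((isClosed_eq (by fun_prop) continuous_id).inter (isClosed_iInter fun x => ?_)).inter ?_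
  · exact isClosed_le continuous_const
      (continuous_const.dotProduct (continuous_id.matrix_mulVec continuous_const))
  · refine isClosed_le ?_ continuous_const
    unfold frobNorm
    refine Real.continuous_sqrt.comp (continuous_finsetSum _ fun i _ =>
      continuous_finsetSum _ fun j _ => ?_)
    exact ((continuous_apply_apply i j).norm).pow 2

theorem proj_spec {R : ℝ} (hR : 0 ≤ R) (X : BandMatrix d t) :
    proj R X ∈ feasible d t R ∧
      ∀ B ∈ feasible d t R, frobNorm (proj R X - X) ≤ frobNorm (B - X) := by
  refine Classical.epsilon_spec (p := fun A => A ∈ feasible d t R ∧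
    ∀ B ∈ feasible d t R, frobNorm (A - X) ≤ frobNorm (B - X)) ?_
  set e : EuclideanSpace ℂ (band d t × band d t) → BandMatrix d t :=
    fun v => Matrix.of fun i j => v (i, j) with he
  have hev : ∀ A, e (vec A) = A := fun A => rfl
  have hve : ∀ v, vec (e v) = v := fun v => rfl
  have hec : Continuous e := continuous_pi fun i => continuous_pi fun j =>
    (EuclideanSpace.proj (𝕜 := ℂ) (i, j)).continuous
  obtain ⟨v, hv, hdist⟩ :=
    ((isClosed_feasible (d := d) (t := t) R).preimage hec).exists_infDist_eq_dist
    ⟨vec 0, by rw [Set.mem_preimage, hev]; exact zero_mem_feasible hR⟩ (vec X)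
  refine ⟨e v, hv, fun B hB => ?_⟩
  have h1 := Metric.infDist_le_dist_of_mem (x := vec X) (s := e ⁻¹' feasible d t R) (y := vec B)
    (by rwa [Set.mem_preimage, hev])
  rw [hdist, dist_comm, dist_comm (vec X), dist_eq_norm, dist_eq_norm] at h1
  rwa [frobNorm_eq_norm_vec, frobNorm_eq_norm_vec, map_sub, map_sub, hve]

/-- A point `p` nearest to `x` on the segment from `p` to `b` is no farther from `b` than `x`. -/
theorem norm_sub_le_of_forall_segment {E : Type*} [NormedAddCommGroup E] [InnerProductSpace ℂ E]
    {x p b : E} (h : ∀ s : ℝ, 0 ≤ s → s ≤ 1 → ‖p - x‖ ≤ ‖p + (s : ℂ) • (b - p) - x‖) :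
    ‖p - b‖ ≤ ‖x - b‖ := by
  set r := RCLike.re (inner ℂ (p - x) (b - p)) with hr
  have h1 : ∀ s : ℝ, 0 < s → s ≤ 1 → 0 ≤ 2 * r + s * ‖b - p‖ ^ 2 := by
    intro s hs hs1
    have h2 := pow_le_pow_left₀ (norm_nonneg _) (h s hs.le hs1) 2
    rw [show p + (s : ℂ) • (b - p) - x = (p - x) + (s : ℂ) • (b - p) by abel,
      norm_add_sq (𝕜 := ℂ), inner_smul_right, norm_smul, Complex.norm_real,
      Real.norm_of_nonneg hs.le] at h2
    have h3 : RCLike.re ((s : ℂ) * inner ℂ (p - x) (b - p)) = s * r := by simp [hr]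
    rw [h3] at h2
    have h4 : 0 ≤ s * (2 * r + s * ‖b - p‖ ^ 2) := by nlinarith
    exact nonneg_of_mul_nonneg_right h4 hs
  have h5 : 0 ≤ 2 * r := by
    by_contra! hneg
    have hb : 0 ≤ ‖b - p‖ ^ 2 := sq_nonneg _
    have hs0 : 0 < min 1 (-r / (‖b - p‖ ^ 2 + 1)) :=
      lt_min one_pos (div_pos (by linarith) (by positivity))
    have h6 := h1 _ hs0 (min_le_left _ _)
    have h7 : min 1 (-r / (‖b - p‖ ^ 2 + 1)) * ‖b - p‖ ^ 2 ≤ -r := by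
      calc _ ≤ -r / (‖b - p‖ ^ 2 + 1) * (‖b - p‖ ^ 2 + 1) := by
            gcongr
            · exact div_nonneg (by linarith) (by positivity)
            · exact min_le_right _ _
            · linarith
        _ = -r := div_mul_cancel₀ _ (by positivity)
    linarith
  have h8 : ‖x - b‖ ^ 2 = ‖p - x‖ ^ 2 + 2 * r + ‖p - b‖ ^ 2 := by
    rw [norm_sub_rev x b, norm_sub_rev p b, hr, ← norm_add_sq (𝕜 := ℂ)]
    congr 2
    abel
  exact le_of_sq_le_sq (by nlinarith [sq_nonneg ‖p - x‖]) (norm_nonneg _)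

theorem frobNorm_proj_sub_le {R : ℝ} (hR : 0 ≤ R) (X : BandMatrix d t) {B : BandMatrix d t}
    (hB : B ∈ feasible d t R) : frobNorm (proj R X - B) ≤ frobNorm (X - B) := by
  obtain ⟨h1, h2⟩ := proj_spec hR X
  rw [frobNorm_eq_norm_vec, frobNorm_eq_norm_vec, map_sub, map_sub]
  refine norm_sub_le_of_forall_segment fun s hs hs1 => ?_
  have h3 : proj R X + (s : ℂ) • (B - proj R X) ∈ feasible d t R := by
    have := sum_smul_mem_feasible (R := R) (w := ![1 - s, s]) (A := ![proj R X, B])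
      (by simp [Fin.forall_fin_two, hs, hs1]) (by simp) (by simp [Fin.forall_fin_two, h1, hB])
    convert this using 1
    simp only [Fin.sum_univ_two, Matrix.cons_val_zero, Matrix.cons_val_one, Complex.ofReal_sub,
      Complex.ofReal_one, sub_smul, one_smul, smul_sub]
    abel
  have h4 := h2 _ h3
  simpa only [frobNorm_eq_norm_vec, map_sub, map_add, map_smul] using h4

/-! ### Projected stochastic gradient ascent -/

theorem abs_stochObj_sub_le (hd : 1 ≤ d) (f : (Fin d → ℝ) → ℝ) (A B : BandMatrix d t)
    (k : Fin d → ℤ) : |stochObj f k A - stochObj f k B| ≤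
      frobNorm (A - B) * (frobNorm (featCoeff d t k) / prob d t k) := by
  have hπ := prob_pos (t := t) hd k
  rw [stochObj_eq, stochObj_eq, ← sub_div, abs_div, abs_of_pos hπ, ← mul_div_assoc]
  gcongr
  exact abs_objTerm_sub_le f A B k

theorem frobInner_self_re (A : BandMatrix d t) : (frobInner A A).re = frobNorm A ^ 2 := by
  rw [frobInner_eq_inner_vec, frobNorm_eq_norm_vec]
  exact inner_self_eq_norm_sq (𝕜 := ℂ) _

variable {f : (Fin d → ℝ) → ℝ} {D : (Fin d → ℤ) → BandMatrix d t → BandMatrix d t} {R G : ℝ}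

/-- A supergradient is bounded by the Lipschitz constant: test its inequality at `A - D k A`. -/
theorem IsSupergradient.frobNorm_le (hd : 1 ≤ d) (hD : IsSupergradient f D)
    (hG : ∀ k, frobNorm (featCoeff d t k) / prob d t k ≤ G) (k : Fin d → ℤ) {A : BandMatrix d t}
    (hA : A.IsHermitian) : frobNorm (D k A) ≤ G := by
  obtain ⟨h1, h2⟩ := hD k A hA
  have h3 := h2 (A - D k A) (hA.sub h1)
  have h4 : (frobInner (D k A) (A - D k A - A)).re = -frobNorm (D k A) ^ 2 := by
    rw [sub_sub_cancel_left, frobInner_eq_inner_vec, map_neg, inner_neg_right, Complex.neg_re,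
      ← frobInner_eq_inner_vec, frobInner_self_re]
  have h5 := abs_stochObj_sub_le hd f A (A - D k A) k
  rw [sub_sub_cancel] at h5
  have h0 := frobNorm_nonneg (D k A)
  have h6 : frobNorm (D k A) ^ 2 ≤ frobNorm (D k A) * G := by
    have := h5.trans (mul_le_mul_of_nonneg_left (hG k) h0)
    linarith [le_abs_self (stochObj f k A - stochObj f k (A - D k A))]
  rcases h0.eq_or_lt with h | h
  · rw [← h]
    exact (div_nonneg (frobNorm_nonneg _) (prob_pos hd k).le).trans (hG k)
  · rw [sq] at h6
    exact le_of_mul_le_mul_left h6 h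

/-- One step of projected supergradient ascent decreases the squared distance to any feasible point,
up to the squared step length, by the gain of that point over the current iterate. -/
theorem IsSupergradient.step_le (hd : 1 ≤ d) (hD : IsSupergradient f D)
    (hG : ∀ k, frobNorm (featCoeff d t k) / prob d t k ≤ G) (hR : 0 ≤ R) {η : ℝ} (hη : 0 ≤ η)
    {A B : BandMatrix d t} (hA : A ∈ feasible d t R) (hB : B ∈ feasible d t R) (k : Fin d → ℤ) :
    2 * η * (stochObj f k B - stochObj f k A) ≤
      frobNorm (A - B) ^ 2 - frobNorm (proj R (A + (η : ℂ) • D k A) - B) ^ 2 + η ^ 2 * G ^ 2 := by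
  have h1 := (hD k A hA.1.isHermitian).2 B hB.1.isHermitian
  have h2 := hD.frobNorm_le hd hG k hA.1.isHermitian
  have h3 := pow_le_pow_left₀ (frobNorm_nonneg _)
    (frobNorm_proj_sub_le hR (A + (η : ℂ) • D k A) hB) 2
  have h4 : frobNorm (A + (η : ℂ) • D k A - B) ^ 2 = frobNorm (A - B) ^ 2 -
      2 * η * (frobInner (D k A) (B - A)).re + η ^ 2 * frobNorm (D k A) ^ 2 := by
    rw [show A + (η : ℂ) • D k A - B = (A - B) + (η : ℂ) • D k A by abel]
    simp only [frobNorm_eq_norm_vec, frobInner_eq_inner_vec, map_add, map_smul]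
    rw [← neg_sub A B, map_neg, norm_add_sq (𝕜 := ℂ), inner_smul_right, norm_smul,
      Complex.norm_real, Real.norm_of_nonneg hη, inner_neg_right]
    have hs := inner_re_symm (𝕜 := ℂ) (vec (A - B)) (vec (D k A))
    simp only [RCLike.re_to_complex, Complex.re_ofReal_mul, Complex.neg_re] at hs ⊢
    rw [hs]
    ring
  have h5 : η ^ 2 * frobNorm (D k A) ^ 2 ≤ η ^ 2 * G ^ 2 := by
    have := frobNorm_nonneg (D k A)
    gcongr
  have h6 := mul_le_mul_of_nonneg_left h1 (by linarith : 0 ≤ 2 * η)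
  linarith

theorem iterates_eq_chainState {T : ℕ} (η : ℝ) (ks : Fin T → Fin d → ℤ) :
    iterates D R η ks = chainState (fun A k => proj R (A + (η : ℂ) • D k A)) 0 ks := rfl

theorem iterates_succ {T : ℕ} (η : ℝ) (ks : Fin T → Fin d → ℤ) (i : Fin T) :
    iterates D R η ks i.succ =
      proj R (iterates D R η ks i.castSucc + (η : ℂ) • D (ks i) (iterates D R η ks i.castSucc)) :=
  chainState_succ (fun A k => proj R (A + (η : ℂ) • D k A)) 0 ks i

theorem iterates_mem_feasible (hR : 0 ≤ R) {T : ℕ} (η : ℝ) (ks : Fin T → Fin d → ℤ)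
    (i : Fin (T + 1)) : iterates D R η ks i ∈ feasible d t R :=
  chainState_mem (F := fun A k => proj R (A + (η : ℂ) • D k A)) (zero_mem_feasible hR)
    (fun _ _ _ => (proj_spec hR _).1) ks i

theorem one_div_smul_sum_eq {T : ℕ} (a : Fin T → BandMatrix d t) :
    (1 / (T : ℂ)) • ∑ i, a i = ∑ i, (((1 / T : ℝ)) : ℂ) • a i := by
  rw [Finset.smul_sum]
  simp

theorem sum_const_one_div {T : ℕ} (hT : 1 ≤ T) : ∑ _i : Fin T, (1 / T : ℝ) = 1 := by
  have : (T : ℝ) ≠ 0 := by positivity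
  simp [this]

theorem sgaOutput_mem_feasible (hR : 0 ≤ R) {T : ℕ} (hT : 1 ≤ T) (η : ℝ)
    (ks : Fin T → Fin d → ℤ) : sgaOutput D R η ks ∈ feasible d t R := by
  rw [sgaOutput, one_div_smul_sum_eq]
  exact sum_smul_mem_feasible (fun _ => by positivity) (sum_const_one_div hT)
    fun i => iterates_mem_feasible hR η ks _

theorem frobNorm_sub_le_of_mem_feasible {A B : BandMatrix d t} (hA : A ∈ feasible d t R)
    (hB : B ∈ feasible d t R) : frobNorm (A - B) ≤ 2 * R := by
  have h1 := frobNorm_add_le A (-B)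
  have h2 : frobNorm (-B) = frobNorm B := by simp [frobNorm_eq_norm_vec]
  rw [← sub_eq_add_neg, h2] at h1
  linarith [hA.2, hB.2]

theorem sum_castSucc_sub_succ {T : ℕ} (u : Fin (T + 1) → ℝ) :
    ∑ i : Fin T, (u i.castSucc - u i.succ) = u 0 - u (Fin.last T) := by
  have h1 := Fin.sum_univ_castSucc u
  have h2 := Fin.sum_univ_succ u
  rw [Finset.sum_sub_distrib]
  linarith

/-- The regret of projected supergradient ascent, for an arbitrary sequence of frequencies. -/
theorem IsSupergradient.regret_le (hd : 1 ≤ d) (hD : IsSupergradient f D)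
    (hG : ∀ k, frobNorm (featCoeff d t k) / prob d t k ≤ G) (hG0 : 0 < G) (hR : 0 ≤ R)
    {B : BandMatrix d t} (hB : B ∈ feasible d t R) {T : ℕ} (hT : 1 ≤ T) (ks : Fin T → Fin d → ℤ) :
    ∑ i, (stochObj f (ks i) B -
      stochObj f (ks i) (iterates D R (R / (G * √T)) ks i.castSucc)) ≤ R * G * √T := by
  have hT0 : (0 : ℝ) < T := by exact_mod_cast hT
  set η := R / (G * √T) with hη
  have hη0 : 0 ≤ η := by positivity
  have hmem := iterates_mem_feasible (D := D) hR η ks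
  rcases hR.eq_or_lt with rfl | hR
  · -- a vanishing radius leaves the zero matrix as only feasible point
    have h0 : ∀ A ∈ feasible d t 0, A = B := fun A hA => by
      have h1 : frobNorm (A - B) = 0 :=
        le_antisymm (by simpa using frobNorm_sub_le_of_mem_feasible hA hB) (frobNorm_nonneg _)
      rw [frobNorm_eq_norm_vec, norm_eq_zero] at h1
      have h2 : vec A = vec B := by rwa [map_sub, sub_eq_zero] at h1
      ext i j
      exact congrArg (fun v => v (i, j)) h2
    simp [h0 _ (hmem _)]
  · have h1 := Finset.sum_le_sum fun (i : Fin T) (_ : i ∈ Finset.univ) =>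
      hD.step_le hd hG hR.le hη0 (hmem i.castSucc) hB (ks i)
    simp only [← iterates_succ] at h1
    rw [← Finset.mul_sum, Finset.sum_add_distrib,
      sum_castSucc_sub_succ fun i => frobNorm (iterates D R η ks i - B) ^ 2, Finset.sum_const,
      Finset.card_univ, Fintype.card_fin, nsmul_eq_mul] at h1
    have h2 : frobNorm (iterates D R η ks 0 - B) ≤ R := by
      have : frobNorm (iterates D R η ks 0 - B) = frobNorm B := by
        rw [iterates_eq_chainState, chainState_zero]
        simp [frobNorm_eq_norm_vec]
      rw [this]
      exact hB.2
    have h3 := pow_le_pow_left₀ (frobNorm_nonneg _) h2 2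
    have h4 : (T : ℝ) * (η ^ 2 * G ^ 2) = R ^ 2 := by
      rw [hη, div_pow, mul_pow, Real.sq_sqrt hT0.le]
      field_simp
    have h5 : 2 * η * (R * G * √T) = 2 * R ^ 2 := by
      rw [hη]
      field_simp
    have h6 : 0 < 2 * η := by positivity
    refine le_of_mul_le_mul_left ?_ h6
    rw [h5]
    linarith [sq_nonneg (frobNorm (iterates D R η ks (Fin.last T) - B))]

/-- The output of projected stochastic gradient ascent is nearly optimal with high probability: the
regret bound passes to the expected objective by the Azuma–Hoeffding inequality, and to the averaged
iterate by concavity. -/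
theorem measure_expectedObj_sgaOutput_lt (hd : 1 ≤ d) (hf : ContDiff ℝ (d + 1 : ℕ) f)
    (hp : LatticePeriodic f) (hsum : Summable fun k => ‖fcoeff (fun x => (f x : ℂ)) k‖)
    {μ : Measure (Fin d → ℤ)} [IsProbabilityMeasure μ] (hμ : ∀ k, μ.real {k} = prob d t k)
    (hD : IsSupergradient f D) (hG : ∀ k, frobNorm (featCoeff d t k) / prob d t k ≤ G)
    (hR : 0 ≤ R) {W : ℝ} (hGW : G ≤ W)
    (hMW : ∑' k : Fin d → ℤ, frobNorm (featCoeff d t k) ≤ W)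
    {B : BandMatrix d t} (hB : B ∈ feasible d t R) {T : ℕ} (hT : 1 ≤ T)
    {δ : ℝ} (h0 : 0 < δ) (h1 : δ < 1) :
    (Measure.pi fun _ : Fin T => μ) {ks | expectedObj f (sgaOutput D R (R / (G * √T)) ks) <
      expectedObj f B - W * (20 * R * Real.log (2 / δ) / √T)} ≤ ENNReal.ofReal (δ / 2) := by
  have hT0 : (0 : ℝ) < T := by exact_mod_cast hT
  have hG0 : 0 < G := lt_of_lt_of_le (div_pos (zero_lt_one.trans_le
    (one_le_frobNorm_featCoeff zero_mem_band)) (prob_pos (t := t) hd 0)) (hG 0)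
  have hℓ := log_two_div_pos h0 h1
  set ℓ := Real.log (2 / δ) with hℓdef
  have hℓ2 : 1 / 2 ≤ ℓ := by
    have h2 : Real.log 2 ≤ ℓ :=
      Real.log_le_log (by norm_num) (by rw [le_div_iff₀ h0]; linarith)
    linarith [Real.log_two_gt_d9]
  set η := R / (G * √T) with hη
  have htail := measure_chain_sum_gt_le μ (F := fun A k => proj R (A + (η : ℂ) • D k A))
    (X := fun A k => (expectedObj f B - expectedObj f A) - (stochObj f k B - stochObj f k A))
    (sq_nonneg (2 * R * G)) (I := feasible d t R) (fun A _ k => (proj_spec hR _).1)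
    (fun A hA l _ => by
      have hb : ∀ k, |stochObj f k A - stochObj f k B| ≤ 2 * R * G := fun k => by
        refine (abs_stochObj_sub_le hd f A B k).trans ?_
        have h2 := frobNorm_sub_le_of_mem_feasible hA hB
        have h3 := frobNorm_nonneg (featCoeff d t k)
        have h4 := prob_pos (t := t) hd k
        gcongr
        exact hG k
      have := lintegral_exp_le_of_abs_le μ hb l
      rw [integral_sub (integrable_stochObj hd hf hp μ A) (integrable_stochObj hd hf hp μ B),
        integral_stochObj hd hf hp hμ, integral_stochObj hd hf hp hμ] at this
      refine le_trans (le_of_eq (lintegral_congr fun k => ?_)) this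
      congr 3
      ring) (zero_mem_feasible hR) hT hℓ.le
  rw [exp_neg_log_two_div h0, sqrt_sq_mul_mul (by positivity) hT0] at htail
  refine (measure_mono fun ks hks => ?_).trans htail
  rw [Set.mem_ofPred_eq] at hks ⊢
  rw [← iterates_eq_chainState]
  by_contra! hle
  refine absurd hks (not_lt.2 ?_)
  set a := iterates D R η ks with ha
  have hreg := hD.regret_le hd hG hG0 hR hB hT ks
  rw [← hη, ← ha] at hreg
  have hmem : ∀ i, a i ∈ feasible d t R := iterates_mem_feasible hR η ks
  have h2 : ∑ i : Fin T, (expectedObj f B - expectedObj f (a i.castSucc)) ≤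
      R * G * √T + T * (2 * R * G * √(2 * ℓ / T)) := by
    have := add_le_add hreg hle
    rw [← Finset.sum_add_distrib] at this
    simpa only [add_sub_cancel] using this
  have h3 : ∑ i : Fin T, (expectedObj f (a i.castSucc) - expectedObj f (a i.succ)) ≤ R * W := by
    rw [sum_castSucc_sub_succ fun i => expectedObj f (a i)]
    refine (le_abs_self _).trans ((abs_expectedObj_sub_le hsum _ _).trans ?_)
    have h4 : frobNorm (a 0 - a (Fin.last T)) ≤ R := by
      have : frobNorm (a 0 - a (Fin.last T)) = frobNorm (a (Fin.last T)) := by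
        rw [ha, iterates_eq_chainState, chainState_zero]
        simp [frobNorm_eq_norm_vec]
      rw [this]
      exact (hmem _).2
    have h5 : 0 ≤ ∑' k : Fin d → ℤ, frobNorm (featCoeff d t k) :=
      tsum_nonneg fun _ => frobNorm_nonneg _
    gcongr
  have h6 : ∑ i : Fin T, (1 / T : ℝ) * expectedObj f (a i.succ) ≤
      expectedObj f (sgaOutput D R η ks) := by
    rw [sgaOutput, one_div_smul_sum_eq]
    exact le_expectedObj_convex hsum _ (fun _ => by positivity) (sum_const_one_div hT) _
  have h7 : ∑ i : Fin T, (expectedObj f B - expectedObj f (a i.succ)) =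
      ∑ i : Fin T, (expectedObj f B - expectedObj f (a i.castSucc)) +
        ∑ i : Fin T, (expectedObj f (a i.castSucc) - expectedObj f (a i.succ)) := by
    rw [← Finset.sum_add_distrib]
    exact Finset.sum_congr rfl fun i _ => by ring
  rw [Finset.sum_sub_distrib, Finset.sum_const, Finset.card_univ, Fintype.card_fin,
    nsmul_eq_mul] at h7
  rw [← Finset.mul_sum, div_mul_eq_mul_div, one_mul, div_le_iff₀ hT0] at h6
  -- it remains to compare `R G √T + T · 2 R G √(2ℓ/T) + R W` with `20 R ℓ W √T`
  have h8 : (T : ℝ) * √(2 * ℓ / T) = √(2 * ℓ) * √T := by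
    rw [Real.sqrt_div (by positivity), ← mul_div_assoc, div_eq_iff (by positivity), mul_assoc,
      Real.mul_self_sqrt hT0.le, mul_comm]
  have hsT : 1 ≤ √(T : ℝ) := Real.one_le_sqrt.2 (by exact_mod_cast hT)
  have hsℓ : √(2 * ℓ) ≤ 2 * ℓ := Real.sqrt_le_iff.2 ⟨by linarith, by nlinarith⟩
  have hW : 0 ≤ W := hG0.le.trans hGW
  have h9 : R * G * √T + T * (2 * R * G * √(2 * ℓ / T)) + R * W ≤ R * W * √T * (20 * ℓ) := by
    calc _ = R * G * √T + R * G * √T * (2 * √(2 * ℓ)) + R * W * 1 := by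
          linear_combination (2 * R * G) * h8
      _ ≤ R * W * √T + R * W * √T * (2 * (2 * ℓ)) + R * W * √T := by gcongr
      _ = R * W * √T * (2 + 4 * ℓ) := by ring
      _ ≤ _ := by gcongr; linarith
  have h10 : W * (20 * R * ℓ / √T) * T = R * W * √T * (20 * ℓ) := by
    field_simp
    rw [Real.sq_sqrt hT0.le]
  have h11 : (expectedObj f B - W * (20 * R * ℓ / √T)) * T ≤
      expectedObj f (sgaOutput D R η ks) * T := by
    rw [sub_mul, h10]
    linarith
  exact le_of_mul_le_mul_right h11 hT0

end

/-! ### The deterministic bound -/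

section

variable {d t : ℕ} {f : (Fin d → ℝ) → ℝ}

/-- Beyond the cutoff, each term of the expected objective is replaced by a lower bound. -/
theorem lowerDet_le_expectedObj (hd : 1 ≤ d)
    (hsum : Summable fun k => ‖fcoeff (fun x => (f x : ℂ)) k‖) (K : ℕ) (A : BandMatrix d t) :
    lowerDet f K A ≤ expectedObj f A := by
  set g : (Fin d → ℤ) → ℝ := fun k =>
    ‖fcoeff (fun x => (f x : ℂ)) k‖ + frobNorm A * frobNorm (featCoeff d t k) with hg
  have hgs : Summable g := hsum.add (summable_frobNorm_featCoeff.mul_left (frobNorm A))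
  have h1 : HasSum (fun k => if k ∈ band d K then objTerm f A k else 0)
      (∑ k ∈ band d K, prob d t k * stochObj f k A) := by
    have h2 := hasSum_sum_of_ne_finset_zero (s := band d K) (L := SummationFilter.unconditional _)
      (f := fun k => if k ∈ band d K then objTerm f A k else 0) fun k hk => if_neg hk
    convert h2 using 1
    exact Finset.sum_congr rfl fun k hk => by rw [prob_mul_stochObj hd, if_pos hk]
  have h2 : HasSum ({k : Fin d → ℤ | (K : ℤ) < len k}.indicator g)
      (∑' k : {k : Fin d → ℤ // (K : ℤ) < len k}, g k.1) :=
    hasSum_subtype_iff_indicator.1 (hgs.subtype {k : Fin d → ℤ | (K : ℤ) < len k}).hasSum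
  refine hasSum_le (fun k => ?_) (h1.sub h2) (summable_objTerm hsum A).hasSum
  by_cases hk : len k ≤ K
  · rw [if_pos (mem_band.2 hk),
      Set.indicator_of_notMem (by rw [Set.mem_ofPred_eq]; omega), sub_zero]
  · rw [if_neg (fun h => hk (mem_band.1 h)),
      Set.indicator_of_mem (by rw [Set.mem_ofPred_eq]; omega), zero_sub]
    have h3 : |objTerm f A k| ≤ g k := (abs_objTerm_le f A k).trans
      ((norm_sub_le _ _).trans (by simp only [hg]; gcongr; exact norm_frobInner_le _ _))
    linarith [(abs_le.1 h3).1]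

/-! ### From tail bounds to coverage probabilities -/

theorem one_sub_le_measureReal {Ω : Type*} [MeasurableSpace Ω] {P : Measure Ω}
    [IsProbabilityMeasure P] {E : Set Ω} (hE : MeasurableSet E) {ε : ℝ} (hε : 0 ≤ ε)
    (h : P Eᶜ ≤ ENNReal.ofReal ε) : 1 - ε ≤ P.real E := by
  have h1 : P.real Eᶜ ≤ ε := ENNReal.toReal_le_of_le_ofReal hε h
  rw [probReal_compl_eq_one_sub hE] at h1
  linarith

/-- A union bound for two independent blocks of samples, where the second bad event may depend on
the first block. -/
theorem measure_pi_sum_or_le {Z : Type*} [MeasurableSpace Z] [Countable Z]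
    [MeasurableSingletonClass Z] (μ : Measure Z) [IsProbabilityMeasure μ] {T K : ℕ}
    {E : Set (Fin T → Z)} {F : (Fin T → Z) → Set (Fin K → Z)} {a b : ENNReal}
    (hE : (Measure.pi fun _ : Fin T => μ) E ≤ a)
    (hF : ∀ x, (Measure.pi fun _ : Fin K => μ) (F x) ≤ b) :
    (Measure.pi fun _ : Fin T ⊕ Fin K => μ) {ks | (fun i => ks (.inl i)) ∈ E ∨
      (fun i => ks (.inr i)) ∈ F fun i => ks (.inl i)} ≤ a + b := by
  have hmp := measurePreserving_sumPiEquivProdPi (ι := Fin T) (ι' := Fin K) fun _ => μ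
  have h1 : (Measure.pi fun _ : Fin T ⊕ Fin K => μ) {ks | (fun i => ks (.inl i)) ∈ E ∨
      (fun i => ks (.inr i)) ∈ F fun i => ks (.inl i)} =
      ((Measure.pi fun _ : Fin T => μ).prod (Measure.pi fun _ : Fin K => μ))
        {p | p.1 ∈ E ∨ p.2 ∈ F p.1} := by
    rw [← hmp.measure_preimage (Set.to_countable _).measurableSet.nullMeasurableSet]
    rfl
  rw [h1]
  refine (measure_mono (t := (E ×ˢ Set.univ) ∪ {p | p.2 ∈ F p.1}) ?_).trans
    ((measure_union_le _ _).trans (add_le_add ?_ ?_))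
  · rintro p (hp | hp)
    · exact Or.inl ⟨hp, trivial⟩
    · exact Or.inr hp
  · rw [Measure.prod_prod, measure_univ, mul_one]
    exact hE
  · rw [Measure.prod_apply (Set.to_countable _).measurableSet]
    calc _ ≤ ∫⁻ _, b ∂(Measure.pi fun _ : Fin T => μ) := lintegral_mono fun x => hF x
      _ = b := by rw [lintegral_const, measure_univ, mul_one]

/-- The a posteriori guarantee of the sampled bound. -/
theorem one_sub_le_measureReal_lowerSample_le (hd : 1 ≤ d) (ht : 1 ≤ t)
    (hf : ContDiff ℝ (d + 1 : ℕ) f) (hp : LatticePeriodic f)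
    (hsum : Summable fun k => ‖fcoeff (fun x => (f x : ℂ)) k‖)
    {A : BandMatrix d t} (hA : A.PosSemidef) {K : ℕ} (hK : 1 ≤ K) {δ : ℝ} (h0 : 0 < δ)
    (h1 : δ < 1) {Ω : Type*} [MeasurableSpace Ω] {P : Measure Ω} [IsProbabilityMeasure P]
    {κ : Fin K → Ω → (Fin d → ℤ)} (hκ : IsIIDSample t P κ) (x : Fin d → ℝ) :
    1 - δ ≤ P.real {ω | globalMin f ≤ f x ∧ lowerSample f δ (fun i => κ i ω) A ≤ globalMin f} := by
  have : Nonempty (Fin K) := ⟨⟨0, hK⟩⟩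
  obtain ⟨μ, _, hμ, hlaw⟩ := hκ.exists_law
  have hc := hf.continuous
  refine (one_sub_le_measureReal (P := Measure.pi fun _ : Fin K => μ)
    (E := {ks | globalMin f ≤ f x ∧ lowerSample f δ ks A ≤ globalMin f})
    (Set.to_countable _).measurableSet h0.le ?_).trans (hlaw _).ge
  refine (measure_mono fun ks hks => ?_).trans
    ((measure_expectedObj_lt_lowerSample hd ht hf hp hμ hA hK h0 h1).trans
      (ENNReal.ofReal_le_ofReal (by linarith)))
  rw [Set.mem_compl_iff, Set.mem_ofPred_eq, not_and, not_le] at hks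
  exact (expectedObj_le_globalMin hsum hc hp hA).trans_lt (hks (globalMin_le hc hp x))

/-! ### The a priori guarantee -/

theorem tsum_frobNorm_featCoeff_le_mul (ht : 1 ≤ t) :
    ∑' k : Fin d → ℤ, frobNorm (featCoeff d t k) ≤
      3 ^ d * ((band d t).card : ℝ) * (t : ℝ) ^ d := by
  refine tsum_frobNorm_featCoeff_le.trans ?_
  rw [sq]
  calc ((band d t).card : ℝ) * (band d t).card ≤ (band d t).card * (3 ^ d * (t : ℝ) ^ d) := by
        gcongr
        exact card_band_le ht
    _ = _ := by ring

theorem tsum_frobNorm_featCoeff_add_le (hd : 1 ≤ d) (ht : 1 ≤ t) :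
    ∑' k : Fin d → ℤ, frobNorm (featCoeff d t k) + 3 / 2 ≤
      4 ^ d * ((band d t).card : ℝ) * (t : ℝ) ^ d := by
  have h1 : (3 : ℝ) ≤ (band d t).card := by exact_mod_cast three_le_card_band hd ht
  have h2 : (1 : ℝ) ≤ (t : ℝ) ^ d := one_le_pow₀ (by exact_mod_cast ht)
  have h3 : (3 : ℝ) ^ d + 1 ≤ 4 ^ d := by
    exact_mod_cast Nat.succ_le_of_lt (Nat.pow_lt_pow_left (by norm_num : 3 < 4) (by omega))
  have h4 : (3 : ℝ) ≤ (band d t).card * (t : ℝ) ^ d := by nlinarith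
  calc _ ≤ 3 ^ d * ((band d t).card : ℝ) * (t : ℝ) ^ d + (band d t).card * (t : ℝ) ^ d :=
        add_le_add (tsum_frobNorm_featCoeff_le_mul ht) (by linarith)
    _ = (3 ^ d + 1) * ((band d t).card * (t : ℝ) ^ d) := by ring
    _ ≤ 4 ^ d * ((band d t).card * (t : ℝ) ^ d) := by gcongr
    _ = _ := by ring

theorem sqrt_add_one_le_two_pow (d : ℕ) : √((d : ℝ) + 1) ≤ 2 ^ d := by
  refine Real.sqrt_le_iff.2 ⟨by positivity, ?_⟩
  have h1 : (d : ℝ) + 1 ≤ 2 ^ d := by exact_mod_cast Nat.lt_two_pow_self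
  have h2 : (1 : ℝ) ≤ 2 ^ d := one_le_pow₀ (by norm_num)
  nlinarith

/-- Both the error `Err` and the lower deviation of the sample mean fit into the stated rate, by
`√(d+1) ≤ 2^d` and `∑ w ≤ 4^d n t^d`. -/
theorem errSample_add_deviation_le (hd : 1 ≤ d) (ht : 1 ≤ t) (hf : ContDiff ℝ (d + 1 : ℕ) f)
    {A : BandMatrix d t} {R : ℝ} (hA : frobNorm A ≤ R) {K : ℕ} (δ : ℝ) :
    errSample f δ K A + (((d : ℝ) + 1) * CNorm (d + 1) f + frobNorm A) *
        (∑' k, weight d t k) * √(2 * Real.log (2 / δ) / K) ≤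
      8 ^ d * ((band d t).card : ℝ) * (t : ℝ) ^ d *
        (2 * (√((d : ℝ) + 1) * CNorm (d + 1) f + R) * √(2 * Real.log (2 / δ)) / √(K : ℝ)) := by
  have hC := CNorm_nonneg hd hf
  have hS := tsum_weight_pos (t := t) hd
  have hA0 := frobNorm_nonneg A
  have hR : 0 ≤ R := hA0.trans hA
  have hQ := tsum_frobNorm_featCoeff_add_le hd ht
  have hSQ := (tsum_weight_le (t := t) hd).trans hQ
  have hDl := seven_fifths_le_sqrt hd
  have hDu := sqrt_add_one_le_two_pow d
  have hD2 : √((d : ℝ) + 1) * √((d : ℝ) + 1) = (d : ℝ) + 1 := Real.mul_self_sqrt (by positivity)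
  set D := √((d : ℝ) + 1) with hD
  set N := ((band d t).card : ℝ) * (t : ℝ) ^ d with hN
  set r := √(2 * Real.log (2 / δ) / K) with hr
  have hN0 : 0 ≤ N := by positivity
  have hr0 : 0 ≤ r := Real.sqrt_nonneg _
  have h8 : (8 : ℝ) ^ d = 2 ^ d * 4 ^ d := by rw [← mul_pow]; norm_num
  have h48 : (4 : ℝ) ^ d ≤ 8 ^ d := pow_le_pow_left₀ (by norm_num) (by norm_num) d
  rw [mul_assoc, ← hN] at hQ hSQ
  have h1 : (1 + ∑' k : Fin d → ℤ, frobNorm (featCoeff d t k)) ≤ 8 ^ d * N := by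
    have : (4 : ℝ) ^ d * N ≤ 8 ^ d * N := by gcongr
    linarith
  have h2 : (((d : ℝ) + 1) * CNorm (d + 1) f + frobNorm A) * (∑' k, weight d t k) ≤
      (D * CNorm (d + 1) f + R) * (8 ^ d * N) := by
    calc _ ≤ (D * (D * CNorm (d + 1) f) + D * R) * (4 ^ d * N) := by
          rw [← mul_assoc D D, hD2]
          gcongr
          nlinarith
      _ = D * ((D * CNorm (d + 1) f + R) * (4 ^ d * N)) := by ring
      _ ≤ 2 ^ d * ((D * CNorm (d + 1) f + R) * (4 ^ d * N)) := by gcongr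
      _ = _ := by rw [h8]; ring
  have h3 : √(2 * Real.log (2 / δ)) / √(K : ℝ) = r := (Real.sqrt_div' _ (Nat.cast_nonneg K)).symm
  calc _ ≤ (D * CNorm (d + 1) f + R) * r * (8 ^ d * N) +
        (D * CNorm (d + 1) f + R) * (8 ^ d * N) * r := by
        rw [errSample, ← hD, ← hr]
        have : 0 ≤ ∑' k : Fin d → ℤ, frobNorm (featCoeff d t k) :=
          tsum_nonneg fun _ => frobNorm_nonneg _
        gcongr
    _ = 8 ^ d * N * (2 * (D * CNorm (d + 1) f + R) * r) := by ring
    _ = _ := by rw [← h3, hN]; ring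

/-- The a priori guarantee, where `ε` is the error of the relaxation. -/
theorem one_sub_le_measureReal_sgaOutput (hd : 1 ≤ d) (ht : 1 ≤ t)
    (hf : ContDiff ℝ (d + 1 : ℕ) f) (hp : LatticePeriodic f)
    (hsum : Summable fun k => ‖fcoeff (fun x => (f x : ℂ)) k‖) {ε : ℝ}
    (hε : ∃ A : BandMatrix d t, A.PosSemidef ∧ globalMin f - ε ≤ relaxObj f (globalMin f) A)
    {R : ℝ} {Astar : BandMatrix d t} (hmax : IsMaximizer f Astar) (hAR : frobNorm Astar ≤ R)
    {D : (Fin d → ℤ) → BandMatrix d t → BandMatrix d t} (hD : IsSupergradient f D)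
    {G : ℝ} (hG : ∀ k, frobNorm (featCoeff d t k) / prob d t k ≤ G)
    (hGS : G ≤ ∑' k : Fin d → ℤ, weight d t k)
    {T K : ℕ} (hT : 1 ≤ T) (hK : 1 ≤ K) {δ : ℝ} (h0 : 0 < δ) (h1 : δ < 1)
    {Ω : Type*} [MeasurableSpace Ω] {P : Measure Ω} [IsProbabilityMeasure P]
    {κ : Fin T ⊕ Fin K → Ω → (Fin d → ℤ)} (hκ : IsIIDSample t P κ) :
    1 - 2 * δ ≤ P.real {ω |
      let Abar : BandMatrix d t :=
        sgaOutput D R (R / (G * √(T : ℝ))) (fun i => κ (Sum.inl i) ω)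
      let chat : ℝ := lowerSample f δ (fun i => κ (Sum.inr i) ω) Abar
      chat ≤ globalMin f ∧
      globalMin f - ε
        - 8 ^ d * ((band d t).card : ℝ) * (t : ℝ) ^ d *
          (20 * R * Real.log (2 / δ) / √(T : ℝ)
            + 2 * (√((d : ℝ) + 1) * CNorm (d + 1) f + R) * √(2 * Real.log (2 / δ))
              / √(K : ℝ)) ≤ chat} := by
  have hc := hf.continuous
  have hR : 0 ≤ R := (frobNorm_nonneg _).trans hAR
  have hB : Astar ∈ feasible d t R := ⟨hmax.1, hAR⟩
  have hval : globalMin f - ε ≤ expectedObj f Astar := by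
    obtain ⟨A, hA, hAε⟩ := hε
    obtain ⟨c, hcmax⟩ := hmax.2
    exact hAε.trans ((hcmax _ A hA).trans
      (relaxObj_le_expectedObj hsum hc hmax.1.isHermitian c))
  set W := 8 ^ d * ((band d t).card : ℝ) * (t : ℝ) ^ d with hW
  have hQW : ∑' k : Fin d → ℤ, frobNorm (featCoeff d t k) + 3 / 2 ≤ W := by
    refine (tsum_frobNorm_featCoeff_add_le hd ht).trans ?_
    rw [hW]
    gcongr
    norm_num
  have hGW : G ≤ W := hGS.trans ((tsum_weight_le hd).trans hQW)
  have hMW : ∑' k : Fin d → ℤ, frobNorm (featCoeff d t k) ≤ W := by linarith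
  have : Nonempty (Fin T ⊕ Fin K) := ⟨.inl ⟨0, hT⟩⟩
  obtain ⟨μ, _, hμ, hlaw⟩ := hκ.exists_law
  set out : (Fin T → Fin d → ℤ) → BandMatrix d t := sgaOutput D R (R / (G * √(T : ℝ))) with hout
  have hmem : ∀ ks, out ks ∈ feasible d t R := sgaOutput_mem_feasible hR hT _
  set dev : BandMatrix d t → ℝ := fun A => (((d : ℝ) + 1) * CNorm (d + 1) f + frobNorm A) *
    (∑' k, weight d t k) * √(2 * Real.log (2 / δ) / K) with hdev
  have htail := measure_pi_sum_or_le μ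
    (F := fun x => {ks : Fin K → Fin d → ℤ | expectedObj f (out x) < lowerSample f δ ks (out x)} ∪
      {ks | lowerSample f δ ks (out x) <
        expectedObj f (out x) - errSample f δ K (out x) - dev (out x)})
    (measure_expectedObj_sgaOutput_lt hd hf hp hsum hμ hD hG hR hGW hMW hB hT h0 h1)
    (fun x => (measure_union_le _ _).trans (add_le_add
      (measure_expectedObj_lt_lowerSample hd ht hf hp hμ (hmem x).1 hK h0 h1)
      (measure_lowerSample_lt hd hf hp hμ (out x) hK h0 h1)))
  refine (one_sub_le_measureReal (P := Measure.pi fun _ : Fin T ⊕ Fin K => μ)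
    (E := {ks | lowerSample f δ (fun i => ks (.inr i)) (out fun i => ks (.inl i)) ≤ globalMin f ∧
      globalMin f - ε - W * (20 * R * Real.log (2 / δ) / √(T : ℝ) +
        2 * (√((d : ℝ) + 1) * CNorm (d + 1) f + R) * √(2 * Real.log (2 / δ)) / √(K : ℝ)) ≤
        lowerSample f δ (fun i => ks (.inr i)) (out fun i => ks (.inl i))})
    (Set.to_countable _).measurableSet (by linarith) ?_).trans (hlaw _).ge
  refine (measure_mono fun ks hks => ?_).trans (htail.trans ?_)
  · rw [Set.mem_ofPred_eq]
    by_contra! hgood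
    obtain ⟨g1, g2⟩ := hgood
    rw [Set.mem_ofPred_eq, not_lt] at g1
    rw [Set.mem_union, Set.mem_ofPred_eq, Set.mem_ofPred_eq, not_or, not_lt, not_lt] at g2
    obtain ⟨g2, g3⟩ := g2
    rw [Set.mem_compl_iff, Set.mem_ofPred_eq] at hks
    refine hks ⟨g2.trans (expectedObj_le_globalMin hsum hc hp (hmem _).1), ?_⟩
    have h2 := errSample_add_deviation_le hd ht hf (K := K) (hmem fun i => ks (.inl i)).2 δ
    rw [mul_add]
    simp only [hdev] at g3
    linarith
  · rw [← ENNReal.ofReal_add (by linarith) (by linarith),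
      ← ENNReal.ofReal_add (by linarith) (by linarith)]
    exact ENNReal.ofReal_le_ofReal (by linarith)

end

end FourierPSD

theorem corollary5 (d : ℕ) (hd : 1 ≤ d) (m : ℝ) (hm : (d : ℝ) / 2 < m)
    (f : (Fin d → ℝ) → ℝ)
    (hf : ContDiff ℝ (⌈m + (d : ℝ) / 2 + 2⌉₊ : ℕ) f) (hper : IsPeriodic f)
    (hfin : (minimizers f).Finite) (hhess : ∀ x ∈ minimizers f, HasPosHessian f x) :
    -- the constant `C` depends on `f`, `m` and `d` only
    ∃ C : ℝ, ∀ t : ℕ, 1 ≤ t →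
      -- a priori guarantee
      (∀ (R : ℝ) (Astar : BandMatrix d t), IsMaximizer f Astar → frobNorm Astar ≤ R →
        ∀ D : (Fin d → ℤ) → BandMatrix d t → BandMatrix d t, IsSupergradient f D →
        ∀ G : ℝ, (∀ k, frobNorm (featCoeff d t k) / prob d t k ≤ G) →
          G ≤ ∑' k : Fin d → ℤ, weight d t k →
        ∀ T K : ℕ, 1 ≤ T → 1 ≤ K → ∀ δ : ℝ, 0 < δ → δ < 1 →
        ∀ (Ω : Type*) [MeasurableSpace Ω] (P : Measure Ω) [IsProbabilityMeasure P]
          (κ : Fin T ⊕ Fin K → Ω → (Fin d → ℤ)), IsIIDSample t P κ →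
        1 - 2 * δ ≤ P.real {ω |
          let Abar : BandMatrix d t :=
            sgaOutput D R (R / (G * √(T : ℝ))) (fun i => κ (Sum.inl i) ω)
          let chat : ℝ := lowerSample f δ (fun i => κ (Sum.inr i) ω) Abar
          chat ≤ globalMin f ∧
          globalMin f - C * (t : ℝ) ^ (-m)
            - 8 ^ d * ((band d t).card : ℝ) * (t : ℝ) ^ d *
              (20 * R * Real.log (2 / δ) / √(T : ℝ)
                + 2 * (√((d : ℝ) + 1) * CNorm (d + 1) f + R) * √(2 * Real.log (2 / δ))
                  / √(K : ℝ)) ≤ chat}) ∧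
      -- a posteriori guarantees
      (∀ x : Fin d → ℝ, ∀ A : BandMatrix d t, A.PosSemidef →
        (∀ K : ℕ, globalMin f ≤ f x ∧ lowerDet f K A ≤ globalMin f) ∧
        (∀ K : ℕ, 1 ≤ K → ∀ δ : ℝ, 0 < δ → δ < 1 →
          ∀ (Ω : Type*) [MeasurableSpace Ω] (P : Measure Ω) [IsProbabilityMeasure P]
            (κ : Fin K → Ω → (Fin d → ℤ)), IsIIDSample t P κ →
          1 - δ ≤ P.real {ω |
            globalMin f ≤ f x ∧ lowerSample f δ (fun i => κ i ω) A ≤ globalMin f})) := by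
  have hp : LatticePeriodic f := hper
  have hN : m + (d : ℝ) / 2 + 2 ≤ (⌈m + (d : ℝ) / 2 + 2⌉₊ : ℝ) := Nat.le_ceil _
  have hd2 : (0 : ℝ) ≤ (d : ℝ) / 2 := by positivity
  -- the smoothness `N` is at least `d + 3`, since `m > d/2`
  have hNd : d + 2 < ⌈m + (d : ℝ) / 2 + 2⌉₊ := by
    have : ((d + 2 : ℕ) : ℝ) < (⌈m + (d : ℝ) / 2 + 2⌉₊ : ℝ) := by push_cast; linarith
    exact_mod_cast this
  obtain ⟨s, hs⟩ : ∃ s : ℕ, ⌈m + (d : ℝ) / 2 + 2⌉₊ = s + 2 :=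
    ⟨⌈m + (d : ℝ) / 2 + 2⌉₊ - 2, by omega⟩
  rw [hs] at hf hN hNd
  push_cast at hN
  have hf1 : ContDiff ℝ (d + 1 : ℕ) f := hf.of_le (by exact_mod_cast (by omega : d + 1 ≤ s + 2))
  have hc := hf.continuous
  have hsum := summable_fcoeff hd (s := d + 1) (by omega) hf1 hp
  obtain ⟨C, hC⟩ := exists_relaxObj_ge hd (by linarith) (by linarith) hf hp hfin hhess
  refine ⟨C, fun t ht => ⟨?_, ?_⟩⟩
  · intro R Astar hmax hAR D hD G hG hGS T K hT hK δ h0 h1 Ω _ P _ κ hκ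
    exact one_sub_le_measureReal_sgaOutput hd ht hf1 hp hsum (hC t ht) hmax hAR hD hG hGS hT hK
      h0 h1 hκ
  · intro x A hA
    refine ⟨fun K => ⟨globalMin_le hc hp x, (lowerDet_le_expectedObj hd hsum K A).trans
      (expectedObj_le_globalMin hsum hc hp hA)⟩, ?_⟩
    intro K hK δ h0 h1 Ω _ P _ κ hκ
    exact one_sub_le_measureReal_lowerSample_le hd ht hf1 hp hsum hA hK h0 h1 hκ x
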